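/- Manifolds and Lie groups are Hausdorff, smooth and modelled on (possibly infinite-dimensional) Hausdorff locally convex real vector spaces; smoothness is understood in the sense of Michal–Bastiani. Let $(M,\omega)$ be a connected symplectic manifold ($\omega$ a smooth, closed, weakly non-degenerate $2$-form) and let $G$, $G^*$ be Lie groups with Lie algebras $\mathfrak g$, $\mathfrak g^*$ which form a dual pair $\kappa(G,G^*)$, i.e. $\kappa:\mathfrak g\times\mathfrak g^*\to\mathbb R$ is a weakly non-degenerate bilinear map ($\mathfrak g^*$ need not be the functional analytic dual of $\mathfrak g$). If $G^*$ is infinite-dimensional, assume that it is regular: for every $c\in C^\infty([0,1],\mathfrak g^*)$ the problem $\delta\eta=c$, $\eta(0)=e$ has a solution $\eta_c\in C^\infty([0,1],G^*)$, and $c\mapsto\eta_c(1)$ is smooth. Here $\delta$ denotes the left logarithmic derivative, $\delta_m f=L_{f(m)^{-1}}\circ T_m f$. Let $G$ act smoothly from the left on $M$ in a $G^*$-symplectic way: there is a smooth $1$-form $\alpha\in\Omega^1(M,\mathfrak g^*)$ with $$\kappa(A,\alpha_m(X))=\omega_m(X,A^*_m)\qquad (A\in\mathfrak g,\ m\in M,\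 X\in T_mM),$$ where $A^*$ is the fundamental vector field of $A$, i.e. $A^*_m$ is the image of $A$ under the tangent map at $e$ of $g\mapsto g\cdot m$, and $\alpha$ satisfies the Maurer–Cartan equation $d\alpha+\tfrac12[\alpha\wedge\alpha]=0$. A $G^*$-valued momentum map is a smooth map $J:M\to G^*$ such that $\omega(A^*,\cdot)+\kappa(A,\delta J)=0$ for all $A\in\mathfrak g$. Let $m_0\in M$. Then: 1. There is a unique group homomorphism $\mathrm{per}_\alpha:\pi_1(M,m_0)\to G^*$ (the period homomorphism) such that for every piecewise smooth loop $\gamma:[0,1]\to M$ based at $m_0$ the problem $\delta\eta=\gamma^*\alpha$, $\eta(0)=e$ has a continuous, piecewise smooth solution $\eta_\gamma:[0,1]\to G^*$, and $\mathrm{per}_\alpha([\gamma])=\eta_\gamma(1)$ for every such solution. (The product $[\gamma][\gamma']$ in $\pi_1(M,m_0)$ is the class of $\gamma$ followed by $\gamma'$.) 2. A $G^*$-valued momentum map exists if and only if $\mathrm{per}_\alpha$ is trivial. 3. If $J$ is a $G^*$-valued momentum map, then a map $J':M\to G^*$ is a $G^*$-valued momentum map if and only if there is $h\in G^*$ with $J'(m)=h\,J(m)$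 for all $m\in M$. -/

import Mathlib

open Set Filter
open scoped Topology unitInterval

noncomputable section

namespace LCGeometry

/-! ### Differential calculus in locally convex spaces -/

section Calculus

/-- `f` has directional derivative `y` at `x` in the direction `v`:
`(f (x + t v) - f x) / t → y` as `t → 0`, `t ≠ 0`. -/
def HasDirDeriv {E F : Type*} [AddCommGroup E] [Module ℝ E]
    [AddCommGroup F] [Module ℝ F] [TopologicalSpace F]
    (f : E → F) (y : F) (x v : E) : Prop :=
  Tendsto (fun t : ℝ => t⁻¹ • (f (x + t • v) - f x)) (𝓝[≠] 0) (𝓝 y)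

/-- The directional derivative `df(x)(v)`; it is meaningful where it exists. -/
def dirDeriv {E F : Type*} [AddCommGroup E] [Module ℝ E]
    [AddCommGroup F] [Module ℝ F] [TopologicalSpace F]
    (f : E → F) (x v : E) : F :=
  limUnder (𝓝[≠] (0 : ℝ)) (fun t : ℝ => t⁻¹ • (f (x + t • v) - f x))

universe u v

/-- Maps of class `C^k` on an (open) set `U`, in the sense of Michal and Bastiani: `f` is `C^0` if it
is continuous on `U`, and `C^(k+1)` if it is continuous on `U`, has directional derivatives
`df(x)(v)` at all points `x` of `U` in all directions `v`, and `df` is `C^k` on `U × E`. -/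
def CkOn {F : Type v} [AddCommGroup F] [Module ℝ F] [TopologicalSpace F] :
    ℕ → ∀ {E : Type u} [AddCommGroup E] [Module ℝ E] [TopologicalSpace E],
      (E → F) → Set E → Prop
  | 0, _, _, _, _, f, U => ContinuousOn f U
  | k + 1, E, _, _, _, f, U => ContinuousOn f U ∧
      ∃ f' : E × E → F, (∀ x ∈ U, ∀ v : E, HasDirDeriv f (f' (x, v)) x v) ∧
        CkOn k f' (U ×ˢ (univ : Set E))

/-- Smooth maps on an (open) subset of a locally convex space. -/
def SmoothOn {E F : Type*} [AddCommGroup E] [Module ℝ E] [TopologicalSpace E]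
    [AddCommGroup F] [Module ℝ F] [TopologicalSpace F] (f : E → F) (U : Set E) : Prop :=
  ∀ k : ℕ, CkOn k f U

/-- `y` is the derivative at `t` of the curve `c` restricted to `s ⊆ ℝ` (one-sided at the endpoints
of an interval). -/
def HasCurveDeriv {V : Type*} [AddCommGroup V] [Module ℝ V] [TopologicalSpace V]
    (c : ℝ → V) (y : V) (s : Set ℝ) (t : ℝ) : Prop :=
  Tendsto (fun r : ℝ => (r - t)⁻¹ • (c r - c t)) (𝓝[s \ {t}] t) (𝓝 y)

/-- The curve `c` restricted to `s` is smooth: it has derivatives of all orders on `s`. Here `s` is a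
relatively open subset of an interval of positive length. -/
def SmoothCurveIn {V : Type*} [AddCommGroup V] [Module ℝ V] [TopologicalSpace V]
    (c : ℝ → V) (s : Set ℝ) : Prop :=
  ∃ d : ℕ → ℝ → V, d 0 = c ∧ ∀ k, ∀ t ∈ s, HasCurveDeriv (d k) (d (k + 1) t) s t

end Calculus

/-! ### The space `C^∞([0,1], V)` -/

section CurveSpace

variable (V : Type*) [AddCommGroup V] [Module ℝ V] [TopologicalSpace V]
  [IsTopologicalAddGroup V] [ContinuousSMul ℝ V]

/-- The space `C^∞([0,1], V)`. A smooth curve `c` is encoded by the sequence of its derivatives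
`c, c', c'', …` (which `c` determines), so that the topology induced from the product of the spaces
`C([0,1], V)` is the topology of uniform convergence of all derivatives. -/
def SmoothCurves : Submodule ℝ (ℕ → C(I, V)) where
  carrier := {c | ∀ k, ∀ t : I, Tendsto (fun r : I => ((r : ℝ) - t)⁻¹ • (c k r - c k t))
    (𝓝[≠] t) (𝓝 (c (k + 1) t))}
  add_mem' := by
    intro a b ha hb k t
    refine ((ha k t).add (hb k t)).congr fun r => ?_
    simp only [Pi.add_apply, ContinuousMap.add_apply, ← smul_add]
    congr 1
    abel
  zero_mem' := by
    intro k t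
    simpa using tendsto_const_nhds
  smul_mem' := by
    intro r a ha k t
    refine ((ha k t).const_smul r).congr fun s => ?_
    simp only [Pi.smul_apply, ContinuousMap.smul_apply, ← smul_sub]
    rw [smul_comm]

end CurveSpace

/-! ### Manifolds modelled on locally convex spaces -/

section Manifolds

/-- `M` is a smooth manifold modelled on `E`: the changes of charts are smooth. -/
class LCManifold (E M : Type*) [AddCommGroup E] [Module ℝ E] [TopologicalSpace E]
    [TopologicalSpace M] [ChartedSpace E M] : Prop where
  compat : ∀ e ∈ atlas E M, ∀ e' ∈ atlas E M, SmoothOn (e' ∘ e.symm) (e.symm.trans e').source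

/-- A map is smooth with respect to atlases `𝒜` and `ℬ` if it is continuous and all its local
representatives are smooth. -/
def SmoothBetween {E F M N : Type*} [AddCommGroup E] [Module ℝ E] [TopologicalSpace E]
    [AddCommGroup F] [Module ℝ F] [TopologicalSpace F] [TopologicalSpace M] [TopologicalSpace N]
    (𝒜 : Set (OpenPartialHomeomorph M E)) (ℬ : Set (OpenPartialHomeomorph N F))
    (f : M → N) : Prop :=
  Continuous f ∧ ∀ e ∈ 𝒜, ∀ e' ∈ ℬ,
    SmoothOn (e' ∘ f ∘ e.symm) (e.target ∩ e.symm ⁻¹' (f ⁻¹' e'.source))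

/-- The product charts on `M × N`. -/
def prodAtlas (E M F N : Type*) [TopologicalSpace E] [TopologicalSpace M] [ChartedSpace E M]
    [TopologicalSpace F] [TopologicalSpace N] [ChartedSpace F N] :
    Set (OpenPartialHomeomorph (M × N) (E × F)) :=
  Set.image2 OpenPartialHomeomorph.prod (atlas E M) (atlas F N)

/-- `G` is a Lie group modelled on the locally convex space `𝔤`. -/
class LCLieGroup (𝔤 G : Type*) [AddCommGroup 𝔤] [Module ℝ 𝔤] [TopologicalSpace 𝔤]
    [TopologicalSpace G] [ChartedSpace 𝔤 G] [Group G] : Prop extends LCManifold 𝔤 G where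
  smooth_mul : SmoothBetween (prodAtlas 𝔤 G 𝔤 G) (atlas 𝔤 G) (fun p : G × G => p.1 * p.2)
  smooth_inv : SmoothBetween (atlas 𝔤 G) (atlas 𝔤 G) (fun g : G => g⁻¹)

variable (E F : Type*) {M N : Type*} [AddCommGroup E] [Module ℝ E] [TopologicalSpace E]
  [AddCommGroup F] [Module ℝ F] [TopologicalSpace F]
  [TopologicalSpace M] [ChartedSpace E M] [TopologicalSpace N] [ChartedSpace F N]

/-- The tangent map `T_m f : T_m M → T_(f m) N`. The tangent space `T_m M` at `m` is identified with
the model space `E` by means of the chart `chartAt E m`, for every `m`. -/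
def tangentMap (f : M → N) (m : M) (v : E) : F :=
  dirDeriv (chartAt F (f m) ∘ f ∘ (chartAt E m).symm) (chartAt E m m) v

variable {E} in
/-- The tangent vector at `e.symm x` that is represented by `v` in the chart `e`. -/
def tangentOfChart (e : OpenPartialHomeomorph M E) (x v : E) : E :=
  dirDeriv (chartAt E (e.symm x) ∘ e.symm) x v

/-- A curve in `M`, restricted to `s ⊆ ℝ`, is smooth. -/
def SmoothCurve (γ : ℝ → M) (s : Set ℝ) : Prop :=
  ContinuousOn γ s ∧ ∀ e ∈ atlas E M, SmoothCurveIn (e ∘ γ) (s ∩ γ ⁻¹' e.source)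

/-- The velocity `γ'(t) ∈ T_(γ t) M` of the curve `γ` restricted to `s`. -/
def velocity (γ : ℝ → M) (s : Set ℝ) (t : ℝ) : E :=
  limUnder (𝓝[s \ {t}] t)
    (fun r : ℝ => (r - t)⁻¹ • (chartAt E (γ t) (γ r) - chartAt E (γ t) (γ t)))

/-- A curve `[0,1] → M` is piecewise smooth: it is continuous and there is a finite set of break
points such that it is smooth on every interval `[a, b] ⊆ [0,1]` without break points inside. -/
def PiecewiseSmooth (γ : ℝ → M) : Prop :=
  ContinuousOn γ (Icc 0 1) ∧ ∃ S : Finset ℝ, ∀ a b : ℝ, 0 ≤ a → a < b → b ≤ 1 →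
    Disjoint (Ioo a b) (S : Set ℝ) → SmoothCurve E γ (Icc a b)

end Manifolds

/-! ### Differential forms -/

section Forms

/-- A smooth `V`-valued 1-form on `M`: its representatives `e.target × E → V` in the charts `e` are
smooth. -/
structure OneForm (E M V : Type*) [AddCommGroup E] [Module ℝ E] [TopologicalSpace E]
    [TopologicalSpace M] [ChartedSpace E M]
    [AddCommGroup V] [Module ℝ V] [TopologicalSpace V] where
  toFun : M → E →ₗ[ℝ] V
  smooth : ∀ e ∈ atlas E M,
    SmoothOn (fun p : E × E => toFun (e.symm p.1) (tangentOfChart e p.1 p.2))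
      (e.target ×ˢ (univ : Set E))

/-- A smooth real-valued 2-form on `M`. -/
structure TwoForm (E M : Type*) [AddCommGroup E] [Module ℝ E] [TopologicalSpace E]
    [TopologicalSpace M] [ChartedSpace E M] where
  toFun : M → E →ₗ[ℝ] E →ₗ[ℝ] ℝ
  alternating : ∀ m v, toFun m v v = 0
  smooth : ∀ e ∈ atlas E M,
    SmoothOn (fun p : E × (E × E) => toFun (e.symm p.1)
        (tangentOfChart e p.1 p.2.1) (tangentOfChart e p.1 p.2.2))
      (e.target ×ˢ (univ : Set (E × E)))

variable {E M V : Type*} [AddCommGroup E] [Module ℝ E] [TopologicalSpace E]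
  [TopologicalSpace M] [ChartedSpace E M] [AddCommGroup V] [Module ℝ V] [TopologicalSpace V]

/-- The representative of a 1-form in a chart. -/
def OneForm.rep (α : OneForm E M V) (e : OpenPartialHomeomorph M E) (x v : E) : V :=
  α.toFun (e.symm x) (tangentOfChart e x v)

/-- The representative of a 2-form in a chart. -/
def TwoForm.rep (ω : TwoForm E M) (e : OpenPartialHomeomorph M E) (x v w : E) : ℝ :=
  ω.toFun (e.symm x) (tangentOfChart e x v) (tangentOfChart e x w)

/-- The exterior derivative of a 1-form, `dα(X, Y) = X α(Y) - Y α(X) - α([X, Y])`, computed with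
fields that are constant in the chart `chartAt E m`. -/
def OneForm.extDeriv (α : OneForm E M V) (m : M) (v w : E) : V :=
  dirDeriv (fun x => α.rep (chartAt E m) x w) (chartAt E m m) v
    - dirDeriv (fun x => α.rep (chartAt E m) x v) (chartAt E m m) w

/-- The exterior derivative of a 2-form, computed with fields that are constant in the chart
`chartAt E m`. -/
def TwoForm.extDeriv (ω : TwoForm E M) (m : M) (u v w : E) : ℝ :=
  dirDeriv (fun x => ω.rep (chartAt E m) x v w) (chartAt E m m) u
    - dirDeriv (fun x => ω.rep (chartAt E m) x u w) (chartAt E m m) v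
    + dirDeriv (fun x => ω.rep (chartAt E m) x u v) (chartAt E m m) w

/-- A symplectic form: a closed, (weakly) non-degenerate 2-form. -/
def TwoForm.IsSymplectic (ω : TwoForm E M) : Prop :=
  (∀ m u v w, ω.extDeriv m u v w = 0) ∧ ∀ m v, (∀ w, ω.toFun m v w = 0) → v = 0

end Forms

/-! ### Lie groups: Lie bracket, logarithmic derivatives, regularity -/

section LieGroups

variable (E 𝔥 : Type*) {M H : Type*} [AddCommGroup E] [Module ℝ E] [TopologicalSpace E]
  [TopologicalSpace M] [ChartedSpace E M]
  [AddCommGroup 𝔥] [Module ℝ 𝔥] [TopologicalSpace 𝔥]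
  [TopologicalSpace H] [ChartedSpace 𝔥 H] [Group H]

variable {𝔥} (H) in
/-- The representative of the left invariant vector field generated by `B ∈ T_1 H = 𝔥` in the chart
`chartAt 𝔥 1`. -/
def leftInvariantRep (B x : 𝔥) : 𝔥 :=
  dirDeriv (fun y => chartAt 𝔥 (1 : H) ((chartAt 𝔥 (1 : H)).symm x * (chartAt 𝔥 (1 : H)).symm y))
    (chartAt 𝔥 (1 : H) 1) B

variable {𝔥} (H) in
/-- The Lie bracket on the Lie algebra `T_1 H = 𝔥` of `H`: the value at `1` of the bracket of the
left invariant vector fields. -/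
def lieBracket (A B : 𝔥) : 𝔥 :=
  dirDeriv (leftInvariantRep H B) (chartAt 𝔥 (1 : H) 1) A
    - dirDeriv (leftInvariantRep H A) (chartAt 𝔥 (1 : H) 1) B

/-- Left translation of tangent vectors at `h` to the Lie algebra, `T_h H → T_1 H = 𝔥`. -/
def leftTranslateToOne (h : H) (v : 𝔥) : 𝔥 :=
  tangentMap 𝔥 𝔥 (fun k : H => h⁻¹ * k) h v

/-- The left logarithmic derivative `δJ` of a map `J : M → H`. -/
def logDeriv (J : M → H) (m : M) (v : E) : 𝔥 :=
  leftTranslateToOne 𝔥 (J m) (tangentMap E 𝔥 J m v)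

/-- The left logarithmic derivative of the curve `η` restricted to `s ⊆ ℝ`. -/
def curveLogDeriv (η : ℝ → H) (s : Set ℝ) (t : ℝ) : 𝔥 :=
  leftTranslateToOne 𝔥 (η t) (velocity 𝔥 η s t)

variable (H) in
/-- Regular Lie groups: every initial value problem `δη = c`, `η(0) = 1` with `c ∈ C^∞([0,1], 𝔥)` has
a smooth solution `η_c` on `[0,1]`, and `c ↦ η_c(1)` is a smooth map `C^∞([0,1], 𝔥) → H`. -/
def IsRegular [IsTopologicalAddGroup 𝔥] [ContinuousSMul ℝ 𝔥] : Prop :=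
  ∃ evol : SmoothCurves 𝔥 → H,
    SmoothBetween (atlas (SmoothCurves 𝔥) (SmoothCurves 𝔥)) (atlas 𝔥 H) evol ∧
    ∀ c : SmoothCurves 𝔥, ∃ η : ℝ → H, SmoothCurve 𝔥 η (Icc 0 1) ∧ η 0 = 1 ∧
      (∀ t : I, curveLogDeriv 𝔥 η (Icc 0 1) t = (c : ℕ → C(I, 𝔥)) 0 t) ∧ η 1 = evol c

variable {E 𝔥}

variable (H) in
/-- The wedge product `[α ∧ β]` of 1-forms with values in the Lie algebra of `H`. -/
def wedgeBracket (α β : OneForm E M 𝔥) (m : M) (v w : E) : 𝔥 :=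
  lieBracket H (α.toFun m v) (β.toFun m w) - lieBracket H (α.toFun m w) (β.toFun m v)

variable (H) in
/-- The Maurer–Cartan equation `dα + 1/2 [α ∧ α] = 0`. -/
def MaurerCartan (α : OneForm E M 𝔥) : Prop :=
  ∀ m v w, α.extDeriv m v w + (1 / 2 : ℝ) • wedgeBracket H α α m v w = 0

/-- `η : [0,1] → H` is the solution of the initial value problem `δη = γ^* α`, `η(0) = 1` along the
piecewise smooth curve `γ : [0,1] → M`: `η` is continuous, and on every interval `[a, b] ⊆ [0,1]`
without break points inside, `γ` and `η` are smooth and the equation holds. -/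
def SolvesLogIVP (α : OneForm E M 𝔥) (γ : ℝ → M) (η : ℝ → H) : Prop :=
  ContinuousOn η (Icc 0 1) ∧ η 0 = 1 ∧
    ∃ S : Finset ℝ, ∀ a b : ℝ, 0 ≤ a → a < b → b ≤ 1 → Disjoint (Ioo a b) (S : Set ℝ) →
      SmoothCurve E γ (Icc a b) ∧ SmoothCurve 𝔥 η (Icc a b) ∧
      ∀ t ∈ Icc a b, curveLogDeriv 𝔥 η (Icc a b) t = α.toFun (γ t) (velocity E γ (Icc a b) t)

/-- `per` is the period homomorphism of `α`: for every piecewise smooth loop `γ` at `m₀` the problem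
`δη = γ^* α`, `η(0) = 1` can be solved, and `per [γ] = η(1)` for its solution.

In Mathlib the product `p * q` in `FundamentalGroup M m₀` is the class of the loop `q` followed by
the loop `p`; its opposite is the fundamental group with the product `[γ] [γ'] = [γ followed by γ']`
used here. -/
def IsPeriodHom (α : OneForm E M 𝔥) (m₀ : M) (per : (FundamentalGroup M m₀)ᵐᵒᵖ →* H) : Prop :=
  ∀ γ : Path m₀ m₀, PiecewiseSmooth E γ.extend →
    (∃ η : ℝ → H, SolvesLogIVP α γ.extend η) ∧
    ∀ η : ℝ → H, SolvesLogIVP α γ.extend η →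
      per (MulOpposite.op (FundamentalGroup.fromPath (Path.Homotopic.Quotient.mk γ))) = η 1

end LieGroups

/-! ### Group actions and momentum maps -/

section MomentumMaps

variable {E M 𝔤 𝔥 : Type*} (G H : Type*) [AddCommGroup E] [Module ℝ E] [TopologicalSpace E]
  [TopologicalSpace M] [ChartedSpace E M]
  [AddCommGroup 𝔤] [Module ℝ 𝔤] [TopologicalSpace 𝔤]
  [TopologicalSpace G] [ChartedSpace 𝔤 G] [Group G] [MulAction G M]
  [AddCommGroup 𝔥] [Module ℝ 𝔥] [TopologicalSpace 𝔥]
  [TopologicalSpace H] [ChartedSpace 𝔥 H] [Group H]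

variable (E) in
/-- The fundamental vector field of `A ∈ T_1 G = 𝔤` at `m`: the image of `A` under the tangent map at
`1` of the orbit map `g ↦ g • m`. -/
def fundamentalField (A : 𝔤) (m : M) : E :=
  tangentMap 𝔤 E (fun g : G => g • m) 1 A

variable {H} in
/-- `J` is an `H`-valued momentum map: `J` is smooth and `A^* ⌟ ω + κ(A, δJ) = 0` for all `A`. -/
def IsMomentumMap (ω : TwoForm E M) (κ : 𝔤 →ₗ[ℝ] 𝔥 →ₗ[ℝ] ℝ) (J : M → H) : Prop :=
  SmoothBetween (atlas E M) (atlas 𝔥 H) J ∧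
    ∀ (A : 𝔤) (m : M) (v : E),
      ω.toFun m (fundamentalField E G A m) v + κ A (logDeriv E 𝔥 J m v) = 0

/-- The action is `H`-symplectic, with associated form `α`: the form `α` satisfies
`A^* ⌟ ω + κ(A, α) = 0` for all `A`, that is `κ(A, α(X)) = ω(X, A^*)`, and the Maurer–Cartan
equation. -/
def IsDualSymplectic (ω : TwoForm E M) (κ : 𝔤 →ₗ[ℝ] 𝔥 →ₗ[ℝ] ℝ) (α : OneForm E M 𝔥) : Prop :=
  (∀ (A : 𝔤) (m : M) (v : E), κ A (α.toFun m v) = ω.toFun m v (fundamentalField E G A m)) ∧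
    MaurerCartan H α

end MomentumMaps

end LCGeometry

end

set_option linter.unusedSectionVars false

noncomputable section

namespace LCGeometry

/-! ### Mean value theorem in locally convex spaces -/

section MeanValue

variable {V : Type*} [AddCommGroup V] [Module ℝ V] [TopologicalSpace V]
  [IsTopologicalAddGroup V] [ContinuousSMul ℝ V]

/-! Non-degeneracy of `κ` turns the momentum equation, required for all `A`, into the single
equation `δJ = α` (`IsDualSymplectic.isMomentumMap_iff`). The action and the symplectic form then
disappear, and what remains is the fundamental theorem of calculus for an `H`-valued Maurer–Cartan
form on a connected manifold: when does `α` have a primitive, and how many?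

Uniqueness: if two curves in `H` have the same left logarithmic derivative, then `η₁ η₂⁻¹` has
logarithmic derivative zero and is constant (`div_eq_of_hasCurveLog`). Hence primitives are locally
unique up to a left factor. The analytic input is a mean value theorem obtained from Hahn–Banach,
which needs neither completeness nor a norm.

Local existence (`exists_local_primitive`) has two sources. If `H` is regular, let `F x` be the
endpoint of the solution of `δη = a` along the ray from `x₀` to `x`. The evolution map makes `F`
smooth, and rescaling rays shows that `F` has the right logarithmic derivative in the radial
direction. The defect in the other directions, multiplied by `t`, solves the linear equation `d' =
-[a, d]` with `d 0 = 0` and vanishes, with `Ad` as integrating factor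
(`SmoothInto.logD_eq_of_radial`). If `𝔥` is finite-dimensional, the equation in the chart at `1` is
a total differential equation whose integrability condition is Maurer–Cartan, and Frobenius' theorem
is proved from Picard–Lindelöf and Gronwall (`exists_total_solution`).

Globalization: germs of primitives form a covering of `M` with fibre the discrete set `H`. Lifting a
path `γ` and evaluating gives a transport `Θ γ` that is multiplicative and invariant under homotopy
(`exists_isTransport`, `IsTransport.trans`). Its value at `1` on loops is the period homomorphism;
it solves the initial value problem along piecewise smooth loops, and such loops represent every
class, which makes the homomorphism unique. If all periods are trivial, `Θ γ 1` depends only on the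
endpoint of `γ` and defines a global primitive; conversely a global primitive forces trivial
periods. -/

theorem HasCurveDeriv.hasDerivWithinAt_clm {c : ℝ → V} {y : V} {s : Set ℝ} {t : ℝ}
    (h : HasCurveDeriv c y s t) (φ : V →L[ℝ] ℝ) :
    HasDerivWithinAt (fun r => φ (c r)) (φ y) s t := by
  rw [hasDerivWithinAt_iff_tendsto_slope]
  refine ((φ.continuous.tendsto y).comp h).congr fun r => ?_
  simp [slope]

/-- If the slope were outside `C`, a functional `φ` would separate it strictly from `C`; the scalar
mean value theorem for `φ ∘ c` yields a derivative on the wrong side. This replaces integral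
estimates throughout. -/
theorem slope_mem_of_hasCurveDeriv_mem [LocallyConvexSpace ℝ V] {c d : ℝ → V} {a b : ℝ}
    (hab : a < b) {C : Set V} (hC : Convex ℝ C) (hC' : IsClosed C)
    (hd : ∀ t ∈ Icc a b, HasCurveDeriv c (d t) (Icc a b) t) (hdC : ∀ t ∈ Icc a b, d t ∈ C) :
    (b - a)⁻¹ • (c b - c a) ∈ C := by
  by_contra hn
  obtain ⟨φ, u, h1, h2⟩ := geometric_hahn_banach_point_closed hC hC' hn
  have hder := fun t ht => (hd t ht).hasDerivWithinAt_clm φ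
  obtain ⟨t, ht, hslope⟩ := exists_hasDerivAt_eq_slope (fun r => φ (c r)) (fun r => φ (d r)) hab
    (fun t ht => (hder t ht).continuousWithinAt)
    (fun t ht => (hder t (Ioo_subset_Icc_self ht)).hasDerivAt (Icc_mem_nhds ht.1 ht.2))
  have := h2 _ (hdC t (Ioo_subset_Icc_self ht))
  rw [hslope] at this
  rw [map_smul, map_sub, smul_eq_mul, mul_comm, ← div_eq_mul_inv] at h1
  exact lt_asymm h1 this

theorem eq_of_hasCurveDeriv_zero [LocallyConvexSpace ℝ V] [T2Space V] {c : ℝ → V} {a b : ℝ}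
    (hd : ∀ t ∈ Icc a b, HasCurveDeriv c 0 (Icc a b) t) (hab : a ≤ b) : c b = c a := by
  rcases hab.eq_or_lt with rfl | hab
  · rfl
  have := slope_mem_of_hasCurveDeriv_mem hab (convex_singleton (0 : V)) isClosed_singleton hd
    (fun _ _ => rfl)
  rw [mem_singleton_iff, smul_eq_zero, inv_eq_zero, sub_eq_zero, sub_eq_zero] at this
  rcases this with h | h
  · exact absurd h hab.ne'
  · exact h

theorem exists_closed_convex_nhds [LocallyConvexSpace ℝ V] {x : V} {N : Set V}
    (hN : N ∈ 𝓝 x) : ∃ C ∈ 𝓝 x, Convex ℝ C ∧ IsClosed C ∧ C ⊆ N := by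
  obtain ⟨N', hN', hcl, hsub⟩ := exists_mem_nhds_isClosed_subset hN
  obtain ⟨C, ⟨hC, hconv⟩, hCN⟩ := (LocallyConvexSpace.convex_basis (𝕜 := ℝ) x).mem_iff.1 hN'
  exact ⟨closure C, mem_of_superset hC subset_closure, hconv.closure, isClosed_closure,
    (closure_minimal hCN hcl).trans hsub⟩

end MeanValue

/-! ### Maps of class `C^k` -/

universe u v w

/-! ### Elementary rules for directional derivatives. -/

section Basic

variable {E : Type*} [AddCommGroup E] [Module ℝ E] [TopologicalSpace E]
  [IsTopologicalAddGroup E] [ContinuousSMul ℝ E]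
  {F : Type*} [AddCommGroup F] [Module ℝ F] [TopologicalSpace F]

omit [TopologicalSpace E] [IsTopologicalAddGroup E] [ContinuousSMul ℝ E] in
theorem HasDirDeriv.dirDeriv_eq [T2Space F] {f : E → F} {y : F} {x v : E}
    (h : HasDirDeriv f y x v) : dirDeriv f x v = y :=
  Tendsto.limUnder_eq h

theorem tendsto_add_smul (x v : E) : Tendsto (fun t : ℝ => x + t • v) (𝓝 0) (𝓝 x) := by
  have : Continuous fun t : ℝ => x + t • v := by fun_prop
  simpa using this.tendsto 0

theorem HasDirDeriv.congr {f g : E → F} {y : F} {x v : E} (h : HasDirDeriv f y x v)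
    (hfg : f =ᶠ[𝓝 x] g) : HasDirDeriv g y x v := by
  refine Tendsto.congr' ?_ h
  filter_upwards [((tendsto_add_smul x v).mono_left nhdsWithin_le_nhds).eventually hfg] with t ht
  rw [ht, hfg.self_of_nhds]

theorem dirDeriv_congr {f g : E → F} {x : E} (hfg : f =ᶠ[𝓝 x] g) (v : E) :
    dirDeriv f x v = dirDeriv g x v := by
  unfold dirDeriv limUnder
  congr 1
  refine Filter.map_congr ?_
  filter_upwards [((tendsto_add_smul x v).mono_left nhdsWithin_le_nhds).eventually hfg] with t ht
  rw [ht, hfg.self_of_nhds]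

/-- The total derivative `(x, v) ↦ df(x)(v)`. -/
def tderiv (f : E → F) (p : E × E) : F := dirDeriv f p.1 p.2

omit [TopologicalSpace E] [IsTopologicalAddGroup E] [ContinuousSMul ℝ E] in
theorem hasDirDeriv_const (c : F) (x v : E) : HasDirDeriv (fun _ : E => c) 0 x v := by
  unfold HasDirDeriv
  simp only [sub_self, smul_zero]
  exact tendsto_const_nhds

theorem hasDirDeriv_clm {F : Type*} [AddCommGroup F] [Module ℝ F] [TopologicalSpace F]
    (f : E →L[ℝ] F) (x v : E) : HasDirDeriv f (f v) x v := by
  refine tendsto_const_nhds.congr' ?_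
  filter_upwards [self_mem_nhdsWithin] with t ht
  have ht : t ≠ 0 := ht
  simp [smul_smul, ht]

omit [TopologicalSpace E] [IsTopologicalAddGroup E] [ContinuousSMul ℝ E] in
theorem HasDirDeriv.prodMk {F' : Type*} [AddCommGroup F'] [Module ℝ F'] [TopologicalSpace F']
    {f : E → F} {g : E → F'} {y z} {x v : E} (hf : HasDirDeriv f y x v)
    (hg : HasDirDeriv g z x v) : HasDirDeriv (fun x => (f x, g x)) (y, z) x v := by
  unfold HasDirDeriv
  rw [nhds_prod_eq]
  exact Tendsto.prodMk hf hg

omit [TopologicalSpace E] [IsTopologicalAddGroup E] [ContinuousSMul ℝ E] in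
theorem hasDirDeriv_fst_iff {E' : Type*} [AddCommGroup E'] [Module ℝ E'] {f : E × E' → F} {y : F}
    {x v : E} {w : E'} :
    HasDirDeriv (fun z => f (z, w)) y x v ↔ HasDirDeriv f y (x, w) (v, 0) := by
  simp [HasDirDeriv]

omit [TopologicalSpace E] [IsTopologicalAddGroup E] [ContinuousSMul ℝ E] in
theorem dirDeriv_fst {E' : Type*} [AddCommGroup E'] [Module ℝ E'] (f : E × E' → F)
    (x v : E) (w : E') :
    dirDeriv (fun z => f (z, w)) x v = dirDeriv f (x, w) (v, 0) := by
  simp [dirDeriv]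

omit [TopologicalSpace E] [IsTopologicalAddGroup E] [ContinuousSMul ℝ E] in
theorem dirDeriv_snd {E' : Type*} [AddCommGroup E'] [Module ℝ E'] (f : E' × E → F)
    (x v : E) (w : E') :
    dirDeriv (fun z => f (w, z)) x v = dirDeriv f (w, x) (0, v) := by
  simp [dirDeriv]

end Basic

/-! ### Difference quotients with moving base point, direction and step. -/

section KeyLemma

variable {E : Type*} [AddCommGroup E] [Module ℝ E] [TopologicalSpace E]
  [IsTopologicalAddGroup E] [ContinuousSMul ℝ E]
  {F : Type*} [AddCommGroup F] [Module ℝ F] [TopologicalSpace F]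

theorem hasCurveDeriv_line {f : E → F} {y : F} {x v : E} {s : Set ℝ} {t : ℝ}
    (h : HasDirDeriv f y (x + t • v) v) : HasCurveDeriv (fun r => f (x + r • v)) y s t := by
  have h1 : Tendsto (fun r : ℝ => r - t) (𝓝[s \ {t}] t) (𝓝[≠] 0) := by
    refine tendsto_nhdsWithin_iff.2 ⟨?_, ?_⟩
    · have : Continuous fun r : ℝ => r - t := by fun_prop
      simpa using (this.tendsto t).mono_left nhdsWithin_le_nhds
    · filter_upwards [self_mem_nhdsWithin] with r hr
      exact sub_ne_zero.2 hr.2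
  refine (h.comp h1).congr fun r => ?_
  simp only [Function.comp]
  rw [add_assoc, ← add_smul, add_sub_cancel]

variable [IsTopologicalAddGroup F] [ContinuousSMul ℝ F]

/-- Normalizes a segment of step `t` to the parameter interval `[0,1]`, so that the mean value
theorem there speaks about the difference quotient itself. -/
theorem HasDirDeriv.line_smul {f : E → F} {y : F} {x v : E} {t : ℝ} (ht : t ≠ 0)
    (h : HasDirDeriv f y x v) : HasDirDeriv (fun z => t⁻¹ • f z) y x (t • v) := by
  have h1 : Tendsto (fun r : ℝ => r * t) (𝓝[≠] 0) (𝓝[≠] 0) := by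
    refine tendsto_nhdsWithin_iff.2 ⟨?_, ?_⟩
    · have : Continuous fun r : ℝ => r * t := by fun_prop
      simpa using (this.tendsto 0).mono_left nhdsWithin_le_nhds
    · filter_upwards [self_mem_nhdsWithin] with r hr
      exact mul_ne_zero hr ht
  refine (h.comp h1).congr fun r => ?_
  simp only [Function.comp, ← smul_sub, smul_smul, mul_inv]

variable [LocallyConvexSpace ℝ F]

/-- Near `(x, w)` the derivative takes values in a closed convex neighbourhood of its value at `(x,
w)`, and the mean value theorem carries this over to the quotients. The chain rule, additivity of
the derivative and the symmetry of second derivatives all rest on this convergence in all variables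
jointly. -/
theorem tendsto_slope_of_hasDirDeriv {f : E → F} {f' : E × E → F} {U : Set E} (hU : IsOpen U)
    (hd : ∀ x ∈ U, ∀ v, HasDirDeriv f (f' (x, v)) x v)
    {x w : E} (hx : x ∈ U) (hf' : ContinuousAt f' (x, w)) {ι : Type*} {l : Filter ι}
    {X W : ι → E} {T : ι → ℝ} (hX : Tendsto X l (𝓝 x)) (hW : Tendsto W l (𝓝 w))
    (hT : Tendsto T l (𝓝[≠] 0)) :
    Tendsto (fun i => (T i)⁻¹ • (f (X i + T i • W i) - f (X i))) l (𝓝 (f' (x, w))) := by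
  intro N hN
  obtain ⟨C, hC, hconv, hcl, hCN⟩ := exists_closed_convex_nhds hN
  -- At step `0` the whole segment collapses to `x`, so compactness of `[0,1]` gives one
  -- neighbourhood that works for all points of the segment.
  have key : ∀ᶠ q in 𝓝 (x, (0 : ℝ), w), ∀ r ∈ Icc (0 : ℝ) 1,
      q.1 + r • q.2.1 • q.2.2 ∈ U ∧ f' (q.1 + r • q.2.1 • q.2.2, q.2.2) ∈ C := by
    refine isCompact_Icc.eventually_forall_of_forall_eventually fun r _ => ?_
    have hc : Continuous fun p : (E × ℝ × E) × ℝ =>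
        (p.1.1 + p.2 • p.1.2.1 • p.1.2.2, p.1.2.2) := by fun_prop
    have ht := hc.tendsto ((x, (0 : ℝ), w), r)
    simp only [zero_smul, smul_zero, add_zero] at ht
    have h1 : ∀ᶠ q : E × E in 𝓝 (x, w), q.1 ∈ U :=
      (continuous_fst.tendsto _).eventually (hU.mem_nhds hx)
    have h2 : ∀ᶠ q : E × E in 𝓝 (x, w), f' q ∈ C := hf'.eventually hC
    exact ht.eventually (h1.and h2)
  rw [tendsto_nhdsWithin_iff] at hT
  have hlim : Tendsto (fun i => (X i, T i, W i)) l (𝓝 (x, (0 : ℝ), w)) := by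
    rw [nhds_prod_eq, nhds_prod_eq]
    exact hX.prodMk (hT.1.prodMk hW)
  rw [mem_map]
  filter_upwards [hlim.eventually key, hT.2] with i hi hne
  refine hCN ?_
  have hder : ∀ r ∈ Icc (0 : ℝ) 1, HasCurveDeriv (fun r => (T i)⁻¹ • f (X i + r • T i • W i))
      (f' (X i + r • T i • W i, W i)) (Icc 0 1) r := fun r hr =>
    hasCurveDeriv_line (f := fun z => (T i)⁻¹ • f z) ((hd _ (hi r hr).1 _).line_smul hne)
  have := slope_mem_of_hasCurveDeriv_mem zero_lt_one hconv hcl hder (fun r hr => (hi r hr).2)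
  rw [sub_zero, inv_one, one_smul, one_smul, zero_smul, add_zero, ← smul_sub] at this
  exact this

end KeyLemma

/-! ### Calculus of `C^k` maps. -/

section Ck

variable {E : Type u} [AddCommGroup E] [Module ℝ E] [TopologicalSpace E]
  {F : Type v} [AddCommGroup F] [Module ℝ F] [TopologicalSpace F]

theorem CkOn.continuousOn {k : ℕ} {f : E → F} {U : Set E} (h : CkOn k f U) : ContinuousOn f U := by
  cases k with
  | zero => exact h
  | succ k => exact h.1

theorem CkOn.mono {k : ℕ} : ∀ {E : Type u} [AddCommGroup E] [Module ℝ E] [TopologicalSpace E]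
    {f : E → F} {U V : Set E}, CkOn k f U → V ⊆ U → CkOn k f V := by
  induction k with
  | zero => intro E _ _ _ f U V h hVU; exact ContinuousOn.mono h hVU
  | succ k ih =>
    rintro E _ _ _ f U V ⟨h1, f', h2, h3⟩ hVU
    exact ⟨h1.mono hVU, f', fun x hx => h2 x (hVU hx), ih h3 (prod_mono hVU subset_rfl)⟩

theorem CkOn.of_succ {k : ℕ} : ∀ {E : Type u} [AddCommGroup E] [Module ℝ E] [TopologicalSpace E]
    {f : E → F} {U : Set E}, CkOn (k + 1) f U → CkOn k f U := by
  induction k with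
  | zero => intro E _ _ _ f U h; exact h.1
  | succ k ih =>
    rintro E _ _ _ f U ⟨h1, f', h2, h3⟩
    exact ⟨h1, f', h2, ih h3⟩

theorem CkOn.congr {k : ℕ} : ∀ {E : Type u} [AddCommGroup E] [Module ℝ E] [TopologicalSpace E]
    [IsTopologicalAddGroup E] [ContinuousSMul ℝ E]
    {f g : E → F} {U : Set E}, IsOpen U → CkOn k f U → EqOn f g U → CkOn k g U := by
  cases k with
  | zero => intro E _ _ _ _ _ f g U _ h hfg; exact ContinuousOn.congr h hfg.symm
  | succ k =>
    rintro E _ _ _ _ _ f g U hU ⟨h1, f', h2, h3⟩ hfg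
    exact ⟨h1.congr hfg.symm, f', fun x hx v => (h2 x hx v).congr
      (hfg.eventuallyEq_of_mem (hU.mem_nhds hx)), h3⟩

variable [IsTopologicalAddGroup E] [ContinuousSMul ℝ E]

/-- Limits are unique, so the existential derivative in the definition agrees on `U × E` with the
canonical `tderiv f`. This canonical choice is what lets local information be glued in
`CkOn.of_local`. -/
theorem ckOn_succ_iff [T2Space F] {k : ℕ} {f : E → F} {U : Set E} (hU : IsOpen U) :
    CkOn (k + 1) f U ↔ ContinuousOn f U ∧
      (∀ x ∈ U, ∀ v, HasDirDeriv f (tderiv f (x, v)) x v) ∧ CkOn k (tderiv f) (U ×ˢ univ) := by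
  constructor
  · rintro ⟨h1, f', h2, h3⟩
    have he : EqOn f' (tderiv f) (U ×ˢ univ) := fun p hp => ((h2 p.1 hp.1 p.2).dirDeriv_eq).symm
    refine ⟨h1, fun x hx v => ?_, h3.congr (hU.prod isOpen_univ) he⟩
    rw [← he (show (x, v) ∈ U ×ˢ univ from ⟨hx, trivial⟩)]
    exact h2 x hx v
  · rintro ⟨h1, h2, h3⟩
    exact ⟨h1, _, h2, h3⟩

theorem CkOn.of_local [T2Space F] {k : ℕ} : ∀ {E : Type u} [AddCommGroup E] [Module ℝ E]
    [TopologicalSpace E] [IsTopologicalAddGroup E] [ContinuousSMul ℝ E] {f : E → F} {U : Set E},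
    IsOpen U → (∀ x ∈ U, ∃ O, IsOpen O ∧ x ∈ O ∧ CkOn k f (U ∩ O)) → CkOn k f U := by
  induction k with
  | zero =>
    intro E _ _ _ _ _ f U hU h x hx
    obtain ⟨O, hO, hxO, hc⟩ := h x hx
    exact ((hc x ⟨hx, hxO⟩).continuousAt ((hU.inter hO).mem_nhds ⟨hx, hxO⟩)).continuousWithinAt
  | succ k ih =>
    intro E _ _ _ _ _ f U hU h
    rw [ckOn_succ_iff hU]
    refine ⟨fun x hx => ?_, fun x hx v => ?_, ih (hU.prod isOpen_univ) fun p hp => ?_⟩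
    · obtain ⟨O, hO, hxO, hc⟩ := h x hx
      exact ((hc.1 x ⟨hx, hxO⟩).continuousAt
        ((hU.inter hO).mem_nhds ⟨hx, hxO⟩)).continuousWithinAt
    · obtain ⟨O, hO, hxO, hc⟩ := h x hx
      rw [ckOn_succ_iff (hU.inter hO)] at hc
      exact hc.2.1 x ⟨hx, hxO⟩ v
    · obtain ⟨O, hO, hxO, hc⟩ := h p.1 hp.1
      rw [ckOn_succ_iff (hU.inter hO)] at hc
      exact ⟨O ×ˢ univ, hO.prod isOpen_univ, ⟨hxO, trivial⟩, hc.2.2.mono (by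
        rintro q ⟨⟨h1, _⟩, ⟨h2, _⟩⟩; exact ⟨⟨h1, h2⟩, trivial⟩)⟩

/-- The difference quotients of `g ∘ ℓ` are literally those of `g`, so neither an open `V` nor a
locally convex target is needed. The general composition theorem uses this to view `f` as a function
of `(x, v)`. -/
theorem CkOn.comp_clm {k : ℕ} : ∀ {E F : Type*} {G : Type w} [AddCommGroup E] [Module ℝ E]
    [TopologicalSpace E] [IsTopologicalAddGroup E] [ContinuousSMul ℝ E]
    [AddCommGroup F] [Module ℝ F] [TopologicalSpace F] [AddCommGroup G] [Module ℝ G]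
    [TopologicalSpace G] {g : F → G} {V : Set F} (_ : CkOn k g V) (ℓ : E →L[ℝ] F),
    CkOn k (g ∘ ℓ) (ℓ ⁻¹' V) := by
  induction k with
  | zero =>
    intro E F G _ _ _ _ _ _ _ _ _ _ _ g V h ℓ
    have h1 : ContinuousOn g V := h
    have h2 : ContinuousOn (g ∘ ℓ) (ℓ ⁻¹' V) :=
      h1.comp ℓ.continuous.continuousOn (mapsTo_preimage _ _)
    exact h2
  | succ k ih =>
    rintro E F G _ _ _ _ _ _ _ _ _ _ _ g V ⟨h1, g', h2, h3⟩ ℓ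
    refine ⟨h1.comp ℓ.continuous.continuousOn (mapsTo_preimage _ _),
      fun p => g' (ℓ p.1, ℓ p.2), fun x hx v => ?_, ?_⟩
    · refine Tendsto.congr (fun t => ?_) (h2 _ hx (ℓ v))
      simp
    · have h4 := (ih h3 (ℓ.prodMap ℓ)).mono (V := (ℓ ⁻¹' V) ×ˢ univ) fun p hp => ⟨hp.1, trivial⟩
      exact h4

theorem CkOn.prodMk {k : ℕ} : ∀ {E : Type u} {F : Type v} {G : Type w} [AddCommGroup E]
    [Module ℝ E] [TopologicalSpace E]
    [AddCommGroup F] [Module ℝ F] [TopologicalSpace F] [AddCommGroup G] [Module ℝ G]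
    [TopologicalSpace G] {f : E → F} {g : E → G} {U : Set E} (_ : CkOn k f U) (_ : CkOn k g U),
    CkOn k (fun x => (f x, g x)) U := by
  induction k with
  | zero => intro E F G _ _ _ _ _ _ _ _ _ f g U hf hg; exact ContinuousOn.prodMk hf hg
  | succ k ih =>
    rintro E F G _ _ _ _ _ _ _ _ _ f g U ⟨h1, f', h2, h3⟩ ⟨h1', g', h2', h3'⟩
    exact ⟨ContinuousOn.prodMk h1 h1', fun p => (f' p, g' p),
      fun x hx v => (h2 x hx v).prodMk (h2' x hx v), ih h3 h3'⟩

omit [IsTopologicalAddGroup E] [ContinuousSMul ℝ E] in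
theorem ckOn_const (k : ℕ) (c : F) (U : Set E) : CkOn k (fun _ => c) U := by
  induction k generalizing E c with
  | zero => exact continuousOn_const
  | succ k ih => exact ⟨continuousOn_const, fun _ => 0, fun x _ v => hasDirDeriv_const c x v, ih _ _⟩

theorem ckOn_clm (k : ℕ) {E : Type u} [AddCommGroup E] [Module ℝ E] [TopologicalSpace E]
    [IsTopologicalAddGroup E] [ContinuousSMul ℝ E] (ℓ : E →L[ℝ] F) (U : Set E) : CkOn k ℓ U := by
  induction k generalizing E with
  | zero => exact ℓ.continuous.continuousOn
  | succ k ih => exact ⟨ℓ.continuous.continuousOn, ℓ ∘ (ContinuousLinearMap.snd ℝ E E),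
      fun x _ v => hasDirDeriv_clm ℓ x v, ih (ℓ.comp (ContinuousLinearMap.snd ℝ E E)) _⟩

/-- Write `f (x + t v) = f x + t W(t)` with `W(t)` the difference quotient of `f`; then `W(t) → y`,
and the quotient of `g ∘ f` is one of `g` with varying direction. -/
theorem HasDirDeriv.comp {E : Type*} [AddCommGroup E] [Module ℝ E] {F : Type*} [AddCommGroup F]
    [Module ℝ F] [TopologicalSpace F] [IsTopologicalAddGroup F] [ContinuousSMul ℝ F]
    {G : Type*} [AddCommGroup G] [Module ℝ G] [TopologicalSpace G] [IsTopologicalAddGroup G]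
    [ContinuousSMul ℝ G] [LocallyConvexSpace ℝ G] {f : E → F} {g : F → G} {g' : F × F → G}
    {V : Set F} (hV : IsOpen V) (hd : ∀ x ∈ V, ∀ v, HasDirDeriv g (g' (x, v)) x v)
    {x v : E} {y : F} (hx : f x ∈ V) (hg' : ContinuousAt g' (f x, y)) (hf : HasDirDeriv f y x v) :
    HasDirDeriv (g ∘ f) (g' (f x, y)) x v := by
  have := tendsto_slope_of_hasDirDeriv hV hd hx hg' (l := 𝓝[≠] (0 : ℝ)) (X := fun _ => f x)
    (T := id) tendsto_const_nhds hf tendsto_id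
  refine this.congr' ?_
  filter_upwards [self_mem_nhdsWithin] with t ht
  have ht : t ≠ 0 := ht
  simp [smul_smul, ht]

/-- Induction on `d(g ∘ f) = dg ∘ (f ∘ pr₁, df)`. The spaces are quantified inside the statement
because each step replaces `E` by `E × E` and `F` by `F × F`. -/
theorem CkOn.comp {k : ℕ} : ∀ {E : Type u} {F : Type v} {G : Type w} [AddCommGroup E]
    [Module ℝ E] [TopologicalSpace E] [IsTopologicalAddGroup E] [ContinuousSMul ℝ E]
    [AddCommGroup F] [Module ℝ F] [TopologicalSpace F] [IsTopologicalAddGroup F]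
    [ContinuousSMul ℝ F] [AddCommGroup G] [Module ℝ G] [TopologicalSpace G]
    [IsTopologicalAddGroup G] [ContinuousSMul ℝ G] [LocallyConvexSpace ℝ G]
    {f : E → F} {g : F → G} {U : Set E} {V : Set F} (_ : IsOpen V)
    (_ : CkOn k g V) (_ : CkOn k f U) (_ : MapsTo f U V), CkOn k (g ∘ f) U := by
  induction k with
  | zero => intro E F G _ _ _ _ _ _ _ _ _ _ _ _ _ _ _ _ f g U V _ hg hf hm
            exact ContinuousOn.comp hg hf hm
  | succ k ih =>
    rintro E F G _ _ _ _ _ _ _ _ _ _ _ _ _ _ _ _ f g U V hV ⟨g1, g', g2, g3⟩ hf hm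
    have hf0 := hf.of_succ
    obtain ⟨f1, f', f2, f3⟩ := hf
    refine ⟨g1.comp f1 hm, g' ∘ (fun p => (f p.1, f' p)), fun x hx v => ?_, ?_⟩
    · refine HasDirDeriv.comp hV g2 (hm hx) ?_ (f2 x hx v)
      exact g3.continuousOn.continuousAt ((hV.prod isOpen_univ).mem_nhds ⟨hm hx, trivial⟩)
    · refine ih (hV.prod isOpen_univ) g3 (CkOn.prodMk ?_ f3) fun p hp => ⟨hm hp.1, trivial⟩
      exact (hf0.comp_clm (ContinuousLinearMap.fst ℝ E E)).mono fun p hp => hp.1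

/-- The factors are linear maps on an arbitrary space, which makes the induction close: the
derivative is a sum of two products of the same shape on `E × E`. -/
theorem ckOn_smul (k : ℕ) {E : Type u} [AddCommGroup E] [Module ℝ E] [TopologicalSpace E]
    [IsTopologicalAddGroup E] [ContinuousSMul ℝ E]
    [IsTopologicalAddGroup F] [ContinuousSMul ℝ F] [LocallyConvexSpace ℝ F]
    (a : E →L[ℝ] ℝ) (b : E →L[ℝ] F) (U : Set E) : CkOn k (fun p => a p • b p) U := by
  induction k generalizing E with
  | zero => exact (a.continuous.smul b.continuous).continuousOn
  | succ k ih =>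
    refine ⟨(a.continuous.smul b.continuous).continuousOn,
      fun p => a p.1 • b p.2 + a p.2 • b p.1, fun x _ v => ?_, ?_⟩
    · have hc : Continuous fun t : ℝ => a x • b v + a v • b x + t • (a v • b v) := by fun_prop
      have := (hc.tendsto 0).mono_left (nhdsWithin_le_nhds (s := {0}ᶜ))
      rw [zero_smul, add_zero] at this
      refine this.congr' ?_
      filter_upwards [self_mem_nhdsWithin] with t ht
      have ht : t ≠ 0 := ht
      have e : (a (x + t • v)) • b (x + t • v) - a x • b x
          = t • (a x • b v + a v • b x + t • (a v • b v)) := by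
        simp only [map_add, map_smul, smul_eq_mul]; module
      rw [e, inv_smul_smul₀ ht]
    · exact CkOn.comp isOpen_univ
        (ckOn_clm k (ContinuousLinearMap.fst ℝ F F + ContinuousLinearMap.snd ℝ F F) univ)
        (CkOn.prodMk (ih (a.comp (ContinuousLinearMap.fst ℝ E E))
          (b.comp (ContinuousLinearMap.snd ℝ E E)) _)
          (ih (a.comp (ContinuousLinearMap.snd ℝ E E)) (b.comp (ContinuousLinearMap.fst ℝ E E)) _))
        (mapsTo_univ _ _)

end Ck

/-! ### Smooth maps -/

section Smooth

variable {E F G : Type*} [AddCommGroup E] [Module ℝ E] [TopologicalSpace E]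
  [IsTopologicalAddGroup E] [ContinuousSMul ℝ E]
  [AddCommGroup F] [Module ℝ F] [TopologicalSpace F]

theorem SmoothOn.continuousOn {f : E → F} {U : Set E} (h : SmoothOn f U) : ContinuousOn f U := h 0

theorem SmoothOn.mono {f : E → F} {U V : Set E} (h : SmoothOn f U) (hV : V ⊆ U) : SmoothOn f V :=
  fun k => (h k).mono hV

theorem SmoothOn.congr {f g : E → F} {U : Set E} (h : SmoothOn f U) (hU : IsOpen U)
    (hfg : EqOn f g U) : SmoothOn g U :=
  fun k => (h k).congr hU hfg

theorem SmoothOn.of_local [T2Space F] {f : E → F} {U : Set E} (hU : IsOpen U)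
    (h : ∀ x ∈ U, ∃ O, IsOpen O ∧ x ∈ O ∧ SmoothOn f (U ∩ O)) : SmoothOn f U :=
  fun k => CkOn.of_local hU fun x hx =>
    let ⟨O, hO, hxO, hf⟩ := h x hx
    ⟨O, hO, hxO, hf k⟩

theorem smoothOn_const (c : F) (U : Set E) : SmoothOn (fun _ => c) U := fun k => ckOn_const k c U

theorem smoothOn_clm (ℓ : E →L[ℝ] F) (U : Set E) : SmoothOn ℓ U := fun k => ckOn_clm k ℓ U

theorem smoothOn_id (U : Set E) : SmoothOn (fun x => x) U :=
  smoothOn_clm (ContinuousLinearMap.id ℝ E) U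

theorem SmoothOn.prodMk [AddCommGroup G] [Module ℝ G] [TopologicalSpace G] {f : E → F} {g : E → G}
    {U : Set E} (hf : SmoothOn f U) (hg : SmoothOn g U) : SmoothOn (fun x => (f x, g x)) U :=
  fun k => (hf k).prodMk (hg k)

theorem SmoothOn.continuousAt {f : E → F} {U : Set E} (h : SmoothOn f U) (hU : IsOpen U) {x : E}
    (hx : x ∈ U) : ContinuousAt f x :=
  h.continuousOn.continuousAt (hU.mem_nhds hx)

theorem SmoothOn.hasDirDeriv [T2Space F] {f : E → F} {U : Set E} (h : SmoothOn f U)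
    (hU : IsOpen U) {x : E} (hx : x ∈ U) (v : E) : HasDirDeriv f (dirDeriv f x v) x v :=
  ((ckOn_succ_iff hU).1 (h 1)).2.1 x hx v

theorem SmoothOn.tderiv [T2Space F] {f : E → F} {U : Set E} (h : SmoothOn f U)
    (hU : IsOpen U) : SmoothOn (tderiv f) (U ×ˢ univ) :=
  fun k => ((ckOn_succ_iff hU).1 (h (k + 1))).2.2

variable [IsTopologicalAddGroup F] [ContinuousSMul ℝ F]
  [AddCommGroup G] [Module ℝ G] [TopologicalSpace G]

theorem SmoothOn.comp_clm {g : F → G} {V : Set F} (hg : SmoothOn g V) (ℓ : E →L[ℝ] F) :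
    SmoothOn (g ∘ ℓ) (ℓ ⁻¹' V) := fun k => (hg k).comp_clm ℓ

variable [IsTopologicalAddGroup G] [ContinuousSMul ℝ G] [LocallyConvexSpace ℝ G]

theorem SmoothOn.comp {f : E → F} {g : F → G} {U : Set E} {V : Set F} (hg : SmoothOn g V)
    (hV : IsOpen V) (hf : SmoothOn f U) (hm : MapsTo f U V) : SmoothOn (fun x => g (f x)) U :=
  fun k => CkOn.comp hV (hg k) (hf k) hm

theorem SmoothOn.smul {f : E → ℝ} {g : E → G} {U : Set E} (hf : SmoothOn f U)
    (hg : SmoothOn g U) : SmoothOn (fun x => f x • g x) U := by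
  have h : SmoothOn (fun p : ℝ × G => p.1 • p.2) univ := fun k =>
    ckOn_smul k (ContinuousLinearMap.fst ℝ ℝ G) (ContinuousLinearMap.snd ℝ ℝ G) univ
  exact h.comp isOpen_univ (hf.prodMk hg) (mapsTo_univ _ _)

theorem SmoothOn.add {f g : E → G} {U : Set E} (hf : SmoothOn f U)
    (hg : SmoothOn g U) : SmoothOn (fun x => f x + g x) U :=
  (smoothOn_clm (ContinuousLinearMap.fst ℝ G G + ContinuousLinearMap.snd ℝ G G) univ).comp
    isOpen_univ (hf.prodMk hg) (mapsTo_univ _ _)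

theorem SmoothOn.sub {f g : E → G} {U : Set E} (hf : SmoothOn f U)
    (hg : SmoothOn g U) : SmoothOn (fun x => f x - g x) U :=
  (smoothOn_clm (ContinuousLinearMap.fst ℝ G G - ContinuousLinearMap.snd ℝ G G) univ).comp
    isOpen_univ (hf.prodMk hg) (mapsTo_univ _ _)

variable [T2Space G]

theorem SmoothOn.tendsto_slope {g : F → G} {V : Set F} (hg : SmoothOn g V) (hV : IsOpen V)
    {x w : F} (hx : x ∈ V) {ι : Type*} {l : Filter ι} {X W : ι → F} {T : ι → ℝ}
    (hX : Tendsto X l (𝓝 x)) (hW : Tendsto W l (𝓝 w)) (hT : Tendsto T l (𝓝[≠] 0)) :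
    Tendsto (fun i => (T i)⁻¹ • (g (X i + T i • W i) - g (X i))) l (𝓝 (dirDeriv g x w)) :=
  tendsto_slope_of_hasDirDeriv (f' := LCGeometry.tderiv g) hV (fun _ hx => hg.hasDirDeriv hV hx) hx
    ((hg.tderiv hV).continuousAt (hV.prod isOpen_univ) ⟨hx, trivial⟩) hX hW hT

theorem SmoothOn.hasDirDeriv_comp {E : Type*} [AddCommGroup E] [Module ℝ E] {f : E → F} {g : F → G}
    {V : Set F} (hg : SmoothOn g V) (hV : IsOpen V) {x v : E} {y : F} (hx : f x ∈ V)
    (hf : HasDirDeriv f y x v) : HasDirDeriv (fun x => g (f x)) (dirDeriv g (f x) y) x v :=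
  HasDirDeriv.comp (g' := LCGeometry.tderiv g) hV (fun _ hx => hg.hasDirDeriv hV hx) hx
    ((hg.tderiv hV).continuousAt (hV.prod isOpen_univ) ⟨hx, trivial⟩) hf

theorem SmoothOn.dirDeriv_comp {E : Type*} [AddCommGroup E] [Module ℝ E] {f : E → F} {g : F → G}
    {V : Set F} (hg : SmoothOn g V) (hV : IsOpen V) {x v : E} {y : F} (hx : f x ∈ V)
    (hf : HasDirDeriv f y x v) : dirDeriv (fun x => g (f x)) x v = dirDeriv g (f x) y :=
  (hg.hasDirDeriv_comp hV hx hf).dirDeriv_eq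

theorem tendsto_id_mul_punctured {c : ℝ} (hc : c ≠ 0) :
    Tendsto (fun t : ℝ => t * c) (𝓝[≠] 0) (𝓝[≠] 0) := by
  refine tendsto_nhdsWithin_iff.2 ⟨?_, ?_⟩
  · have : Continuous fun r : ℝ => r * c := by fun_prop
    simpa using (this.tendsto 0).mono_left nhdsWithin_le_nhds
  · filter_upwards [self_mem_nhdsWithin] with r hr
    exact mul_ne_zero hr hc

theorem dirDeriv_smul (f : E → G) (x v : E) (c : ℝ) (h : HasDirDeriv f (dirDeriv f x v) x v) :
    dirDeriv f x (c • v) = c • dirDeriv f x v := by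
  refine HasDirDeriv.dirDeriv_eq ?_
  rcases eq_or_ne c 0 with rfl | hc
  · simp only [zero_smul]
    unfold HasDirDeriv
    simp only [smul_zero, add_zero, sub_self]
    exact tendsto_const_nhds
  · refine ((Tendsto.comp h (tendsto_id_mul_punctured hc)).const_smul c).congr fun t => ?_
    simp only [Function.comp, smul_smul, mul_inv]
    congr 1
    field_simp

theorem SmoothOn.dirDeriv_smul {g : F → G} {V : Set F} (hg : SmoothOn g V) (hV : IsOpen V)
    {x : F} (hx : x ∈ V) (c : ℝ) (v : F) : dirDeriv g x (c • v) = c • dirDeriv g x v :=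
  LCGeometry.dirDeriv_smul g x v c (hg.hasDirDeriv hV hx v)

/-- Split the increment at `x + t v`. The second piece is a difference quotient in direction `w`
whose base point moves to `x`, so the joint convergence applies. -/
theorem SmoothOn.dirDeriv_add {g : F → G} {V : Set F} (hg : SmoothOn g V) (hV : IsOpen V)
    {x : F} (hx : x ∈ V) (v w : F) : dirDeriv g x (v + w) = dirDeriv g x v + dirDeriv g x w := by
  refine HasDirDeriv.dirDeriv_eq ?_
  have h1 := hg.tendsto_slope hV hx (l := 𝓝[≠] (0 : ℝ)) (W := fun _ => w)
    ((tendsto_add_smul x v).mono_left nhdsWithin_le_nhds) tendsto_const_nhds tendsto_id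
  refine (Tendsto.add (hg.hasDirDeriv hV hx v) h1).congr fun t => ?_
  simp only [id, ← smul_add]
  congr 1
  rw [smul_add, add_assoc]
  abel

theorem SmoothOn.dirDeriv_zero {g : F → G} {V : Set F} (hg : SmoothOn g V) (hV : IsOpen V)
    {x : F} (hx : x ∈ V) : dirDeriv g x 0 = 0 := by
  simpa using hg.dirDeriv_smul hV hx 0 0

theorem SmoothOn.dirDeriv_neg {g : F → G} {V : Set F} (hg : SmoothOn g V) (hV : IsOpen V)
    {x : F} (hx : x ∈ V) (v : F) : dirDeriv g x (-v) = -dirDeriv g x v := by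
  simpa using hg.dirDeriv_smul hV hx (-1) v

theorem SmoothOn.dirDeriv_sub {g : F → G} {V : Set F} (hg : SmoothOn g V) (hV : IsOpen V)
    {x : F} (hx : x ∈ V) (v w : F) : dirDeriv g x (v - w) = dirDeriv g x v - dirDeriv g x w := by
  rw [sub_eq_add_neg, hg.dirDeriv_add hV hx, hg.dirDeriv_neg hV hx, sub_eq_add_neg]

theorem SmoothOn.dirDeriv_prod {g : E × F → G} {V : Set (E × F)} (hg : SmoothOn g V)
    (hV : IsOpen V) {x : E × F} (hx : x ∈ V) (v : E) (w : F) :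
    dirDeriv g x (v, w) = dirDeriv g x (v, 0) + dirDeriv g x (0, w) := by
  rw [← hg.dirDeriv_add hV hx]
  simp

/-- Symmetry of second derivatives. -/
theorem SmoothOn.dirDeriv_symm {f : F → G} {V : Set F} (hf : SmoothOn f V) (hV : IsOpen V)
    {x : F} (hx : x ∈ V) (v w : F) :
    dirDeriv (fun z => dirDeriv f z w) x v = dirDeriv (fun z => dirDeriv f z v) x w := by
  -- The mixed second difference quotient converges when both steps tend to `0` independently: the
  -- mean value theorem in direction `w` is applied to `z ↦ (f (z + q.1 v) - f z) / q.1`. The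
  -- quotient is symmetric under exchanging the two steps and directions, and limits are unique.
  have key : ∀ v w : F, Tendsto (fun q : ℝ × ℝ => (q.1 * q.2)⁻¹ • (f (x + q.1 • v + q.2 • w)
      - f (x + q.1 • v) - f (x + q.2 • w) + f x)) ((𝓝[≠] 0) ×ˢ (𝓝[≠] 0))
      (𝓝 (dirDeriv (fun z => dirDeriv f z w) x v)) := by
    intro v w N hN
    obtain ⟨C, hC, hconv, hcl, hCN⟩ := exists_closed_convex_nhds hN
    have hVt : IsOpen (V ×ˢ (univ : Set F)) := hV.prod isOpen_univ
    have h1 : Tendsto (fun q : ℝ × F => q.1⁻¹ • (dirDeriv f (q.2 + q.1 • v) w - dirDeriv f q.2 w))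
        ((𝓝[≠] 0) ×ˢ 𝓝 x) (𝓝 (dirDeriv (fun z => dirDeriv f z w) x v)) := by
      have := (hf.tderiv hV).tendsto_slope hVt (x := (x, w)) (w := (v, 0)) ⟨hx, trivial⟩
        (l := (𝓝[≠] (0 : ℝ)) ×ˢ 𝓝 x) (X := fun q => (q.2, w)) (W := fun _ => (v, 0))
        (T := fun q => q.1)
        (by rw [nhds_prod_eq]; exact tendsto_snd.prodMk tendsto_const_nhds)
        tendsto_const_nhds tendsto_fst
      rw [← dirDeriv_fst (E' := F)] at this
      simpa [LCGeometry.tderiv] using this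
    have h2 : ∀ᶠ q : ℝ × F in (𝓝[≠] 0) ×ˢ 𝓝 x, q.2 ∈ V ∧ q.2 + q.1 • v ∈ V ∧
        q.1⁻¹ • (dirDeriv f (q.2 + q.1 • v) w - dirDeriv f q.2 w) ∈ C := by
      refine (tendsto_snd.eventually (hV.mem_nhds hx)).and (Eventually.and ?_ (h1.eventually hC))
      have hc : Continuous fun q : ℝ × F => q.2 + q.1 • v := by fun_prop
      have := hc.tendsto (0, x)
      simp only [zero_smul, add_zero] at this
      rw [nhds_prod_eq] at this
      exact (this.mono_left (Filter.prod_mono nhdsWithin_le_nhds le_rfl)).eventually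
        (hV.mem_nhds hx)
    have h3 : ∀ᶠ q : ℝ × ℝ in (𝓝[≠] 0) ×ˢ (𝓝[≠] 0), ∀ r ∈ Icc (0 : ℝ) 1,
        (x + r • q.2 • w ∈ V ∧ x + r • q.2 • w + q.1 • v ∈ V ∧
        q.1⁻¹ • (dirDeriv f (x + r • q.2 • w + q.1 • v) w - dirDeriv f (x + r • q.2 • w) w) ∈ C) := by
      rw [eventually_prod_iff] at h2 ⊢
      obtain ⟨P, hP, Q, hQ, hPQ⟩ := h2
      refine ⟨P, hP, fun s => ∀ r ∈ Icc (0 : ℝ) 1, Q (x + r • s • w), ?_, fun hp s hs r hr =>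
        hPQ hp (hs r hr)⟩
      refine Filter.Eventually.filter_mono nhdsWithin_le_nhds ?_
      refine isCompact_Icc.eventually_forall_of_forall_eventually fun r _ => ?_
      have hc : Continuous fun p : ℝ × ℝ => x + p.2 • p.1 • w := by fun_prop
      have ht := hc.tendsto ((0 : ℝ), r)
      simp only [zero_smul, smul_zero, add_zero] at ht
      exact ht.eventually hQ
    have h4 : ∀ᶠ q : ℝ × ℝ in (𝓝[≠] 0) ×ˢ (𝓝[≠] 0), q.1 ≠ 0 ∧ q.2 ≠ 0 :=
      (tendsto_fst.eventually self_mem_nhdsWithin).and (tendsto_snd.eventually self_mem_nhdsWithin)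
    rw [mem_map]
    filter_upwards [h3, h4] with q hq hne
    refine hCN ?_
    have hder : ∀ r ∈ Icc (0 : ℝ) 1, HasCurveDeriv
        (fun r => (q.2)⁻¹ • (q.1⁻¹ • (f (x + r • q.2 • w + q.1 • v) - f (x + r • q.2 • w))))
        (q.1⁻¹ • (dirDeriv f (x + r • q.2 • w + q.1 • v) w - dirDeriv f (x + r • q.2 • w) w))
        (Icc 0 1) r := by
      intro r hr
      refine hasCurveDeriv_line (f := fun z => (q.2)⁻¹ • (q.1⁻¹ • (f (z + q.1 • v) - f z)))
        (HasDirDeriv.line_smul hne.2 ?_)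
      have e1 := hf.hasDirDeriv hV (hq r hr).2.1 w
      have e2 := hf.hasDirDeriv hV (hq r hr).1 w
      refine ((e1.sub e2).const_smul q.1⁻¹).congr fun t => ?_
      have : x + r • q.2 • w + q.1 • v + t • w = x + r • q.2 • w + t • w + q.1 • v := by abel
      rw [this]
      module
    have := slope_mem_of_hasCurveDeriv_mem zero_lt_one hconv hcl hder (fun r hr => (hq r hr).2.2)
    rw [sub_zero, inv_one, one_smul, one_smul, zero_smul, add_zero] at this
    show (q.1 * q.2)⁻¹ • _ ∈ C
    convert this using 1
    have : x + q.2 • w + q.1 • v = x + q.1 • v + q.2 • w := by abel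
    rw [this, mul_inv]
    module
  have h1 := key v w
  have h2 := (key w v).comp (tendsto_snd.prodMk (tendsto_fst (f := 𝓝[≠] (0 : ℝ)) (g := 𝓝[≠] (0 : ℝ))))
  refine tendsto_nhds_unique h1 (h2.congr fun q => ?_)
  have : x + q.2 • w + q.1 • v = x + q.1 • v + q.2 • w := by abel
  simp only [Function.comp, this, mul_comm q.2]
  congr 1
  abel

end Smooth

/-! ### Curves -/

section Curves

variable {V W : Type*} [AddCommGroup V] [Module ℝ V] [TopologicalSpace V]
  [AddCommGroup W] [Module ℝ W] [TopologicalSpace W]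

theorem HasCurveDeriv.unique [T2Space V] {c : ℝ → V} {y z : V} {s : Set ℝ} {t : ℝ}
    [h : (𝓝[s \ {t}] t).NeBot] (h1 : HasCurveDeriv c y s t) (h2 : HasCurveDeriv c z s t) : y = z :=
  tendsto_nhds_unique h1 h2

theorem HasCurveDeriv.congr {c c' : ℝ → V} {y : V} {s : Set ℝ} {t : ℝ}
    (h : HasCurveDeriv c y s t) (hc : ∀ᶠ r in 𝓝[s] t, c r = c' r) (ht : c t = c' t) :
    HasCurveDeriv c' y s t := by
  refine Tendsto.congr' ?_ h
  filter_upwards [hc.filter_mono (nhdsWithin_mono t sdiff_subset)] with r hr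
  rw [hr, ht]

theorem HasCurveDeriv.mono {c : ℝ → V} {y : V} {s s' : Set ℝ} {t : ℝ}
    (h : HasCurveDeriv c y s t) (hs : s' ⊆ s) : HasCurveDeriv c y s' t :=
  h.mono_left (nhdsWithin_mono t (sdiff_subset_sdiff_left hs))

theorem nhdsWithin_inter_diff {s O : Set ℝ} {t : ℝ} (hO : O ∈ 𝓝[s] t) :
    𝓝[(s ∩ O) \ {t}] t = 𝓝[s \ {t}] t := by
  have : (s ∩ O) \ {t} = (s \ {t}) ∩ O := by ext; simp; tauto
  rw [this]
  exact nhdsWithin_inter_of_mem' (nhdsWithin_mono t sdiff_subset hO)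

theorem hasCurveDeriv_inter {c : ℝ → V} {y : V} {s O : Set ℝ} {t : ℝ} (hO : O ∈ 𝓝[s] t) :
    HasCurveDeriv c y (s ∩ O) t ↔ HasCurveDeriv c y s t := by
  unfold HasCurveDeriv
  rw [nhdsWithin_inter_diff hO]

theorem HasCurveDeriv.prodMk {c : ℝ → V} {c' : ℝ → W} {y : V} {y' : W} {s : Set ℝ} {t : ℝ}
    (h : HasCurveDeriv c y s t) (h' : HasCurveDeriv c' y' s t) :
    HasCurveDeriv (fun r => (c r, c' r)) (y, y') s t := by
  unfold HasCurveDeriv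
  rw [nhds_prod_eq]
  exact Tendsto.prodMk h h'

theorem hasCurveDeriv_const (v : V) (s : Set ℝ) (t : ℝ) : HasCurveDeriv (fun _ => v) 0 s t := by
  unfold HasCurveDeriv
  simp only [sub_self, smul_zero]
  exact tendsto_const_nhds

theorem hasCurveDeriv_id (s : Set ℝ) (t : ℝ) : HasCurveDeriv (fun r : ℝ => r) (1 : ℝ) s t := by
  refine tendsto_const_nhds.congr' ?_
  filter_upwards [self_mem_nhdsWithin] with r hr
  have : r - t ≠ 0 := sub_ne_zero.2 hr.2
  simp [this]

theorem tendsto_sub_punctured (s : Set ℝ) (t : ℝ) :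
    Tendsto (fun r : ℝ => r - t) (𝓝[s \ {t}] t) (𝓝[≠] 0) := by
  refine tendsto_nhdsWithin_iff.2 ⟨?_, ?_⟩
  · have : Continuous fun r : ℝ => r - t := by fun_prop
    simpa using (this.tendsto t).mono_left nhdsWithin_le_nhds
  · filter_upwards [self_mem_nhdsWithin] with r hr
    exact sub_ne_zero.2 hr.2

variable [IsTopologicalAddGroup V] [ContinuousSMul ℝ V] [IsTopologicalAddGroup W]
  [ContinuousSMul ℝ W]

theorem HasCurveDeriv.tendsto {c : ℝ → V} {y : V} {s : Set ℝ} {t : ℝ}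
    (h : HasCurveDeriv c y s t) : Tendsto c (𝓝[s \ {t}] t) (𝓝 (c t)) := by
  have := ((((tendsto_sub_punctured s t).mono_right nhdsWithin_le_nhds).smul h)).add_const (c t)
  rw [zero_smul, zero_add] at this
  refine this.congr' ?_
  filter_upwards [self_mem_nhdsWithin] with r hr
  have : r - t ≠ 0 := sub_ne_zero.2 hr.2
  simp [smul_smul, this]

/-- Chain rule along curves, one-sided derivatives included. -/
theorem SmoothOn.hasCurveDeriv_comp [LocallyConvexSpace ℝ W] [T2Space W] {g : V → W} {U : Set V}
    (hg : SmoothOn g U) (hU : IsOpen U) {c : ℝ → V} {y : V} {s : Set ℝ} {t : ℝ} (ht : c t ∈ U)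
    (h : HasCurveDeriv c y s t) : HasCurveDeriv (fun r => g (c r)) (dirDeriv g (c t) y) s t := by
  have := hg.tendsto_slope hU ht (l := 𝓝[s \ {t}] t) (X := fun _ => c t)
    tendsto_const_nhds h (tendsto_sub_punctured s t)
  refine this.congr' ?_
  filter_upwards [self_mem_nhdsWithin] with r hr
  have : r - t ≠ 0 := sub_ne_zero.2 hr.2
  simp [smul_smul, this]

theorem HasCurveDeriv.smul {a : ℝ → ℝ} {a' : ℝ} {c : ℝ → V} {y : V} {s : Set ℝ} {t : ℝ}
    (ha : HasCurveDeriv a a' s t) (h : HasCurveDeriv c y s t) :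
    HasCurveDeriv (fun r => a r • c r) (a t • y + a' • c t) s t := by
  refine (Tendsto.add (ha.tendsto.smul h) (Tendsto.smul ha (tendsto_const_nhds (x := c t)))).congr fun r => ?_
  simp only [smul_eq_mul]
  module

theorem HasCurveDeriv.comp_affine {c : ℝ → V} {y : V} {s s' : Set ℝ} {t k m : ℝ}
    (h : HasCurveDeriv c y s (k * t + m)) (hs : ∀ r ∈ s', k * r + m ∈ s) (hk : k ≠ 0) :
    HasCurveDeriv (fun r => c (k * r + m)) (k • y) s' t := by
  have h1 : Tendsto (fun r : ℝ => k * r + m) (𝓝[s' \ {t}] t) (𝓝[s \ {k * t + m}] (k * t + m)) := by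
    refine tendsto_nhdsWithin_iff.2 ⟨?_, ?_⟩
    · have : Continuous fun r : ℝ => k * r + m := by fun_prop
      exact (this.tendsto t).mono_left nhdsWithin_le_nhds
    · filter_upwards [self_mem_nhdsWithin] with r hr
      exact ⟨hs r hr.1, fun h => hr.2 (by simpa [hk] using h)⟩
  refine ((h.comp h1).const_smul k).congr fun r => ?_
  simp only [Function.comp, smul_smul]
  congr 1
  have : k * r + m - (k * t + m) = k * (r - t) := by ring
  rw [this, mul_inv, ← mul_assoc, mul_inv_cancel₀ hk, one_mul]

theorem SmoothCurveIn.mono {c : ℝ → V} {s s' : Set ℝ} (h : SmoothCurveIn c s) (hs : s' ⊆ s) :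
    SmoothCurveIn c s' :=
  let ⟨d, h0, h1⟩ := h
  ⟨d, h0, fun k t ht => (h1 k t (hs ht)).mono hs⟩

theorem SmoothCurveIn.comp_affine {c : ℝ → V} {s s' : Set ℝ} {k m : ℝ} (h : SmoothCurveIn c s)
    (hs : ∀ r ∈ s', k * r + m ∈ s) (hk : k ≠ 0) : SmoothCurveIn (fun r => c (k * r + m)) s' := by
  obtain ⟨d, h0, h1⟩ := h
  refine ⟨fun j r => k ^ j • d j (k * r + m), by simp [h0], fun j t ht => ?_⟩
  have := ((h1 j _ (hs t ht)).comp_affine hs hk).const_smul (k ^ j)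
  rw [smul_smul, ← pow_succ] at this
  refine this.congr fun r => ?_
  module

/-- The derivatives of `g ∘ c`, where `c j` is the `j`-th derivative of `c 0`. -/
def compDerivs {F : Type v} [AddCommGroup F] [Module ℝ F] [TopologicalSpace F] :
    ℕ → ∀ {E : Type u} [AddCommGroup E] [Module ℝ E], (E → F) → (ℕ → ℝ → E) → ℝ → F
  | 0, _, _, _, g, c => fun t => g (c 0 t)
  | k + 1, _, _, _, g, c => compDerivs k (tderiv g) fun j t => (c j t, c (j + 1) t)

/-- Passing from `(g, c)` to `(tderiv g, (c, c'))` lowers `k` by one, so every order reduces to the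
first-order chain rule and no formula for higher derivatives of a composition is needed. -/
theorem hasCurveDeriv_compDerivs {F : Type v} [AddCommGroup F] [Module ℝ F] [TopologicalSpace F]
    [IsTopologicalAddGroup F] [ContinuousSMul ℝ F] [LocallyConvexSpace ℝ F] [T2Space F]
    {s : Set ℝ} (k : ℕ) : ∀ {E : Type u} [AddCommGroup E] [Module ℝ E]
    [TopologicalSpace E] [IsTopologicalAddGroup E] [ContinuousSMul ℝ E] {g : E → F} {U : Set E}
    (_ : SmoothOn g U) (_ : IsOpen U) {c : ℕ → ℝ → E} (_ : MapsTo (c 0) s U)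
    (_ : ∀ k, ∀ t ∈ s, HasCurveDeriv (c k) (c (k + 1) t) s t) (t : ℝ) (_ : t ∈ s),
    HasCurveDeriv (compDerivs k g c) (compDerivs (k + 1) g c t) s t := by
  induction k with
  | zero =>
    intro E _ _ _ _ _ g U hg hU c hc hd t ht
    exact hg.hasCurveDeriv_comp hU (hc ht) (hd 0 t ht)
  | succ k ih =>
    intro E _ _ _ _ _ g U hg hU c hc hd t ht
    exact ih (hg.tderiv hU) (hU.prod isOpen_univ) (c := fun j t => (c j t, c (j + 1) t))
      (fun t ht => ⟨hc ht, trivial⟩) (fun k t ht => (hd k t ht).prodMk (hd (k + 1) t ht)) t ht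

theorem SmoothOn.smoothCurveIn_comp [LocallyConvexSpace ℝ W] [T2Space W] {g : V → W} {U : Set V}
    (hg : SmoothOn g U) (hU : IsOpen U) {c : ℝ → V} {s : Set ℝ} (hc : SmoothCurveIn c s)
    (hm : MapsTo c s U) : SmoothCurveIn (fun t => g (c t)) s := by
  obtain ⟨d, rfl, h1⟩ := hc
  exact ⟨fun k => compDerivs k g d, rfl, fun k t ht => hasCurveDeriv_compDerivs k hg hU hm h1 t ht⟩

/-- The canonical sequence of iterated derivatives of a curve. -/
def iterCurveDeriv (c : ℝ → V) (s : Set ℝ) : ℕ → ℝ → V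
  | 0 => c
  | k + 1 => fun t => limUnder (𝓝[s \ {t}] t)
      (fun r => (r - t)⁻¹ • (iterCurveDeriv c s k r - iterCurveDeriv c s k t))

/-- Smoothness asks for one sequence of derivatives on all of `s`. At accumulation points
derivatives are unique, so the canonical sequence agrees with every local one. -/
theorem SmoothCurveIn.of_local [T2Space V] {c : ℝ → V} {s : Set ℝ}
    (hs : ∀ t ∈ s, (𝓝[s \ {t}] t).NeBot)
    (h : ∀ t ∈ s, ∃ O, IsOpen O ∧ t ∈ O ∧ ∃ c' : ℝ → V, EqOn c c' (s ∩ O) ∧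
      SmoothCurveIn c' (s ∩ O)) : SmoothCurveIn c s := by
  refine ⟨iterCurveDeriv c s, rfl, fun k t ht => ?_⟩
  obtain ⟨O, hO, htO, c', hcc', d, rfl, hd⟩ := h t ht
  -- Since `O` is open, a derivative relative to `s ∩ O` is one relative to `s`.
  have hd' : ∀ k, ∀ t ∈ s ∩ O, HasCurveDeriv (d k) (d (k + 1) t) s t := fun k t ht =>
    (hasCurveDeriv_inter (mem_nhdsWithin_of_mem_nhds (hO.mem_nhds ht.2))).1 (hd k t ht)
  have hev : ∀ k, EqOn (iterCurveDeriv c s k) (d k) (s ∩ O) →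
      ∀ t ∈ s ∩ O, HasCurveDeriv (iterCurveDeriv c s k) (d (k + 1) t) s t := by
    intro k heq t ht
    refine (hd' k t ht).congr ?_ (heq ht).symm
    filter_upwards [self_mem_nhdsWithin, mem_nhdsWithin_of_mem_nhds (hO.mem_nhds ht.2)] with r h1 h2
    exact (heq ⟨h1, h2⟩).symm
  have heq : ∀ k, EqOn (iterCurveDeriv c s k) (d k) (s ∩ O) := by
    intro k
    induction k with
    | zero => exact hcc'
    | succ k ih =>
      intro t ht
      have := hs t ht.1
      exact Tendsto.limUnder_eq (hev k ih t ht)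
  rw [heq (k + 1) ⟨ht, htO⟩]
  exact hev k (heq k) t ⟨ht, htO⟩

end Curves

/-! ### Maps that are linear in the second argument -/

section Bilin

variable {E F G : Type*} [AddCommGroup E] [Module ℝ E] [TopologicalSpace E]
  [IsTopologicalAddGroup E] [ContinuousSMul ℝ E]
  [AddCommGroup F] [Module ℝ F] [TopologicalSpace F]
  [IsTopologicalAddGroup F] [ContinuousSMul ℝ F]
  [AddCommGroup G] [Module ℝ G] [TopologicalSpace G]
  [IsTopologicalAddGroup G] [ContinuousSMul ℝ G] [LocallyConvexSpace ℝ G] [T2Space G]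

/-- `Φ(u, ·)` is linear for all `u ∈ U`. -/
def LinSnd (Φ : E × F → G) (U : Set E) : Prop :=
  ∀ u ∈ U, ∀ (w z : F) (t : ℝ), Φ (u, w + t • z) = Φ (u, w) + t • Φ (u, z)

theorem LinSnd.map_zero {Φ : E × F → G} {U : Set E} (h : LinSnd Φ U) {u : E} (hu : u ∈ U) :
    Φ (u, 0) = 0 := by
  have := h u hu 0 0 1
  simpa using this

theorem LinSnd.map_smul {Φ : E × F → G} {U : Set E} (h : LinSnd Φ U) {u : E} (hu : u ∈ U)
    (t : ℝ) (z : F) : Φ (u, t • z) = t • Φ (u, z) := by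
  have := h u hu 0 z t
  simpa [h.map_zero hu] using this

theorem LinSnd.map_add {Φ : E × F → G} {U : Set E} (h : LinSnd Φ U) {u : E} (hu : u ∈ U)
    (w z : F) : Φ (u, w + z) = Φ (u, w) + Φ (u, z) := by
  have := h u hu w z 1
  simpa using this

theorem LinSnd.map_sub {Φ : E × F → G} {U : Set E} (h : LinSnd Φ U) {u : E} (hu : u ∈ U)
    (w z : F) : Φ (u, w - z) = Φ (u, w) - Φ (u, z) := by
  have := h u hu w z (-1)
  simpa [sub_eq_add_neg] using this

theorem LinSnd.dirDeriv_snd {Φ : E × F → G} {U : Set E} (h : LinSnd Φ U) {u : E} (hu : u ∈ U)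
    (w z : F) : dirDeriv Φ (u, w) (0, z) = Φ (u, z) := by
  refine HasDirDeriv.dirDeriv_eq (tendsto_const_nhds.congr' ?_)
  filter_upwards [self_mem_nhdsWithin] with t ht
  have ht : t ≠ 0 := ht
  simp [h u hu, smul_smul, ht]

/-- Leibniz rule: the partial derivative in the linear argument is the map itself. -/
theorem SmoothOn.dirDeriv_linSnd {Φ : E × F → G} {U : Set E} (hU : IsOpen U)
    (hΦ : SmoothOn Φ (U ×ˢ univ)) (h : LinSnd Φ U) {u : E} (hu : u ∈ U) (w : F) (v : E) (z : F) :
    dirDeriv Φ (u, w) (v, z) = dirDeriv (fun x => Φ (x, w)) u v + Φ (u, z) := by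
  rw [hΦ.dirDeriv_prod (hU.prod isOpen_univ) ⟨hu, trivial⟩, h.dirDeriv_snd hu, dirDeriv_fst]

theorem SmoothOn.hasDirDeriv_linSnd {X : Type*} [AddCommGroup X] [Module ℝ X]
    {Φ : E × F → G} {U : Set E} (hU : IsOpen U)
    (hΦ : SmoothOn Φ (U ×ˢ univ)) (h : LinSnd Φ U) {f : X → E} {g : X → F} {x v : X} {y : E} {z : F}
    (hx : f x ∈ U) (hf : HasDirDeriv f y x v) (hg : HasDirDeriv g z x v) :
    HasDirDeriv (fun x => Φ (f x, g x))
      (dirDeriv (fun u => Φ (u, g x)) (f x) y + Φ (f x, z)) x v := by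
  rw [← hΦ.dirDeriv_linSnd hU h hx]
  exact hΦ.hasDirDeriv_comp (f := fun x => (f x, g x)) (hU.prod isOpen_univ) ⟨hx, trivial⟩
    (hf.prodMk hg)

theorem SmoothOn.hasCurveDeriv_linSnd {Φ : E × F → G} {U : Set E} (hU : IsOpen U)
    (hΦ : SmoothOn Φ (U ×ˢ univ)) (h : LinSnd Φ U) {f : ℝ → E} {g : ℝ → F} {s : Set ℝ} {t : ℝ}
    {y : E} {z : F} (hx : f t ∈ U) (hf : HasCurveDeriv f y s t) (hg : HasCurveDeriv g z s t) :
    HasCurveDeriv (fun r => Φ (f r, g r))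
      (dirDeriv (fun u => Φ (u, g t)) (f t) y + Φ (f t, z)) s t := by
  rw [← hΦ.dirDeriv_linSnd hU h hx]
  exact hΦ.hasCurveDeriv_comp (c := fun r => (f r, g r)) (hU.prod isOpen_univ) ⟨hx, trivial⟩
    (hf.prodMk hg)

theorem SmoothOn.linSnd_tderiv {g : E → G} {U : Set E} (hg : SmoothOn g U) (hU : IsOpen U) :
    LinSnd (LCGeometry.tderiv g) U := fun u hu w z t => by
  simp only [LCGeometry.tderiv]
  rw [hg.dirDeriv_add hU hu, hg.dirDeriv_smul hU hu]

end Bilin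

/-! ### Smooth maps from open subsets of the model space to a manifold -/

section SmoothInto

variable (𝔫 : Type*) {N : Type*} [AddCommGroup 𝔫] [Module ℝ 𝔫] [TopologicalSpace 𝔫]
  [TopologicalSpace N] [ChartedSpace 𝔫 N]
  {X Y : Type*} [AddCommGroup X] [Module ℝ X] [TopologicalSpace X]
  [AddCommGroup Y] [Module ℝ Y] [TopologicalSpace Y]

/-- `F : X → N` is smooth on the open subset `U` of the locally convex space `X`. -/
def SmoothInto (F : X → N) (U : Set X) : Prop :=
  ContinuousOn F U ∧ ∀ e ∈ atlas 𝔫 N, SmoothOn (fun x => e (F x)) (U ∩ F ⁻¹' e.source)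

variable {𝔫}
variable [IsTopologicalAddGroup X] [ContinuousSMul ℝ X] [IsTopologicalAddGroup Y]
  [ContinuousSMul ℝ Y] [IsTopologicalAddGroup 𝔫] [ContinuousSMul ℝ 𝔫] [LocallyConvexSpace ℝ 𝔫]
  [T2Space 𝔫]

theorem SmoothInto.isOpen_inter {F : X → N} {U : Set X} (h : SmoothInto 𝔫 F U) (hU : IsOpen U)
    {O : Set N} (hO : IsOpen O) : IsOpen (U ∩ F ⁻¹' O) := h.1.isOpen_inter_preimage hU hO

theorem SmoothInto.mono {F : X → N} {U V : Set X} (h : SmoothInto 𝔫 F U) (hV : V ⊆ U) :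
    SmoothInto 𝔫 F V :=
  ⟨h.1.mono hV, fun e he => (h.2 e he).mono (inter_subset_inter_left _ hV)⟩

theorem SmoothInto.congr {F F' : X → N} {U : Set X} (h : SmoothInto 𝔫 F U) (hU : IsOpen U)
    (hF : EqOn F F' U) : SmoothInto 𝔫 F' U := by
  refine ⟨h.1.congr hF.symm, fun e he => ?_⟩
  have : U ∩ F' ⁻¹' e.source = U ∩ F ⁻¹' e.source := by
    ext x; constructor <;> rintro ⟨h1, h2⟩ <;> refine ⟨h1, ?_⟩ <;>
      simpa only [mem_preimage, hF h1] using h2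
  rw [this]
  exact (h.2 e he).congr (h.isOpen_inter hU e.open_source) fun x hx => by simp only [hF hx.1]

/-- One chart near each image point suffices because transition maps are smooth; continuity comes
for free from `e.symm ∘ e ∘ F`. -/
theorem SmoothInto.of_local [LCManifold 𝔫 N] {F : X → N} {U : Set X} (hU : IsOpen U)
    (h : ∀ x ∈ U, ∃ O, IsOpen O ∧ x ∈ O ∧ ∃ e ∈ atlas 𝔫 N, MapsTo F (U ∩ O) e.source ∧
      SmoothOn (fun x => e (F x)) (U ∩ O)) : SmoothInto 𝔫 F U := by
  have hcont : ContinuousOn F U := by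
    intro x hx
    obtain ⟨O, hO, hxO, e, he, hm, hs⟩ := h x hx
    have hx' : x ∈ U ∩ O := ⟨hx, hxO⟩
    have h1 : ContinuousAt (fun x => e.symm (e (F x))) x :=
      ContinuousAt.comp (g := e.symm) (e.symm.continuousAt (e.map_source (hm hx')))
        (hs.continuousAt (hU.inter hO) hx')
    refine (h1.congr ?_).continuousWithinAt
    filter_upwards [(hU.inter hO).mem_nhds hx'] with z hz using e.left_inv (hm hz)
  refine ⟨hcont, fun e' he' => SmoothOn.of_local (hcont.isOpen_inter_preimage hU e'.open_source) ?_⟩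
  rintro x ⟨hx, hx'⟩
  obtain ⟨O, hO, hxO, e, he, hm, hs⟩ := h x hx
  refine ⟨O, hO, hxO, ?_⟩
  have hop : IsOpen (U ∩ F ⁻¹' e'.source ∩ O) :=
    (hcont.isOpen_inter_preimage hU e'.open_source).inter hO
  have h1 := (LCManifold.compat e he e' he').comp (e.symm.trans e').open_source
    (f := fun x => e (F x)) (U := U ∩ F ⁻¹' e'.source ∩ O)
    (hs.mono fun z hz => ⟨hz.1.1, hz.2⟩) (fun z hz => by
      have := hm ⟨hz.1.1, hz.2⟩
      simp only [OpenPartialHomeomorph.trans_source, OpenPartialHomeomorph.symm_source, mem_inter_iff,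
        mem_preimage]
      exact ⟨e.map_source this, by rw [e.left_inv this]; exact hz.1.2⟩)
  refine h1.congr hop fun z hz => ?_
  simp only [Function.comp]
  rw [e.left_inv (hm ⟨hz.1.1, hz.2⟩)]

theorem SmoothInto.comp {F : Y → N} {V : Set Y} (h : SmoothInto 𝔫 F V) (hV : IsOpen V)
    {f : X → Y} {U : Set X} (hf : SmoothOn f U) (hm : MapsTo f U V) :
    SmoothInto 𝔫 (fun x => F (f x)) U :=
  ⟨h.1.comp hf.continuousOn hm, fun e he => (h.2 e he).comp (h.isOpen_inter hV e.open_source)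
    (hf.mono inter_subset_left) fun _ hx => ⟨hm hx.1, hx.2⟩⟩

theorem smoothInto_symm [LCManifold 𝔫 N] {e : OpenPartialHomeomorph N 𝔫} (he : e ∈ atlas 𝔫 N) :
    SmoothInto 𝔫 e.symm e.target := by
  refine SmoothInto.of_local e.open_target fun x hx => ⟨univ, isOpen_univ, trivial, e, he, ?_, ?_⟩
  · exact fun z hz => e.map_target hz.1
  · rw [inter_univ]
    exact (smoothOn_id _).congr e.open_target fun z hz => (e.right_inv hz).symm

theorem smoothInto_const [LCManifold 𝔫 N] (g : N) (U : Set X) (hU : IsOpen U) :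
    SmoothInto 𝔫 (fun _ => g) U :=
  SmoothInto.of_local hU fun _ _ => ⟨univ, isOpen_univ, trivial, chartAt 𝔫 g, chart_mem_atlas _ _,
    fun _ _ => mem_chart_source 𝔫 g, smoothOn_const _ _⟩

/-- Composition with a smooth map between manifolds. -/
theorem SmoothInto.smoothBetween {𝔫' N' : Type*} [AddCommGroup 𝔫'] [Module ℝ 𝔫']
    [TopologicalSpace 𝔫'] [IsTopologicalAddGroup 𝔫'] [ContinuousSMul ℝ 𝔫']
    [LocallyConvexSpace ℝ 𝔫'] [T2Space 𝔫'] [TopologicalSpace N'] [ChartedSpace 𝔫' N']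
    [LCManifold 𝔫' N'] {J : N → N'} (hJ : SmoothBetween (atlas 𝔫 N) (atlas 𝔫' N') J)
    {F : X → N} {U : Set X} (hF : SmoothInto 𝔫 F U) (hU : IsOpen U) :
    SmoothInto 𝔫' (fun x => J (F x)) U := by
  refine SmoothInto.of_local hU fun x hx => ?_
  have hO : IsOpen (J ⁻¹' (chartAt 𝔫' (J (F x))).source) :=
    (chartAt 𝔫' (J (F x))).open_source.preimage hJ.1
  have hN := hF.isOpen_inter hU ((chartAt 𝔫 (F x)).open_source.inter hO)
  refine ⟨_, hN, ⟨hx, mem_chart_source 𝔫 _, mem_chart_source 𝔫' _⟩, chartAt 𝔫' (J (F x)),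
    chart_mem_atlas _ _, fun z hz => hz.2.2.2, ?_⟩
  have h1 := hJ.2 _ (chart_mem_atlas 𝔫 (F x)) _ (chart_mem_atlas 𝔫' (J (F x)))
  have h2 := h1.comp (f := fun z => chartAt 𝔫 (F x) (F z))
    (U := U ∩ (U ∩ F ⁻¹' ((chartAt 𝔫 (F x)).source ∩ J ⁻¹' (chartAt 𝔫' (J (F x))).source)))
    ((chartAt 𝔫 (F x)).isOpen_inter_preimage_symm hO)
    ((hF.2 _ (chart_mem_atlas 𝔫 (F x))).mono fun z hz => ⟨hz.1, hz.2.2.1⟩) (fun z hz => by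
      refine ⟨(chartAt 𝔫 (F x)).map_source hz.2.2.1, ?_⟩
      simp only [mem_preimage]
      rw [(chartAt 𝔫 (F x)).left_inv hz.2.2.1]
      exact hz.2.2.2)
  refine h2.congr (hU.inter hN) fun z hz => ?_
  simp only [Function.comp]
  rw [(chartAt 𝔫 (F x)).left_inv hz.2.2.1]

theorem SmoothInto.congr_of_locally [LCManifold 𝔫 N] {F : X → N} {U : Set X} (hU : IsOpen U)
    (h : ∀ x ∈ U, ∃ O, IsOpen O ∧ x ∈ O ∧ ∃ F', EqOn F F' (U ∩ O) ∧ SmoothInto 𝔫 F' (U ∩ O)) :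
    SmoothInto 𝔫 F U := by
  refine SmoothInto.of_local hU fun x hx => ?_
  obtain ⟨O, hO, hxO, F', hFF', hF'⟩ := h x hx
  have hF : SmoothInto 𝔫 F (U ∩ O) := hF'.congr (hU.inter hO) hFF'.symm
  have h1 := hF.isOpen_inter (hU.inter hO) (chartAt 𝔫 (F x)).open_source
  exact ⟨_, h1, ⟨⟨hx, hxO⟩, mem_chart_source _ _⟩, _, chart_mem_atlas 𝔫 (F x), fun z hz => hz.2.2,
    (hF.2 _ (chart_mem_atlas 𝔫 (F x))).mono fun z hz => hz.2⟩

end SmoothInto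

/-! ### Products and inverses of smooth maps into a Lie group. -/

section Group

variable {𝔥 H : Type*} [AddCommGroup 𝔥] [Module ℝ 𝔥] [TopologicalSpace 𝔥]
  [IsTopologicalAddGroup 𝔥] [ContinuousSMul ℝ 𝔥] [LocallyConvexSpace ℝ 𝔥] [T2Space 𝔥]
  [TopologicalSpace H] [ChartedSpace 𝔥 H] [Group H] [LCLieGroup 𝔥 H]
  {X : Type*} [AddCommGroup X] [Module ℝ X] [TopologicalSpace X]
  [IsTopologicalAddGroup X] [ContinuousSMul ℝ X]

theorem SmoothInto.inv {F : X → H} {U : Set X} (hF : SmoothInto 𝔥 F U) (hU : IsOpen U) :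
    SmoothInto 𝔥 (fun x => (F x)⁻¹) U :=
  hF.smoothBetween LCLieGroup.smooth_inv hU

theorem SmoothInto.mul {F F' : X → H} {U : Set X} (hF : SmoothInto 𝔥 F U)
    (hF' : SmoothInto 𝔥 F' U) (hU : IsOpen U) : SmoothInto 𝔥 (fun x => F x * F' x) U := by
  have hJ := LCLieGroup.smooth_mul (𝔤 := 𝔥) (G := H)
  refine SmoothInto.of_local hU fun x hx => ?_
  set e := chartAt 𝔥 (F x) with he
  set e' := chartAt 𝔥 (F' x) with he'
  set d := chartAt 𝔥 (F x * F' x) with hd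
  have hO : IsOpen ((fun p : H × H => p.1 * p.2) ⁻¹' d.source) := d.open_source.preimage hJ.1
  have hN : IsOpen (U ∩ (fun x => (F x, F' x)) ⁻¹' (e.source ×ˢ e'.source ∩
      (fun p : H × H => p.1 * p.2) ⁻¹' d.source)) :=
    (hF.1.prodMk hF'.1).isOpen_inter_preimage hU ((e.open_source.prod e'.open_source).inter hO)
  refine ⟨_, hN, ⟨hx, ⟨mem_chart_source 𝔥 _, mem_chart_source 𝔥 _⟩, mem_chart_source 𝔥 _⟩, d,
    chart_mem_atlas _ _, fun z hz => hz.2.2.2, ?_⟩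
  have h1 := hJ.2 (e.prod e') (mem_image2_of_mem (chart_mem_atlas _ _) (chart_mem_atlas _ _)) d
    (chart_mem_atlas _ _)
  have h2 := h1.comp (f := fun z => (e (F z), e' (F' z)))
    (U := U ∩ (U ∩ (fun x => (F x, F' x)) ⁻¹' (e.source ×ˢ e'.source ∩
      (fun p : H × H => p.1 * p.2) ⁻¹' d.source)))
    ((e.prod e').isOpen_inter_preimage_symm hO)
    (((hF.2 _ (chart_mem_atlas 𝔥 (F x))).mono fun z hz => ⟨hz.1, hz.2.2.1.1⟩).prodMk
      ((hF'.2 _ (chart_mem_atlas 𝔥 (F' x))).mono fun z hz => ⟨hz.1, hz.2.2.1.2⟩)) (fun z hz => by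
      refine ⟨⟨e.map_source hz.2.2.1.1, e'.map_source hz.2.2.1.2⟩, ?_⟩
      simp only [mem_preimage, OpenPartialHomeomorph.prod_symm, OpenPartialHomeomorph.prod_apply]
      rw [e.left_inv hz.2.2.1.1, e'.left_inv hz.2.2.1.2]
      exact hz.2.2.2)
  refine h2.congr (hU.inter hN) fun z hz => ?_
  simp only [Function.comp, OpenPartialHomeomorph.prod_symm, OpenPartialHomeomorph.prod_apply]
  rw [e.left_inv hz.2.2.1.1, e'.left_inv hz.2.2.1.2]

theorem LCLieGroup.isTopologicalGroup (𝔥 H : Type*) [AddCommGroup 𝔥] [Module ℝ 𝔥]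
    [TopologicalSpace 𝔥] [TopologicalSpace H] [ChartedSpace 𝔥 H] [Group H] [LCLieGroup 𝔥 H] :
    IsTopologicalGroup H where
  continuous_mul := (LCLieGroup.smooth_mul (𝔤 := 𝔥) (G := H)).1
  continuous_inv := (LCLieGroup.smooth_inv (𝔤 := 𝔥) (G := H)).1

end Group

/-! ### Logarithmic derivatives in the chart at the identity -/

section Log

variable {𝔥 H : Type*} [AddCommGroup 𝔥] [Module ℝ 𝔥] [TopologicalSpace 𝔥]
  [IsTopologicalAddGroup 𝔥] [ContinuousSMul ℝ 𝔥] [LocallyConvexSpace ℝ 𝔥] [T2Space 𝔥]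
  [TopologicalSpace H] [ChartedSpace 𝔥 H] [Group H] [LCLieGroup 𝔥 H]
  {X : Type*} [AddCommGroup X] [Module ℝ X] [TopologicalSpace X]
  [IsTopologicalAddGroup X] [ContinuousSMul ℝ X]

variable (𝔥) in
/-- The left logarithmic derivative of `F : X → H`, computed in the chart at `1`. -/
def logD (F : X → H) (x v : X) : 𝔥 :=
  dirDeriv (fun z => chartAt 𝔥 (1 : H) ((F x)⁻¹ * F z)) x v

/-- `y` is the left logarithmic derivative at `t` of the curve `η` restricted to `s`. -/
def HasCurveLog (η : ℝ → H) (y : 𝔥) (s : Set ℝ) (t : ℝ) : Prop :=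
  HasCurveDeriv (fun r => chartAt 𝔥 (1 : H) ((η t)⁻¹ * η r)) y s t

/-- For `g = (F x)⁻¹` the open set contains every such `x ∈ U`, since the translated map takes the
value `1` there. All pointwise rules for `logD` come from this local smoothness. -/
theorem SmoothInto.log_aux {F : X → H} {U : Set X} (hF : SmoothInto 𝔥 F U) (hU : IsOpen U) (g : H) :
    IsOpen (U ∩ (fun z => g * F z) ⁻¹' (chartAt 𝔥 (1 : H)).source) ∧
      SmoothOn (fun z => chartAt 𝔥 (1 : H) (g * F z))
        (U ∩ (fun z => g * F z) ⁻¹' (chartAt 𝔥 (1 : H)).source) := by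
  have h := (smoothInto_const g U hU).mul hF hU
  exact ⟨h.isOpen_inter hU (chartAt 𝔥 (1 : H)).open_source, h.2 _ (chart_mem_atlas _ _)⟩

theorem one_mem_source : (1 : H) ∈ (chartAt 𝔥 (1 : H)).source := mem_chart_source _ _

theorem one_mem_target : chartAt 𝔥 (1 : H) 1 ∈ (chartAt 𝔥 (1 : H)).target :=
  mem_chart_target _ _

theorem symm_one : (chartAt 𝔥 (1 : H)).symm (chartAt 𝔥 (1 : H) 1) = 1 :=
  (chartAt 𝔥 (1 : H)).left_inv one_mem_source

theorem smoothInto_chartSymm : SmoothInto 𝔥 (chartAt 𝔥 (1 : H)).symm (chartAt 𝔥 (1 : H)).target :=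
  smoothInto_symm (chart_mem_atlas _ _)

theorem logD_mul_left (h : H) (F : X → H) (x v : X) :
    logD 𝔥 (fun z => h * F z) x v = logD 𝔥 F x v := by
  simp [logD, mul_assoc]

theorem logD_congr {F F' : X → H} {x : X} (h : F =ᶠ[𝓝 x] F') (v : X) :
    logD 𝔥 F x v = logD 𝔥 F' x v := by
  refine dirDeriv_congr ?_ v
  filter_upwards [h] with z hz
  rw [hz, h.self_of_nhds]

theorem SmoothInto.logD_comp {Y : Type*} [AddCommGroup Y] [Module ℝ Y]
    {F : X → H} {U : Set X} (hF : SmoothInto 𝔥 F U) (hU : IsOpen U)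
    {f : Y → X} {y w : Y} {v : X} (hy : f y ∈ U) (hf : HasDirDeriv f v y w) :
    dirDeriv (fun z => chartAt 𝔥 (1 : H) ((F (f y))⁻¹ * F (f z))) y w = logD 𝔥 F (f y) v := by
  obtain ⟨h1, h2⟩ := hF.log_aux hU (F (f y))⁻¹
  exact h2.dirDeriv_comp h1 (f := f) ⟨hy, by simp⟩ hf

theorem SmoothInto.hasCurveLog_comp {F : X → H} {U : Set X} (hF : SmoothInto 𝔥 F U) (hU : IsOpen U)
    {c : ℝ → X} {v : X} {s : Set ℝ} {t : ℝ} (ht : c t ∈ U) (hc : HasCurveDeriv c v s t) :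
    HasCurveLog (fun r => F (c r)) (logD 𝔥 F (c t) v) s t := by
  obtain ⟨h1, h2⟩ := hF.log_aux hU (F (c t))⁻¹
  exact h2.hasCurveDeriv_comp h1 ⟨ht, by simp⟩ hc

theorem SmoothInto.logD_add {F : X → H} {U : Set X} (hF : SmoothInto 𝔥 F U) (hU : IsOpen U)
    {x : X} (hx : x ∈ U) (v w : X) : logD 𝔥 F x (v + w) = logD 𝔥 F x v + logD 𝔥 F x w := by
  obtain ⟨h1, h2⟩ := hF.log_aux hU (F x)⁻¹
  exact h2.dirDeriv_add h1 ⟨hx, by simp⟩ v w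

theorem SmoothInto.logD_smul {F : X → H} {U : Set X} (hF : SmoothInto 𝔥 F U) (hU : IsOpen U)
    {x : X} (hx : x ∈ U) (c : ℝ) (v : X) : logD 𝔥 F x (c • v) = c • logD 𝔥 F x v := by
  obtain ⟨h1, h2⟩ := hF.log_aux hU (F x)⁻¹
  exact h2.dirDeriv_smul h1 ⟨hx, by simp⟩ c v

theorem SmoothInto.linSnd_logD {F : X → H} {U : Set X} (hF : SmoothInto 𝔥 F U) (hU : IsOpen U) :
    LinSnd (fun p : X × X => logD 𝔥 F p.1 p.2) U := fun u hu w z t => by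
  simp only
  rw [hF.logD_add hU hu, hF.logD_smul hU hu]

/-- The base point enters `logD` twice. Decoupling it gives the smooth map `(F p.1)⁻¹ * F p.2` on `U
× U`; its derivative in the second variable along the diagonal is `logD`. -/
theorem SmoothInto.smoothOn_logD {F : X → H} {U : Set X} (hF : SmoothInto 𝔥 F U) (hU : IsOpen U) :
    SmoothOn (fun p : X × X => logD 𝔥 F p.1 p.2) (U ×ˢ univ) := by
  have hUU : IsOpen (U ×ˢ U) := hU.prod hU
  have h1 : SmoothInto 𝔥 (fun p : X × X => (F p.1)⁻¹ * F p.2) (U ×ˢ U) :=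
    ((hF.comp hU (smoothOn_clm (ContinuousLinearMap.fst ℝ X X) _) fun p hp => hp.1).inv hUU).mul
      (hF.comp hU (smoothOn_clm (ContinuousLinearMap.snd ℝ X X) _) fun p hp => hp.2) hUU
  have h2 := h1.2 _ (chart_mem_atlas 𝔥 (1 : H))
  have h3 := h1.isOpen_inter hUU (chartAt 𝔥 (1 : H)).open_source
  have h4 := (h2.tderiv h3).comp (h3.prod isOpen_univ)
    (f := fun p : X × X => ((p.1, p.1), ((0 : X), p.2))) (U := U ×ˢ univ)
    (smoothOn_clm (((ContinuousLinearMap.fst ℝ X X).prod (ContinuousLinearMap.fst ℝ X X)).prod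
      ((0 : X × X →L[ℝ] X).prod (ContinuousLinearMap.snd ℝ X X))) _)
    (fun p hp => ⟨⟨⟨hp.1, hp.1⟩, by simp⟩, trivial⟩)
  refine h4.congr (hU.prod isOpen_univ) fun p hp => ?_
  simp only [LCGeometry.tderiv, logD]
  rw [← dirDeriv_snd]

/-! ### Local multiplication -/

variable (𝔥 H) in
/-- The domain of the multiplication in the chart at `1`. -/
def mulDom : Set (𝔥 × 𝔥) :=
  ((chartAt 𝔥 (1 : H)).target ×ˢ (chartAt 𝔥 (1 : H)).target) ∩
    (fun p => (chartAt 𝔥 (1 : H)).symm p.1 * (chartAt 𝔥 (1 : H)).symm p.2) ⁻¹'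
      (chartAt 𝔥 (1 : H)).source

variable (𝔥 H) in
/-- The multiplication in the chart at `1`. -/
def locMul (p : 𝔥 × 𝔥) : 𝔥 :=
  chartAt 𝔥 (1 : H) ((chartAt 𝔥 (1 : H)).symm p.1 * (chartAt 𝔥 (1 : H)).symm p.2)

theorem smoothInto_chartSymm_fst : SmoothInto 𝔥
    (fun p : 𝔥 × 𝔥 => (chartAt 𝔥 (1 : H)).symm p.1)
    ((chartAt 𝔥 (1 : H)).target ×ˢ (chartAt 𝔥 (1 : H)).target) :=
  smoothInto_chartSymm.comp (chartAt 𝔥 (1 : H)).open_target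
    (smoothOn_clm (ContinuousLinearMap.fst ℝ 𝔥 𝔥) _) fun _ hp => hp.1

theorem smoothInto_chartSymm_snd : SmoothInto 𝔥
    (fun p : 𝔥 × 𝔥 => (chartAt 𝔥 (1 : H)).symm p.2)
    ((chartAt 𝔥 (1 : H)).target ×ˢ (chartAt 𝔥 (1 : H)).target) :=
  smoothInto_chartSymm.comp (chartAt 𝔥 (1 : H)).open_target
    (smoothOn_clm (ContinuousLinearMap.snd ℝ 𝔥 𝔥) _) fun _ hp => hp.2

theorem isOpen_target_prod : IsOpen
    ((chartAt 𝔥 (1 : H)).target ×ˢ (chartAt 𝔥 (1 : H)).target) :=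
  (chartAt 𝔥 (1 : H)).open_target.prod (chartAt 𝔥 (1 : H)).open_target

theorem isOpen_mulDom : IsOpen (mulDom 𝔥 H) :=
  (smoothInto_chartSymm_fst.mul smoothInto_chartSymm_snd isOpen_target_prod).isOpen_inter
    isOpen_target_prod (chartAt 𝔥 (1 : H)).open_source

theorem smoothOn_locMul : SmoothOn (locMul 𝔥 H) (mulDom 𝔥 H) :=
  (smoothInto_chartSymm_fst.mul smoothInto_chartSymm_snd isOpen_target_prod).2 _
    (chart_mem_atlas _ _)

theorem mem_mulDom_one {x : 𝔥} (hx : x ∈ (chartAt 𝔥 (1 : H)).target) :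
    (x, chartAt 𝔥 (1 : H) 1) ∈ mulDom 𝔥 H :=
  ⟨⟨hx, one_mem_target⟩, by simpa [symm_one] using (chartAt 𝔥 (1 : H)).map_target hx⟩

theorem one_mem_mulDom {x : 𝔥} (hx : x ∈ (chartAt 𝔥 (1 : H)).target) :
    (chartAt 𝔥 (1 : H) 1, x) ∈ mulDom 𝔥 H :=
  ⟨⟨one_mem_target, hx⟩, by simpa [symm_one] using (chartAt 𝔥 (1 : H)).map_target hx⟩

theorem locMul_one {x : 𝔥} (hx : x ∈ (chartAt 𝔥 (1 : H)).target) :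
    locMul 𝔥 H (x, chartAt 𝔥 (1 : H) 1) = x := by
  simp [locMul, (chartAt 𝔥 (1 : H)).right_inv hx]

theorem one_locMul {x : 𝔥} (hx : x ∈ (chartAt 𝔥 (1 : H)).target) :
    locMul 𝔥 H (chartAt 𝔥 (1 : H) 1, x) = x := by
  simp [locMul, (chartAt 𝔥 (1 : H)).right_inv hx]

theorem leftInvariantRep_eq (B x : 𝔥) :
    leftInvariantRep H B x = dirDeriv (locMul 𝔥 H) (x, chartAt 𝔥 (1 : H) 1) (0, B) := by
  rw [← dirDeriv_snd]
  rfl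

variable (𝔥 H) in
/-- Left invariant vector fields in the chart at `1`, as a function of base point and generator. -/
def leftRep (p : 𝔥 × 𝔥) : 𝔥 := leftInvariantRep H p.2 p.1

theorem linSnd_leftRep : LinSnd (leftRep 𝔥 H) (chartAt 𝔥 (1 : H)).target := fun u hu w z t => by
  simp only [leftRep, leftInvariantRep_eq]
  have h := fun v w => (smoothOn_locMul (𝔥 := 𝔥) (H := H)).dirDeriv_add isOpen_mulDom
    (mem_mulDom_one hu) v w
  have h' := fun c v => (smoothOn_locMul (𝔥 := 𝔥) (H := H)).dirDeriv_smul isOpen_mulDom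
    (mem_mulDom_one hu) c v
  rw [← h', ← h]
  simp

theorem smoothOn_leftRep : SmoothOn (leftRep 𝔥 H) ((chartAt 𝔥 (1 : H)).target ×ˢ univ) := by
  have hc : SmoothOn (fun p : 𝔥 × 𝔥 => ((p.1, chartAt 𝔥 (1 : H) 1), ((0 : 𝔥), p.2)))
      ((chartAt 𝔥 (1 : H)).target ×ˢ univ) :=
    ((smoothOn_clm (ContinuousLinearMap.fst ℝ 𝔥 𝔥) _).prodMk (smoothOn_const _ _)).prodMk
      ((smoothOn_const _ _).prodMk (smoothOn_clm (ContinuousLinearMap.snd ℝ 𝔥 𝔥) _))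
  have := (smoothOn_locMul (𝔥 := 𝔥) (H := H)).tderiv isOpen_mulDom |>.comp
    (isOpen_mulDom.prod isOpen_univ) hc fun p hp => ⟨mem_mulDom_one hp.1, trivial⟩
  refine this.congr ((chartAt 𝔥 (1 : H)).open_target.prod isOpen_univ) fun p _ => ?_
  simp only [leftRep, leftInvariantRep_eq, LCGeometry.tderiv]

theorem hasDirDeriv_id (x v : X) : HasDirDeriv (fun z : X => z) v x v :=
  hasDirDeriv_clm (ContinuousLinearMap.id ℝ X) x v

theorem dirDeriv_id [T2Space X] (x v : X) : dirDeriv (fun z : X => z) x v = v :=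
  (hasDirDeriv_id x v).dirDeriv_eq

theorem leftRep_one (B : 𝔥) : leftRep 𝔥 H (chartAt 𝔥 (1 : H) 1, B) = B := by
  rw [leftRep, leftInvariantRep]
  refine (dirDeriv_congr ?_ B).trans (dirDeriv_id _ B)
  filter_upwards [(chartAt 𝔥 (1 : H)).open_target.mem_nhds one_mem_target] with y hy
  exact one_locMul hy

theorem dirDeriv_locMul_fst_one (B : 𝔥) : dirDeriv (locMul 𝔥 H)
    (chartAt 𝔥 (1 : H) 1, chartAt 𝔥 (1 : H) 1) (B, 0) = B := by
  rw [← dirDeriv_fst]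
  refine (dirDeriv_congr ?_ B).trans (dirDeriv_id _ B)
  filter_upwards [(chartAt 𝔥 (1 : H)).open_target.mem_nhds one_mem_target] with y hy
  exact locMul_one hy

theorem lieBracket_eq (A B : 𝔥) : lieBracket H A B
    = dirDeriv (fun x => leftRep 𝔥 H (x, B)) (chartAt 𝔥 (1 : H) 1) A
      - dirDeriv (fun x => leftRep 𝔥 H (x, A)) (chartAt 𝔥 (1 : H) 1) B := rfl

theorem lieBracket_skew (A B : 𝔥) : lieBracket H B A = -lieBracket H A B := by
  rw [lieBracket_eq, lieBracket_eq, neg_sub]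

theorem hasDirDeriv_leftRep {u : 𝔥} (hu : u ∈ (chartAt 𝔥 (1 : H)).target) (B A : 𝔥) :
    HasDirDeriv (fun x => leftRep 𝔥 H (x, B)) (dirDeriv (fun x => leftRep 𝔥 H (x, B)) u A) u A := by
  rw [hasDirDeriv_fst_iff, dirDeriv_fst]
  exact smoothOn_leftRep.hasDirDeriv ((chartAt 𝔥 (1 : H)).open_target.prod isOpen_univ)
    ⟨hu, trivial⟩ _

theorem dirDeriv_leftRep_linear {u : 𝔥} (hu : u ∈ (chartAt 𝔥 (1 : H)).target) (A B C : 𝔥) (t : ℝ) :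
    dirDeriv (fun x => leftRep 𝔥 H (x, B + t • C)) u A
      = dirDeriv (fun x => leftRep 𝔥 H (x, B)) u A
        + t • dirDeriv (fun x => leftRep 𝔥 H (x, C)) u A := by
  refine HasDirDeriv.dirDeriv_eq ?_
  have h := (Tendsto.add (hasDirDeriv_leftRep hu B A) ((hasDirDeriv_leftRep hu C A).const_smul t))
  have : HasDirDeriv (fun x => leftRep 𝔥 H (x, B) + t • leftRep 𝔥 H (x, C))
      (dirDeriv (fun x => leftRep 𝔥 H (x, B)) u A
        + t • dirDeriv (fun x => leftRep 𝔥 H (x, C)) u A) u A :=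
    h.congr fun r => by module
  refine this.congr ?_
  filter_upwards [(chartAt 𝔥 (1 : H)).open_target.mem_nhds hu] with x hx
  exact (linSnd_leftRep x hx B C t).symm

theorem dirDeriv_leftRep_smul {u : 𝔥} (hu : u ∈ (chartAt 𝔥 (1 : H)).target) (A B : 𝔥) (t : ℝ) :
    dirDeriv (fun x => leftRep 𝔥 H (x, t • B)) u A
      = t • dirDeriv (fun x => leftRep 𝔥 H (x, B)) u A := by
  have h0 : dirDeriv (fun x => leftRep 𝔥 H (x, 0)) u A = 0 := by
    have := dirDeriv_leftRep_linear hu A 0 0 1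
    simpa using this
  have := dirDeriv_leftRep_linear hu A 0 B t
  rwa [zero_add, h0, zero_add] at this

theorem smoothOn_leftRep_fst (B : 𝔥) :
    SmoothOn (fun x => leftRep 𝔥 H (x, B)) (chartAt 𝔥 (1 : H)).target :=
  smoothOn_leftRep.comp ((chartAt 𝔥 (1 : H)).open_target.prod isOpen_univ)
    ((smoothOn_id _).prodMk (smoothOn_const _ _)) fun _ hx => ⟨hx, trivial⟩

theorem lieBracket_smul_right (A B : 𝔥) (t : ℝ) :
    lieBracket H A (t • B) = t • lieBracket H A B := by
  rw [lieBracket_eq, lieBracket_eq, dirDeriv_leftRep_smul one_mem_target,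
    (smoothOn_leftRep_fst A).dirDeriv_smul (chartAt 𝔥 (1 : H)).open_target one_mem_target, smul_sub]

theorem lieBracket_sub_right (A B C : 𝔥) :
    lieBracket H A (B - C) = lieBracket H A B - lieBracket H A C := by
  have := dirDeriv_leftRep_linear (H := H) one_mem_target A B C (-1)
  simp only [neg_smul, one_smul, ← sub_eq_add_neg] at this
  rw [lieBracket_eq, lieBracket_eq, lieBracket_eq, this,
    (smoothOn_leftRep_fst A).dirDeriv_sub (chartAt 𝔥 (1 : H)).open_target one_mem_target]
  abel

/-- The derivative of `F` in the chart at `1` in terms of the logarithmic derivative. -/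
theorem SmoothInto.dirDeriv_chart {F : X → H} {U : Set X} (hF : SmoothInto 𝔥 F U) (hU : IsOpen U)
    {x : X} (hx : x ∈ U) (hFx : F x ∈ (chartAt 𝔥 (1 : H)).source) (v : X) :
    HasDirDeriv (fun z => chartAt 𝔥 (1 : H) (F z))
      (leftRep 𝔥 H (chartAt 𝔥 (1 : H) (F x), logD 𝔥 F x v)) x v := by
  obtain ⟨h1, h2⟩ := hF.log_aux hU (F x)⁻¹
  have hxO : x ∈ U ∩ (fun z => (F x)⁻¹ * F z) ⁻¹' (chartAt 𝔥 (1 : H)).source :=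
    ⟨hx, by simp⟩
  have h3 := (smoothOn_locMul (𝔥 := 𝔥) (H := H)).hasDirDeriv_comp isOpen_mulDom
    (f := fun z => (chartAt 𝔥 (1 : H) (F x), chartAt 𝔥 (1 : H) ((F x)⁻¹ * F z))) (x := x) (v := v)
    (by simpa using mem_mulDom_one ((chartAt 𝔥 (1 : H)).map_source hFx))
    ((hasDirDeriv_const _ _ _).prodMk (h2.hasDirDeriv h1 hxO v))
  simp only [inv_mul_cancel] at h3
  rw [← leftInvariantRep_eq] at h3
  refine h3.congr ?_
  filter_upwards [h1.mem_nhds hxO] with z hz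
  have hz2 : (F x)⁻¹ * F z ∈ (chartAt 𝔥 (1 : H)).source := hz.2
  simp [locMul, (chartAt 𝔥 (1 : H)).left_inv hz2, (chartAt 𝔥 (1 : H)).left_inv hFx]

/-- Left translation back to `1` inverts the left invariant frame: the logarithmic derivative of the
inverse chart at `u` sends `leftRep (u, B)` to `B`. -/
theorem leftRep_injective {u B C : 𝔥} (hu : u ∈ (chartAt 𝔥 (1 : H)).target)
    (h : leftRep 𝔥 H (u, B) = leftRep 𝔥 H (u, C)) : B = C := by
  have key : ∀ B, logD 𝔥 (chartAt 𝔥 (1 : H)).symm u (leftRep 𝔥 H (u, B)) = B := by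
    intro B
    obtain ⟨h1, h2⟩ := (smoothInto_chartSymm (𝔥 := 𝔥) (H := H)).log_aux
      (chartAt 𝔥 (1 : H)).open_target ((chartAt 𝔥 (1 : H)).symm u)⁻¹
    have h3 : HasDirDeriv (fun z => locMul 𝔥 H (u, z)) (leftRep 𝔥 H (u, B))
        (chartAt 𝔥 (1 : H) 1) B :=
      (smoothOn_locMul (𝔥 := 𝔥) (H := H)).hasDirDeriv_comp isOpen_mulDom
        (f := fun z => (u, z)) (mem_mulDom_one hu)
        ((hasDirDeriv_const _ _ _).prodMk (hasDirDeriv_id _ _)) |> fun h => by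
          rwa [← leftInvariantRep_eq] at h
    have h4 := h2.dirDeriv_comp h1 (f := fun z => locMul 𝔥 H (u, z)) (x := chartAt 𝔥 (1 : H) 1)
      (by simp [locMul_one hu, hu]) h3
    simp only [locMul_one hu] at h4
    rw [logD, ← h4]
    refine (dirDeriv_congr ?_ B).trans (dirDeriv_id (chartAt 𝔥 (1 : H) 1) B)
    have h5 : ∀ᶠ z in 𝓝 (chartAt 𝔥 (1 : H) 1), (u, z) ∈ mulDom 𝔥 H := by
      have : Tendsto (fun z => (u, z)) (𝓝 (chartAt 𝔥 (1 : H) 1)) (𝓝 (u, chartAt 𝔥 (1 : H) 1)) :=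
        (Continuous.prodMk_right u).tendsto _
      exact this.eventually (isOpen_mulDom.mem_nhds (mem_mulDom_one hu))
    filter_upwards [h5] with z hz
    have hz2 := (chartAt 𝔥 (1 : H)).left_inv hz.2
    simp [locMul, hz2, (chartAt 𝔥 (1 : H)).right_inv hz.1.2]
  rw [← key B, h, key C]

end Log

section Uniqueness

variable {𝔥 H : Type*} [AddCommGroup 𝔥] [Module ℝ 𝔥] [TopologicalSpace 𝔥]
  [IsTopologicalAddGroup 𝔥] [ContinuousSMul ℝ 𝔥] [LocallyConvexSpace ℝ 𝔥] [T2Space 𝔥]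
  [TopologicalSpace H] [ChartedSpace 𝔥 H] [Group H] [LCLieGroup 𝔥 H]
  {X : Type*} [AddCommGroup X] [Module ℝ X] [TopologicalSpace X]
  [IsTopologicalAddGroup X] [ContinuousSMul ℝ X]

/-! ### Uniqueness of solutions of the logarithmic equation -/

theorem smooth_conj_div (g : H) : ∃ O : Set (𝔥 × 𝔥), IsOpen O ∧
    (chartAt 𝔥 (1 : H) 1, chartAt 𝔥 (1 : H) 1) ∈ O ∧
    SmoothOn (fun p : 𝔥 × 𝔥 => chartAt 𝔥 (1 : H) (g * ((chartAt 𝔥 (1 : H)).symm p.1 *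
      ((chartAt 𝔥 (1 : H)).symm p.2)⁻¹) * g⁻¹)) O ∧
    ∀ p ∈ O, g * ((chartAt 𝔥 (1 : H)).symm p.1 * ((chartAt 𝔥 (1 : H)).symm p.2)⁻¹) * g⁻¹
      ∈ (chartAt 𝔥 (1 : H)).source := by
  have hop := isOpen_target_prod (𝔥 := 𝔥) (H := H)
  have h := ((smoothInto_const (𝔫 := 𝔥) g _ hop).mul (smoothInto_chartSymm_fst.mul
    (smoothInto_chartSymm_snd.inv hop) hop) hop).mul (smoothInto_const g⁻¹ _ hop) hop
  exact ⟨_, h.isOpen_inter hop (chartAt 𝔥 (1 : H)).open_source,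
    ⟨⟨one_mem_target, one_mem_target⟩, by simp⟩, h.2 _ (chart_mem_atlas _ _),
    fun p hp => hp.2⟩

theorem eventually_translate_mem {η : ℝ → H} {s : Set ℝ} {t : ℝ} (h : ContinuousWithinAt η s t) :
    ∀ᶠ r in 𝓝[s] t, (η t)⁻¹ * η r ∈ (chartAt 𝔥 (1 : H)).source := by
  have := LCLieGroup.isTopologicalGroup 𝔥 H
  have h1 : Tendsto (fun r => (η t)⁻¹ * η r) (𝓝[s] t) (𝓝 ((η t)⁻¹ * η t)) :=
    Tendsto.const_mul _ h
  rw [inv_mul_cancel] at h1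
  exact h1.eventually ((chartAt 𝔥 (1 : H)).open_source.mem_nhds one_mem_source)

/-- The normalized quotient is `η₂(t) (η₁(t)⁻¹ η₁(r)) (η₂(t)⁻¹ η₂(r))⁻¹ η₂(t)⁻¹`, a smooth function
of two curves through `1` with the same velocity `y`. -/
theorem HasCurveLog.div {η₁ η₂ : ℝ → H} {y : 𝔥} {s : Set ℝ} {t : ℝ}
    (h1 : HasCurveLog η₁ y s t) (h2 : HasCurveLog η₂ y s t) (hc1 : ContinuousWithinAt η₁ s t)
    (hc2 : ContinuousWithinAt η₂ s t) : HasCurveLog (fun r => η₁ r * (η₂ r)⁻¹) (0 : 𝔥) s t := by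
  obtain ⟨O, hO, hmem, hN, -⟩ := smooth_conj_div (𝔥 := 𝔥) (η₂ t)
  have h3 := hN.hasCurveDeriv_comp hO (s := s) (t := t)
    (c := fun r => (chartAt 𝔥 (1 : H) ((η₁ t)⁻¹ * η₁ r), chartAt 𝔥 (1 : H) ((η₂ t)⁻¹ * η₂ r)))
    (by simpa using hmem) (HasCurveDeriv.prodMk h1 h2)
  -- In the direction `(y, y)` both arguments stay equal, so the map is identically `g a a⁻¹ g⁻¹ =
  -- 1` along the line.
  have hz : dirDeriv (fun p : 𝔥 × 𝔥 => chartAt 𝔥 (1 : H) (η₂ t * ((chartAt 𝔥 (1 : H)).symm p.1 *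
      ((chartAt 𝔥 (1 : H)).symm p.2)⁻¹) * (η₂ t)⁻¹))
      (chartAt 𝔥 (1 : H) ((η₁ t)⁻¹ * η₁ t), chartAt 𝔥 (1 : H) ((η₂ t)⁻¹ * η₂ t)) (y, y) = 0 := by
    refine Tendsto.limUnder_eq ?_
    simp
  rw [hz] at h3
  refine h3.congr ?_ (by simp)
  filter_upwards [eventually_translate_mem (𝔥 := 𝔥) hc1, eventually_translate_mem (𝔥 := 𝔥) hc2]
    with r e1 e2
  rw [(chartAt 𝔥 (1 : H)).left_inv e1, (chartAt 𝔥 (1 : H)).left_inv e2]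
  congr 1
  group

theorem smooth_translate (g : H) : ∃ O : Set 𝔥, IsOpen O ∧
    (g ∈ (chartAt 𝔥 (1 : H)).source → chartAt 𝔥 (1 : H) 1 ∈ O) ∧
    SmoothOn (fun x : 𝔥 => chartAt 𝔥 (1 : H) (g * (chartAt 𝔥 (1 : H)).symm x)) O := by
  have hop := (chartAt 𝔥 (1 : H)).open_target
  have h := (smoothInto_const (𝔫 := 𝔥) g _ hop).mul smoothInto_chartSymm hop
  exact ⟨_, h.isOpen_inter hop (chartAt 𝔥 (1 : H)).open_source,
    fun hg => ⟨one_mem_target, by simpa [symm_one] using hg⟩, h.2 _ (chart_mem_atlas _ _)⟩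

/-- A zero derivative stays zero under the smooth change from the translate by `(η t)⁻¹` to the
translate by `g`. Hence a single chart can be used for all `t` near a given point. -/
theorem HasCurveLog.translate_zero {η : ℝ → H} {s : Set ℝ} {t : ℝ} (g : H)
    (h : HasCurveLog η (0 : 𝔥) s t) (hc : ContinuousWithinAt η s t)
    (hg : g * η t ∈ (chartAt 𝔥 (1 : H)).source) :
    HasCurveDeriv (fun r => chartAt 𝔥 (1 : H) (g * η r)) 0 s t := by
  obtain ⟨O, hO, hmem, hN⟩ := smooth_translate (𝔥 := 𝔥) (g * η t)
  have hmem' : chartAt 𝔥 (1 : H) ((η t)⁻¹ * η t) ∈ O := by simpa using hmem hg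
  have h3 := hN.hasCurveDeriv_comp hO hmem' h
  rw [hN.dirDeriv_zero hO hmem'] at h3
  refine h3.congr ?_ (by simp)
  filter_upwards [eventually_translate_mem (𝔥 := 𝔥) hc] with r e1
  rw [(chartAt 𝔥 (1 : H)).left_inv e1]
  congr 1
  group

/-- A curve with vanishing logarithmic derivative is constant. -/
theorem eq_of_hasCurveLog_zero {η : ℝ → H} {a b : ℝ} (hc : ContinuousOn η (Icc a b))
    (h : ∀ t ∈ Icc a b, HasCurveLog η (0 : 𝔥) (Icc a b) t) {t t' : ℝ} (ht : t ∈ Icc a b)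
    (ht' : t' ∈ Icc a b) : η t = η t' := by
  have := LCLieGroup.isTopologicalGroup 𝔥 H
  -- Connectedness reduces the claim to local constancy. Near `x` the chart after translation by `(η
  -- x)⁻¹` is injective, and the vector-valued curve in it has derivative zero.
  refine isPreconnected_Icc.induction₂ (fun x y => η x = η y) (fun x hx => ?_)
    (fun x y z _ _ _ h1 h2 => h1.trans h2) (fun x y _ _ h => h.symm) ht ht'
  have h1 := eventually_translate_mem (𝔥 := 𝔥) (hc x hx)
  rw [eventually_nhdsWithin_iff, Metric.eventually_nhds_iff_ball] at h1
  obtain ⟨ε, hε, hball⟩ := h1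
  rw [eventually_nhdsWithin_iff]
  filter_upwards [Metric.ball_mem_nhds x hε] with y hy hyI
  have hconn : ∀ c d : ℝ, c ∈ Icc a b → d ∈ Icc a b → c ∈ Metric.ball x ε → d ∈ Metric.ball x ε →
      c ≤ d → η d = η c := by
    intro c d hc' hd' hcb hdb hcd
    have hsub : Icc c d ⊆ Icc a b := Icc_subset_Icc hc'.1 hd'.2
    have hsub2 : Icc c d ⊆ Metric.ball x ε := by
      rw [Real.ball_eq_Ioo] at *
      exact fun z hz => ⟨hcb.1.trans_le hz.1, hz.2.trans_lt hdb.2⟩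
    have e1 := eq_of_hasCurveDeriv_zero (c := fun r => chartAt 𝔥 (1 : H) ((η x)⁻¹ * η r))
      (fun t ht => ((h t (hsub ht)).translate_zero _ (hc t (hsub ht))
        (hball t (hsub2 ht) (hsub ht))).mono hsub) hcd
    have := (chartAt 𝔥 (1 : H)).injOn (hball d hdb hd') (hball c hcb hc') e1
    exact mul_left_cancel this
  rcases le_total x y with hxy | hxy
  · exact (hconn x y hx hyI (Metric.mem_ball_self hε) hy hxy).symm
  · exact hconn y x hyI hx hy (Metric.mem_ball_self hε) hxy

theorem div_eq_of_hasCurveLog {η₁ η₂ : ℝ → H} {y : ℝ → 𝔥} {a b : ℝ}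
    (hc1 : ContinuousOn η₁ (Icc a b)) (hc2 : ContinuousOn η₂ (Icc a b))
    (h1 : ∀ t ∈ Icc a b, HasCurveLog η₁ (y t) (Icc a b) t)
    (h2 : ∀ t ∈ Icc a b, HasCurveLog η₂ (y t) (Icc a b) t) {t t' : ℝ} (ht : t ∈ Icc a b)
    (ht' : t' ∈ Icc a b) : η₁ t * (η₂ t)⁻¹ = η₁ t' * (η₂ t')⁻¹ := by
  have := LCLieGroup.isTopologicalGroup 𝔥 H
  exact eq_of_hasCurveLog_zero (𝔥 := 𝔥) (η := fun t => η₁ t * (η₂ t)⁻¹) (hc1.mul hc2.inv)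
    (fun t ht => (h1 t ht).div (h2 t ht) (hc1 t ht) (hc2 t ht)) ht ht'

theorem hasCurveDeriv_segment (x v : X) (s : Set ℝ) (t : ℝ) :
    HasCurveDeriv (fun r : ℝ => x + r • v) v s t :=
  hasCurveDeriv_line (f := fun z => z) (hasDirDeriv_id _ _)

theorem SmoothInto.hasCurveLog_segment {F : X → H} {U : Set X} (hF : SmoothInto 𝔥 F U)
    (hU : IsOpen U) {x v : X} {s : Set ℝ} {t : ℝ} (ht : x + t • v ∈ U) :
    HasCurveLog (fun r => F (x + r • v)) (logD 𝔥 F (x + t • v) v) s t :=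
  hF.hasCurveLog_comp hU ht (hasCurveDeriv_segment x v s t)

theorem SmoothInto.div_eq_of_logD_eq {F F' : X → H} {U : Set X} (hF : SmoothInto 𝔥 F U)
    (hF' : SmoothInto 𝔥 F' U) (hU : IsOpen U)
    (hlog : ∀ x ∈ U, ∀ v, logD 𝔥 F x v = logD 𝔥 F' x v) {x y : X} (hxy : segment ℝ x y ⊆ U) :
    F x * (F' x)⁻¹ = F y * (F' y)⁻¹ := by
  have hmem : ∀ t ∈ Icc (0 : ℝ) 1, x + t • (y - x) ∈ U := fun t ht => hxy (by
    rw [segment_eq_image']; exact ⟨t, ht, rfl⟩)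
  have hcont : ContinuousOn (fun t : ℝ => x + t • (y - x)) (Icc 0 1) := by fun_prop
  have := div_eq_of_hasCurveLog (𝔥 := 𝔥) (y := fun t => logD 𝔥 F (x + t • (y - x)) (y - x))
    (hF.1.comp hcont hmem) (hF'.1.comp hcont hmem)
    (fun t ht => hF.hasCurveLog_segment hU (hmem t ht)) (fun t ht => by
      rw [hlog _ (hmem t ht)]; exact hF'.hasCurveLog_segment hU (hmem t ht))
    (left_mem_Icc.2 zero_le_one) (right_mem_Icc.2 zero_le_one)
  simpa using this

/-! ### The Maurer–Cartan equation for logarithmic derivatives -/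

/-- Translate so that `F x = 1`. In the chart at `1` the first derivative is `leftRep (F, logD F)`;
differentiating once more at `x` gives `d(logD F)` plus a derivative of a left invariant field.
Symmetry of second derivatives makes the antisymmetrization vanish, and the field terms combine to
the bracket. -/
theorem SmoothInto.maurerCartan {F : X → H} {U : Set X} (hF : SmoothInto 𝔥 F U) (hU : IsOpen U)
    {x : X} (hx : x ∈ U) (v w : X) :
    dirDeriv (fun z => logD 𝔥 F z w) x v - dirDeriv (fun z => logD 𝔥 F z v) x w
      + lieBracket H (logD 𝔥 F x v) (logD 𝔥 F x w) = 0 := by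
  set F₁ : X → H := fun z => (F x)⁻¹ * F z with hF₁
  have hF₁s : SmoothInto 𝔥 F₁ U := (smoothInto_const _ U hU).mul hF hU
  have hlog : ∀ z v, logD 𝔥 F₁ z v = logD 𝔥 F z v := fun z v => logD_mul_left _ F z v
  set O := U ∩ F₁ ⁻¹' (chartAt 𝔥 (1 : H)).source with hO
  have hOo : IsOpen O := hF₁s.isOpen_inter hU (chartAt 𝔥 (1 : H)).open_source
  have hF₁x : F₁ x = 1 := by simp [hF₁]
  have hxO : x ∈ O := ⟨hx, by simp [hF₁x]⟩
  have hder : ∀ z ∈ O, ∀ v, HasDirDeriv (fun z => chartAt 𝔥 (1 : H) (F₁ z))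
      (leftRep 𝔥 H (chartAt 𝔥 (1 : H) (F₁ z), logD 𝔥 F z v)) z v := fun z hz v => by
    rw [← hlog]; exact hF₁s.dirDeriv_chart hU hz.1 hz.2 v
  have hsec : ∀ v w, dirDeriv (fun z => dirDeriv (fun z => chartAt 𝔥 (1 : H) (F₁ z)) z w) x v
      = dirDeriv (fun u => leftRep 𝔥 H (u, logD 𝔥 F x w)) (chartAt 𝔥 (1 : H) 1) (logD 𝔥 F x v)
        + dirDeriv (fun z => logD 𝔥 F z w) x v := by
    intro v w
    have h1 : HasDirDeriv (fun z => logD 𝔥 F z w) (dirDeriv (fun z => logD 𝔥 F z w) x v) x v := by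
      rw [hasDirDeriv_fst_iff (f := fun p : X × X => logD 𝔥 F p.1 p.2),
        dirDeriv_fst (fun p : X × X => logD 𝔥 F p.1 p.2)]
      exact (hF.smoothOn_logD hU).hasDirDeriv (hU.prod isOpen_univ) ⟨hx, trivial⟩ _
    have h2 := smoothOn_leftRep.hasDirDeriv_linSnd (chartAt 𝔥 (1 : H)).open_target
      (linSnd_leftRep (𝔥 := 𝔥) (H := H)) (f := fun z => chartAt 𝔥 (1 : H) (F₁ z))
      (g := fun z => logD 𝔥 F z w) ((chartAt 𝔥 (1 : H)).map_source hxO.2) (hder x hxO v) h1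
    rw [hF₁x, leftRep_one, leftRep_one] at h2
    refine HasDirDeriv.dirDeriv_eq (h2.congr ?_)
    filter_upwards [hOo.mem_nhds hxO] with z hz
    exact ((hder z hz w).dirDeriv_eq).symm
  have hsymm := (hF₁s.2 _ (chart_mem_atlas 𝔥 (1 : H))).dirDeriv_symm hOo hxO v w
  rw [hsec, hsec] at hsymm
  rw [lieBracket_eq]
  rw [← sub_eq_zero.2 hsymm]
  abel

/-! ### The adjoint representation -/

/-- The adjoint representation. -/
def AdRep (g : H) (B : 𝔥) : 𝔥 :=
  dirDeriv (fun y => chartAt 𝔥 (1 : H) (g * (chartAt 𝔥 (1 : H)).symm y * g⁻¹))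
    (chartAt 𝔥 (1 : H) 1) B

variable (𝔥) in
theorem smooth_conj (g : H) : ∃ O : Set 𝔥, IsOpen O ∧ chartAt 𝔥 (1 : H) 1 ∈ O ∧
    SmoothOn (fun x : 𝔥 => chartAt 𝔥 (1 : H) (g * (chartAt 𝔥 (1 : H)).symm x * g⁻¹)) O ∧
    ∀ x ∈ O, x ∈ (chartAt 𝔥 (1 : H)).target ∧
      g * (chartAt 𝔥 (1 : H)).symm x * g⁻¹ ∈ (chartAt 𝔥 (1 : H)).source := by
  have hop := (chartAt 𝔥 (1 : H)).open_target
  have h := ((smoothInto_const (𝔫 := 𝔥) g _ hop).mul smoothInto_chartSymm hop).mul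
    (smoothInto_const g⁻¹ _ hop) hop
  exact ⟨_, h.isOpen_inter hop (chartAt 𝔥 (1 : H)).open_source,
    ⟨one_mem_target, by simp⟩, h.2 _ (chart_mem_atlas _ _), fun x hx => hx⟩

theorem AdRep_mul (g g' : H) (B : 𝔥) : AdRep (g * g') B = AdRep g (AdRep g' B) := by
  obtain ⟨O, hO, h1, h2, -⟩ := smooth_conj 𝔥 g
  obtain ⟨O', hO', h1', h2', h3'⟩ := smooth_conj 𝔥 g'
  have h := h2.dirDeriv_comp hO (x := chartAt 𝔥 (1 : H) 1) (v := B) (by simpa using h1)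
    (h2'.hasDirDeriv hO' h1' B)
  simp only [symm_one, mul_one, mul_inv_cancel] at h
  rw [AdRep, AdRep, AdRep, ← h]
  refine dirDeriv_congr ?_ B
  filter_upwards [hO'.mem_nhds h1'] with x hx
  rw [(chartAt 𝔥 (1 : H)).left_inv (h3' x hx).2]
  simp [mul_assoc]

theorem AdRep_one (B : 𝔥) : AdRep (1 : H) B = B := by
  refine (dirDeriv_congr ?_ B).trans (dirDeriv_id (chartAt 𝔥 (1 : H) 1) B)
  filter_upwards [(chartAt 𝔥 (1 : H)).open_target.mem_nhds one_mem_target] with x hx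
  simp [(chartAt 𝔥 (1 : H)).right_inv hx]

theorem AdRep_inv_AdRep (g : H) (B : 𝔥) : AdRep g⁻¹ (AdRep g B) = B := by
  rw [← AdRep_mul, inv_mul_cancel, AdRep_one]

theorem AdRep_zero (g : H) : AdRep g (0 : 𝔥) = 0 := by
  obtain ⟨O, hO, h1, h2, -⟩ := smooth_conj 𝔥 g
  exact h2.dirDeriv_zero hO h1

variable (H) in
-- The last clause is the derivative of `x y = (x y x⁻¹) x` at `y = 1`: a left invariant field is
-- the right translate of `Ad x B`.
theorem smooth_AdRep_chart : ∃ O : Set 𝔥, IsOpen O ∧ chartAt 𝔥 (1 : H) 1 ∈ O ∧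
    O ⊆ (chartAt 𝔥 (1 : H)).target ∧
    SmoothOn (fun p : 𝔥 × 𝔥 => AdRep ((chartAt 𝔥 (1 : H)).symm p.1) p.2) (O ×ˢ univ) ∧
    LinSnd (fun p : 𝔥 × 𝔥 => AdRep ((chartAt 𝔥 (1 : H)).symm p.1) p.2) O ∧
    ∀ x ∈ O, ∀ B, leftRep 𝔥 H (x, B) = dirDeriv (locMul 𝔥 H) (chartAt 𝔥 (1 : H) 1, x)
      (AdRep ((chartAt 𝔥 (1 : H)).symm x) B, 0) := by
  have hop := isOpen_target_prod (𝔥 := 𝔥) (H := H)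
  have h := (smoothInto_chartSymm_fst.mul smoothInto_chartSymm_snd hop).mul
    (smoothInto_chartSymm_fst.inv hop) hop
  set P := (chartAt 𝔥 (1 : H)).target with hP
  have hC := h.2 _ (chart_mem_atlas 𝔥 (1 : H))
  have hCo := h.isOpen_inter hop (chartAt 𝔥 (1 : H)).open_source
  have hin : ∀ x ∈ P, (x, chartAt 𝔥 (1 : H) 1) ∈ (P ×ˢ P) ∩ (fun p : 𝔥 × 𝔥 =>
      (chartAt 𝔥 (1 : H)).symm p.1 * (chartAt 𝔥 (1 : H)).symm p.2 *
      ((chartAt 𝔥 (1 : H)).symm p.1)⁻¹) ⁻¹' (chartAt 𝔥 (1 : H)).source := fun x hx =>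
    ⟨⟨hx, one_mem_target⟩, by simp⟩
  have heq : ∀ x B, AdRep ((chartAt 𝔥 (1 : H)).symm x) B = dirDeriv (fun p : 𝔥 × 𝔥 =>
      chartAt 𝔥 (1 : H) ((chartAt 𝔥 (1 : H)).symm p.1 * (chartAt 𝔥 (1 : H)).symm p.2 *
      ((chartAt 𝔥 (1 : H)).symm p.1)⁻¹)) (x, chartAt 𝔥 (1 : H) 1) (0, B) := fun x B => by
    rw [← dirDeriv_snd]; rfl
  refine ⟨P, (chartAt 𝔥 (1 : H)).open_target, one_mem_target, subset_rfl, ?_, ?_, ?_⟩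
  · have hc : SmoothOn (fun p : 𝔥 × 𝔥 => ((p.1, chartAt 𝔥 (1 : H) 1), ((0 : 𝔥), p.2)))
        (P ×ˢ univ) :=
      ((smoothOn_clm (ContinuousLinearMap.fst ℝ 𝔥 𝔥) _).prodMk (smoothOn_const _ _)).prodMk
        ((smoothOn_const _ _).prodMk (smoothOn_clm (ContinuousLinearMap.snd ℝ 𝔥 𝔥) _))
    refine ((hC.tderiv hCo).comp (hCo.prod isOpen_univ) hc
      fun p hp => ⟨hin _ hp.1, trivial⟩).congr
      ((chartAt 𝔥 (1 : H)).open_target.prod isOpen_univ) fun p _ => ?_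
    simp only [LCGeometry.tderiv, heq]
  · intro u hu w z t
    simp only [heq]
    rw [← hC.dirDeriv_smul hCo (hin u hu), ← hC.dirDeriv_add hCo (hin u hu)]
    simp
  · intro x hx B
    have h1 : HasDirDeriv (fun y => chartAt 𝔥 (1 : H) ((chartAt 𝔥 (1 : H)).symm x *
        (chartAt 𝔥 (1 : H)).symm y * ((chartAt 𝔥 (1 : H)).symm x)⁻¹))
        (AdRep ((chartAt 𝔥 (1 : H)).symm x) B) (chartAt 𝔥 (1 : H) 1) B := by
      rw [heq]
      exact hC.hasDirDeriv_comp hCo (f := fun y => (x, y)) (hin x hx)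
        ((hasDirDeriv_const _ _ _).prodMk (hasDirDeriv_id _ _))
    have h2 := (smoothOn_locMul (𝔥 := 𝔥) (H := H)).dirDeriv_comp isOpen_mulDom
      (f := fun y => (chartAt 𝔥 (1 : H) ((chartAt 𝔥 (1 : H)).symm x *
        (chartAt 𝔥 (1 : H)).symm y * ((chartAt 𝔥 (1 : H)).symm x)⁻¹), x))
      (x := chartAt 𝔥 (1 : H) 1)
      (by simpa [symm_one] using one_mem_mulDom hx) (h1.prodMk (hasDirDeriv_const x _ _))
    simp only [symm_one, mul_one, mul_inv_cancel] at h2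
    rw [← h2, leftRep, leftInvariantRep]
    refine dirDeriv_congr ?_ B
    have h5 : ∀ᶠ z in 𝓝 (chartAt 𝔥 (1 : H) 1), (x, z) ∈ (P ×ˢ P) ∩ (fun p : 𝔥 × 𝔥 =>
      (chartAt 𝔥 (1 : H)).symm p.1 * (chartAt 𝔥 (1 : H)).symm p.2 *
      ((chartAt 𝔥 (1 : H)).symm p.1)⁻¹) ⁻¹' (chartAt 𝔥 (1 : H)).source := by
      have : Tendsto (fun z => (x, z)) (𝓝 (chartAt 𝔥 (1 : H) 1)) (𝓝 (x, chartAt 𝔥 (1 : H) 1)) :=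
        (Continuous.prodMk_right x).tendsto _
      exact this.eventually (hCo.mem_nhds (hin x hx))
    filter_upwards [h5] with z hz
    rw [locMul, (chartAt 𝔥 (1 : H)).left_inv hz.2]
    simp

/-- The derivative of `Ad` at `1` is the bracket. -/
theorem dirDeriv_AdRep (A B : 𝔥) :
    dirDeriv (fun x => AdRep ((chartAt 𝔥 (1 : H)).symm x) B) (chartAt 𝔥 (1 : H) 1) A
      = lieBracket H A B := by
  obtain ⟨O, hO, h1, hOt, h2, hlin, h3⟩ := smooth_AdRep_chart (𝔥 := 𝔥) H
  set e := chartAt 𝔥 (1 : H) 1 with he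
  have hm := smoothOn_locMul (𝔥 := 𝔥) (H := H)
  have hW : HasDirDeriv (fun x => AdRep ((chartAt 𝔥 (1 : H)).symm x) B)
      (dirDeriv (fun x => AdRep ((chartAt 𝔥 (1 : H)).symm x) B) e A) e A := by
    rw [hasDirDeriv_fst_iff (f := fun p : 𝔥 × 𝔥 => AdRep ((chartAt 𝔥 (1 : H)).symm p.1) p.2),
      dirDeriv_fst (fun p : 𝔥 × 𝔥 => AdRep ((chartAt 𝔥 (1 : H)).symm p.1) p.2)]
    exact h2.hasDirDeriv (hO.prod isOpen_univ) ⟨h1, trivial⟩ _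
  -- differentiate `x ↦ d₁μ(1, x)(Ad x B)`
  have hΦ : SmoothOn (tderiv (locMul 𝔥 H)) (mulDom 𝔥 H ×ˢ univ) := hm.tderiv isOpen_mulDom
  have h4 := hΦ.hasDirDeriv_linSnd isOpen_mulDom (hm.linSnd_tderiv isOpen_mulDom)
    (f := fun x => (e, x)) (g := fun x => (AdRep ((chartAt 𝔥 (1 : H)).symm x) B, (0 : 𝔥)))
    (x := e) (v := A) (one_mem_mulDom one_mem_target)
    ((hasDirDeriv_const _ _ _).prodMk (hasDirDeriv_id _ _)) (hW.prodMk (hasDirDeriv_const _ _ _))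
  have h5 : HasDirDeriv (fun x => leftRep 𝔥 H (x, B)) _ e A := h4.congr (by
    filter_upwards [hO.mem_nhds h1] with x hx
    exact (h3 x hx B).symm)
  have h6 := h5.dirDeriv_eq
  simp only [tderiv, he, symm_one, AdRep_one] at h6
  -- Differentiating the clause above leaves a mixed second derivative of the multiplication at `(1,
  -- 1)`. Read in the other order it is the derivative of the left invariant field of `A` along `B`,
  -- the second term of the bracket.
  rw [dirDeriv_locMul_fst_one,
    hm.dirDeriv_symm isOpen_mulDom (one_mem_mulDom one_mem_target)] at h6
  have h7 : dirDeriv (fun z => dirDeriv (locMul 𝔥 H) z (0, A)) (e, e) (B, 0)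
      = dirDeriv (fun x => leftRep 𝔥 H (x, A)) e B := by
    rw [← dirDeriv_fst (fun z => dirDeriv (locMul 𝔥 H) z (0, A))]
    simp only [leftRep, leftInvariantRep_eq, he]
  rw [h7] at h6
  rw [lieBracket_eq, h6, ← he]
  abel

/-- Write `Ad (η r) = Ad (η t) Ad ((η t)⁻¹ η r)`. The second factor passes through `1` with velocity
`a`, where the derivative of `Ad` is the bracket; the first factor is a fixed linear map. -/
theorem HasCurveLog.hasCurveDeriv_AdRep {η : ℝ → H} {d : ℝ → 𝔥} {a d' : 𝔥} {s : Set ℝ} {t : ℝ}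
    (h : HasCurveLog η a s t) (hc : ContinuousWithinAt η s t) (hd : HasCurveDeriv d d' s t) :
    HasCurveDeriv (fun r => AdRep (η r) (d r)) (AdRep (η t) (lieBracket H a (d t) + d')) s t := by
  obtain ⟨O, hO, h1, hOt, h2, hlin, -⟩ := smooth_AdRep_chart (𝔥 := 𝔥) H
  have h3 := h2.hasCurveDeriv_linSnd hO hlin
    (f := fun r => chartAt 𝔥 (1 : H) ((η t)⁻¹ * η r)) (by simpa using h1) h hd
  simp only [inv_mul_cancel, symm_one, AdRep_one, dirDeriv_AdRep] at h3
  obtain ⟨Q, hQ, hq1, hq2, -⟩ := smooth_conj 𝔥 (η t)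
  have h4 := (hq2.tderiv hQ).hasCurveDeriv_comp (hQ.prod isOpen_univ)
    (c := fun r => (chartAt 𝔥 (1 : H) 1, AdRep ((chartAt 𝔥 (1 : H)).symm
      (chartAt 𝔥 (1 : H) ((η t)⁻¹ * η r))) (d r))) ⟨hq1, trivial⟩
    ((hasCurveDeriv_const _ s t).prodMk h3)
  rw [(hq2.linSnd_tderiv hQ).dirDeriv_snd hq1] at h4
  refine h4.congr ?_ ?_
  · filter_upwards [eventually_translate_mem (𝔥 := 𝔥) hc] with r hr
    simp only [tderiv]
    rw [(chartAt 𝔥 (1 : H)).left_inv hr, ← AdRep, ← AdRep_mul, mul_inv_cancel_left]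
  · simp only [tderiv]
    rw [inv_mul_cancel, symm_one, AdRep_one]; rfl

/-- Uniqueness for the linear equation `d' = -[a, d]` along a curve with logarithmic
derivative `a`. -/
theorem eq_zero_of_bracket_equation {η : ℝ → H} {a d : ℝ → 𝔥} {b : ℝ} (hb : 0 ≤ b)
    (hc : ContinuousOn η (Icc 0 b)) (h : ∀ t ∈ Icc 0 b, HasCurveLog η (a t) (Icc 0 b) t)
    (hd : ∀ t ∈ Icc 0 b, HasCurveDeriv d (-lieBracket H (a t) (d t)) (Icc 0 b) t)
    (h0 : d 0 = 0) : d b = 0 := by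
  -- `Ad η` is an integrating factor: `(Ad η d)' = Ad η ([a, d] + d') = 0`. This gives uniqueness
  -- for a linear equation in a space where no Lipschitz argument is available.
  have h1 := eq_of_hasCurveDeriv_zero (c := fun r => AdRep (η r) (d r)) (a := 0) (b := b)
    (fun t ht => by
      have := (h t ht).hasCurveDeriv_AdRep (hc t ht) (hd t ht)
      rwa [add_neg_cancel, AdRep_zero] at this) hb
  simp only [h0, AdRep_zero] at h1
  rw [← AdRep_inv_AdRep (η b) (d b), h1, AdRep_zero]

/-- Left invariant vector fields are closed under the bracket, away from `1`. -/
theorem dirDeriv_leftRep_sub {y : 𝔥} (hy : y ∈ (chartAt 𝔥 (1 : H)).target) (A B : 𝔥) :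
    dirDeriv (fun x => leftRep 𝔥 H (x, B)) y (leftRep 𝔥 H (y, A))
      - dirDeriv (fun x => leftRep 𝔥 H (x, A)) y (leftRep 𝔥 H (y, B))
      = leftRep 𝔥 H (y, lieBracket H A B) := by
  set e := chartAt 𝔥 (1 : H) 1 with he
  have hm := smoothOn_locMul (𝔥 := 𝔥) (H := H)
  set Λ : 𝔥 → 𝔥 := fun z => locMul 𝔥 H (y, z) with hΛ
  have hinc : Continuous fun z : 𝔥 => (y, z) := Continuous.prodMk_right y
  set Q : Set 𝔥 := (fun z : 𝔥 => (y, z)) ⁻¹' mulDom 𝔥 H with hQ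
  have hQo : IsOpen Q := isOpen_mulDom.preimage hinc
  have heQ : e ∈ Q := mem_mulDom_one hy
  have hΛs : SmoothOn Λ Q := hm.comp isOpen_mulDom ((smoothOn_const y Q).prodMk (smoothOn_id Q))
    fun z hz => hz
  have hΛe : Λ e = y := locMul_one hy
  have hΛ' : ∀ B, dirDeriv Λ e B = leftRep 𝔥 H (y, B) := fun B => rfl
  -- Left translation `Λ` by the point with coordinate `y` maps left invariant fields to themselves;
  -- this is associativity, differentiated.
  have hequi : ∀ x ∈ Q, ∀ B, leftRep 𝔥 H (Λ x, B) = dirDeriv Λ x (leftRep 𝔥 H (x, B)) := by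
    intro x hx B
    have hxt : x ∈ (chartAt 𝔥 (1 : H)).target := hx.1.2
    have hin2 : (x, e) ∈ mulDom 𝔥 H := mem_mulDom_one hxt
    have h1 : HasDirDeriv (fun z => locMul 𝔥 H (x, z)) (leftRep 𝔥 H (x, B)) e B := by
      rw [leftRep, leftInvariantRep_eq]
      exact hm.hasDirDeriv_comp isOpen_mulDom (f := fun z => (x, z)) hin2
        ((hasDirDeriv_const _ _ _).prodMk (hasDirDeriv_id _ _))
    have h2 := hΛs.dirDeriv_comp hQo (f := fun z => locMul 𝔥 H (x, z)) (x := e)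
      (by rw [locMul_one hxt]; exact hx) h1
    have hx1 : locMul 𝔥 H (x, e) = x := locMul_one hxt
    simp only [hx1] at h2
    rw [← h2, leftRep, leftInvariantRep]
    refine dirDeriv_congr ?_ B
    have h5 : ∀ᶠ z in 𝓝 e, (x, z) ∈ mulDom 𝔥 H :=
      ((Continuous.prodMk_right x).tendsto e).eventually (isOpen_mulDom.mem_nhds hin2)
    filter_upwards [h5] with z hz
    simp only [hΛ, locMul]
    rw [(chartAt 𝔥 (1 : H)).left_inv hx.2, (chartAt 𝔥 (1 : H)).left_inv hz.2, mul_assoc]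
  -- Differentiating the invariance at `1` transports the bracket relation from `1` to `y`, up to a
  -- second derivative of `Λ` that is symmetric in `A` and `B`.
  have key : ∀ A B, dirDeriv (fun x => leftRep 𝔥 H (x, B)) y (leftRep 𝔥 H (y, A))
      = dirDeriv (fun z => dirDeriv Λ z B) e A
        + leftRep 𝔥 H (y, dirDeriv (fun x => leftRep 𝔥 H (x, B)) e A) := by
    intro A B
    have h1 : HasDirDeriv Λ (leftRep 𝔥 H (y, A)) e A := hΛs.hasDirDeriv hQo heQ A
    have h2 := (smoothOn_leftRep_fst (H := H) B).hasDirDeriv_comp (chartAt 𝔥 (1 : H)).open_target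
      (f := Λ) (by rw [hΛe]; exact hy) h1
    rw [hΛe] at h2
    have h3 := (hΛs.tderiv hQo).hasDirDeriv_linSnd hQo (hΛs.linSnd_tderiv hQo)
      (f := fun x => x) (g := fun x => leftRep 𝔥 H (x, B)) heQ (hasDirDeriv_id e A)
      (hasDirDeriv_leftRep one_mem_target B A)
    have h4 : HasDirDeriv (fun x => leftRep 𝔥 H (Λ x, B)) _ e A := h3.congr (by
      filter_upwards [hQo.mem_nhds heQ] with x hx
      exact (hequi x hx B).symm)
    have h5 := h2.dirDeriv_eq.symm.trans h4.dirDeriv_eq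
    simp only [tderiv, he, leftRep_one] at h5
    exact h5
  rw [key, key, lieBracket_eq, (linSnd_leftRep (𝔥 := 𝔥) (H := H)).map_sub hy,
    hΛs.dirDeriv_symm hQo heQ A B]
  abel

end Uniqueness

/-! ### Velocities and logarithmic derivatives of smooth curves -/

section CurveLink

variable {E M : Type*} [AddCommGroup E] [Module ℝ E] [TopologicalSpace E]
  [IsTopologicalAddGroup E] [ContinuousSMul ℝ E] [T2Space E]
  [TopologicalSpace M] [ChartedSpace E M]

theorem SmoothCurve.hasCurveDeriv_velocity {γ : ℝ → M} {s : Set ℝ} (h : SmoothCurve E γ s) {t : ℝ}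
    (ht : t ∈ s) [(𝓝[s \ {t}] t).NeBot] :
    HasCurveDeriv (fun r => chartAt E (γ t) (γ r)) (velocity E γ s t) s t := by
  obtain ⟨d, h0, h1⟩ := h.2 _ (chart_mem_atlas E (γ t))
  have hO : γ ⁻¹' (chartAt E (γ t)).source ∈ 𝓝[s] t :=
    h.1 t ht ((chartAt E (γ t)).open_source.mem_nhds (mem_chart_source E _))
  have h2 := (hasCurveDeriv_inter hO).1 (h1 0 t ⟨ht, mem_chart_source E _⟩)
  rw [h0] at h2
  have h3 : velocity E γ s t = d (0 + 1) t := Tendsto.limUnder_eq h2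
  rw [h3]
  exact h2

variable {𝔥 H : Type*} [AddCommGroup 𝔥] [Module ℝ 𝔥] [TopologicalSpace 𝔥]
  [IsTopologicalAddGroup 𝔥] [ContinuousSMul ℝ 𝔥] [LocallyConvexSpace ℝ 𝔥] [T2Space 𝔥]
  [TopologicalSpace H] [ChartedSpace 𝔥 H] [Group H] [LCLieGroup 𝔥 H]

theorem leftTranslateToOne_eq (h : H) (w : 𝔥) :
    leftTranslateToOne 𝔥 h w = logD 𝔥 (chartAt 𝔥 h).symm (chartAt 𝔥 h h) w := by
  rw [leftTranslateToOne, tangentMap, logD, (chartAt 𝔥 h).left_inv (mem_chart_source 𝔥 h),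
    inv_mul_cancel]
  rfl

/-- Velocities are read in the chart at `η t` and logarithmic derivatives in the chart at `1`; the
chain rule for the inverse chart at `η t` converts one into the other. -/
theorem SmoothCurve.hasCurveLog {η : ℝ → H} {s : Set ℝ} (h : SmoothCurve 𝔥 η s) {t : ℝ}
    (ht : t ∈ s) [(𝓝[s \ {t}] t).NeBot] : HasCurveLog η (curveLogDeriv 𝔥 η s t) s t := by
  have h1 := (smoothInto_symm (chart_mem_atlas 𝔥 (η t))).hasCurveLog_comp
    (chartAt 𝔥 (η t)).open_target (c := fun r => chartAt 𝔥 (η t) (η r))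
    (mem_chart_target 𝔥 _) (h.hasCurveDeriv_velocity ht)
  rw [← leftTranslateToOne_eq] at h1
  have hO : η ⁻¹' (chartAt 𝔥 (η t)).source ∈ 𝓝[s] t :=
    h.1 t ht ((chartAt 𝔥 (η t)).open_source.mem_nhds (mem_chart_source 𝔥 _))
  refine HasCurveDeriv.congr h1 ?_ ?_
  · filter_upwards [hO] with r hr
    rw [(chartAt 𝔥 (η t)).left_inv hr, (chartAt 𝔥 (η t)).left_inv (mem_chart_source 𝔥 _)]
  · simp only [inv_mul_cancel]

theorem neBot_Icc_diff {a b t : ℝ} (hab : a < b) (ht : t ∈ Icc a b) :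
    (𝓝[Icc a b \ {t}] t).NeBot := by
  have h := uniqueDiffWithinAt_iff_accPt.1 (uniqueDiffOn_Icc hab t ht)
  rw [accPt_principal_iff_nhdsWithin] at h
  exact h

end CurveLink

/-! ### Smooth families of curves -/

section CurveFamily

variable {V : Type*} [AddCommGroup V] [Module ℝ V] [TopologicalSpace V]
  [IsTopologicalAddGroup V] [ContinuousSMul ℝ V] [LocallyConvexSpace ℝ V] [T2Space V]

/-- `g 0` is smooth on `Ω`, and `g k` is its `k`-th derivative with respect to the real variable. -/
structure TimeDerivs {X : Type u} [AddCommGroup X] [Module ℝ X] [TopologicalSpace X]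
    (g : ℕ → X × ℝ → V) (Ω : Set (X × ℝ)) : Prop where
  isOpen : IsOpen Ω
  smooth : ∀ k, SmoothOn (g k) Ω
  deriv : ∀ k, ∀ p ∈ Ω, dirDeriv (g k) p (0, 1) = g (k + 1) p

section
variable {X : Type u} [AddCommGroup X] [Module ℝ X] [TopologicalSpace X]
  [IsTopologicalAddGroup X] [ContinuousSMul ℝ X]

theorem TimeDerivs.hasCurveDeriv {g : ℕ → X × ℝ → V} {Ω : Set (X × ℝ)} (h : TimeDerivs g Ω)
    (k : ℕ) {x : X} {t : ℝ} (ht : (x, t) ∈ Ω) (s : Set ℝ) :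
    HasCurveDeriv (fun r => g k (x, r)) (g (k + 1) (x, t)) s t := by
  rw [← h.deriv k _ ht]
  exact (h.smooth k).hasCurveDeriv_comp h.isOpen (c := fun r => (x, r)) ht
    ((hasCurveDeriv_const x s t).prodMk (hasCurveDeriv_id s t))

theorem TimeDerivs.exists_curves {g : ℕ → X × ℝ → V} {Ω : Set (X × ℝ)} (h : TimeDerivs g Ω)
    {U : Set X} (hU : ∀ x ∈ U, ∀ t ∈ Icc (0 : ℝ) 1, (x, t) ∈ Ω) :
    ∃ Γ : X → SmoothCurves V, ∀ x ∈ U, ∀ k, ∀ t : I, (Γ x : ℕ → C(I, V)) k t = g k (x, t) := by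
  have key : ∀ x : X, ∃ c : SmoothCurves V, x ∈ U →
      ∀ k, ∀ t : I, (c : ℕ → C(I, V)) k t = g k (x, t) := by
    intro x
    by_cases hx : x ∈ U
    · have hcont : ∀ k, Continuous fun t : I => g k (x, t) := fun k =>
        continuous_iff_continuousAt.2 fun t =>
          ((h.smooth k).continuousAt h.isOpen (hU x hx t t.2)).comp (f := fun t : I => (x, (t : ℝ)))
            (by fun_prop)
      refine ⟨⟨fun k => ⟨_, hcont k⟩, fun k t => ?_⟩, fun _ k t => rfl⟩
      have h1 := h.hasCurveDeriv k (hU x hx t t.2) univ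
      refine Tendsto.comp h1 (tendsto_nhdsWithin_iff.2 ⟨?_, ?_⟩)
      · exact (continuous_subtype_val.tendsto t).mono_left nhdsWithin_le_nhds
      · filter_upwards [self_mem_nhdsWithin] with r hr
        exact ⟨trivial, fun h => hr (Subtype.ext h)⟩
    · exact ⟨0, fun h => absurd h hx⟩
  choose Γ hΓ using key
  exact ⟨Γ, hΓ⟩

/-- The derivative in the parameter is again such a family, with parameter `(x, v)`: time and
parameter derivatives commute by symmetry of second derivatives. -/
theorem TimeDerivs.tderiv {g : ℕ → X × ℝ → V} {Ω : Set (X × ℝ)} (h : TimeDerivs g Ω) :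
    TimeDerivs (fun k (q : (X × X) × ℝ) => dirDeriv (g k) (q.1.1, q.2) (q.1.2, 0))
      ((fun q : (X × X) × ℝ => (q.1.1, q.2)) ⁻¹' Ω) := by
  have hop : IsOpen ((fun q : (X × X) × ℝ => (q.1.1, q.2)) ⁻¹' Ω) :=
    h.isOpen.preimage (by fun_prop)
  refine ⟨hop, fun k => ?_, fun k q hq => ?_⟩
  · let ℓ : (X × X) × ℝ →L[ℝ] (X × ℝ) × (X × ℝ) :=
      (((ContinuousLinearMap.fst ℝ X X).comp (ContinuousLinearMap.fst ℝ (X × X) ℝ)).prod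
        (ContinuousLinearMap.snd ℝ (X × X) ℝ)).prod
      (((ContinuousLinearMap.snd ℝ X X).comp (ContinuousLinearMap.fst ℝ (X × X) ℝ)).prod 0)
    exact (((h.smooth k).tderiv h.isOpen).comp_clm ℓ).mono fun q hq => ⟨hq, trivial⟩
  · obtain ⟨⟨x, v⟩, t⟩ := q
    have h1 : HasDirDeriv (fun q : (X × X) × ℝ => dirDeriv (g k) (q.1.1, q.2) (q.1.2, 0))
        (dirDeriv (fun p => dirDeriv (g k) p (v, 0)) (x, t) (0, 1)) ((x, v), t) (0, 1) := by
      have h2 := ((h.smooth k).tderiv h.isOpen).hasDirDeriv (h.isOpen.prod isOpen_univ)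
        (x := ((x, t), (v, 0))) ⟨hq, trivial⟩ ((0, 1), (0, 0))
      rw [← Prod.zero_eq_mk, ← dirDeriv_fst] at h2
      refine Tendsto.congr (fun r => ?_) h2
      simp [LCGeometry.tderiv]
    rw [h1.dirDeriv_eq, (h.smooth k).dirDeriv_symm h.isOpen hq]
    refine dirDeriv_congr ?_ _
    filter_upwards [h.isOpen.mem_nhds hq] with p hp using h.deriv k p hp

end

/-- One half of the exponential law: a smooth family of curves is a smooth map into the space of
curves. The difference quotients converge uniformly in `t` by compactness and the joint convergence
of slopes, and the induction continues with the family of parameter derivatives. -/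
theorem TimeDerivs.ckOn (j : ℕ) : ∀ {X : Type u} [AddCommGroup X] [Module ℝ X] [TopologicalSpace X]
    [IsTopologicalAddGroup X] [ContinuousSMul ℝ X] {g : ℕ → X × ℝ → V} {Ω : Set (X × ℝ)}
    (_ : TimeDerivs g Ω) {U : Set X} (_ : IsOpen U)
    (_ : ∀ x ∈ U, ∀ t ∈ Icc (0 : ℝ) 1, (x, t) ∈ Ω) {Γ : X → SmoothCurves V}
    (_ : ∀ x ∈ U, ∀ k, ∀ t : I, (Γ x : ℕ → C(I, V)) k t = g k (x, t)), CkOn j Γ U := by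
  have hcont : ∀ {X : Type u} [AddCommGroup X] [Module ℝ X] [TopologicalSpace X]
      [IsTopologicalAddGroup X] [ContinuousSMul ℝ X] {g : ℕ → X × ℝ → V} {Ω : Set (X × ℝ)}
      (_ : TimeDerivs g Ω) {U : Set X} (_ : IsOpen U)
      (_ : ∀ x ∈ U, ∀ t ∈ Icc (0 : ℝ) 1, (x, t) ∈ Ω) {Γ : X → SmoothCurves V}
      (_ : ∀ x ∈ U, ∀ k, ∀ t : I, (Γ x : ℕ → C(I, V)) k t = g k (x, t)), ContinuousOn Γ U := by
    intro X _ _ _ _ _ g Ω h U hUo hU Γ hΓ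
    rw [continuousOn_iff_continuous_domRestrict]
    refine Topology.IsInducing.subtypeVal.continuous_iff.2 (continuous_pi fun k => ?_)
    refine ContinuousMap.continuous_of_continuous_uncurry _ ?_
    have hc : Continuous fun q : U × I => g k ((q.1 : X), (q.2 : ℝ)) :=
      continuous_iff_continuousAt.2 fun q =>
        ((h.smooth k).continuousAt h.isOpen (hU _ q.1.2 _ q.2.2)).comp
          (f := fun q : U × I => ((q.1 : X), (q.2 : ℝ))) (by fun_prop)
    exact hc.congr fun q => (hΓ _ q.1.2 k q.2).symm
  induction j with
  | zero => exact hcont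
  | succ j ih =>
    intro X _ _ _ _ _ g Ω h U hUo hU Γ hΓ
    have hU' : ∀ p ∈ U ×ˢ (univ : Set X), ∀ t ∈ Icc (0 : ℝ) 1,
        (p, t) ∈ (fun q : (X × X) × ℝ => (q.1.1, q.2)) ⁻¹' Ω := fun p hp t ht => hU p.1 hp.1 t ht
    obtain ⟨Γ', hΓ'⟩ := h.tderiv.exists_curves hU'
    refine ⟨hcont h hUo hU hΓ, Γ', fun x hx v => ?_, ih h.tderiv (hUo.prod isOpen_univ) hU' hΓ'⟩
    refine tendsto_subtype_rng.2 (tendsto_pi_nhds.2 fun k =>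
      ContinuousMap.tendsto_nhds_compactOpen.2 fun K hK O hO hm => ?_)
    -- The clause `r ≠ 0` allows full neighbourhoods of `0`, which the compactness argument over `K`
    -- requires.
    have hP : ∀ᶠ r in 𝓝 (0 : ℝ), ∀ t ∈ K, r ≠ 0 →
        r⁻¹ • (g k (x + r • v, (t : ℝ)) - g k (x, (t : ℝ))) ∈ O := by
      refine hK.eventually_forall_of_forall_eventually fun t ht => ?_
      have hl : Tendsto (fun q : ℝ × I => q.1) (𝓝[{q : ℝ × I | q.1 ≠ 0}] (0, t)) (𝓝[≠] 0) :=
        tendsto_nhdsWithin_iff.2 ⟨(continuous_fst.tendsto (0, t)).mono_left nhdsWithin_le_nhds,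
          self_mem_nhdsWithin⟩
      have hX : Tendsto (fun q : ℝ × I => (x, (q.2 : ℝ))) (𝓝[{q : ℝ × I | q.1 ≠ 0}] (0, t))
          (𝓝 (x, (t : ℝ))) := by
        have hc : Continuous fun q : ℝ × I => (x, (q.2 : ℝ)) := by fun_prop
        exact (hc.tendsto (0, t)).mono_left nhdsWithin_le_nhds
      have h1 := (h.smooth k).tendsto_slope h.isOpen (x := (x, (t : ℝ))) (w := (v, 0))
        (hU x hx t t.2) hX tendsto_const_nhds hl
      have h2 : dirDeriv (g k) (x, (t : ℝ)) (v, 0) ∈ O := by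
        have := hm ht
        rwa [hΓ' (x, v) ⟨hx, trivial⟩ k t] at this
      have h3 := eventually_nhdsWithin_iff.1 (h1.eventually (hO.mem_nhds h2))
      filter_upwards [h3] with q hq hne
      have h4 : q.1⁻¹ • (g k ((x, (q.2 : ℝ)) + q.1 • (v, 0)) - g k (x, (q.2 : ℝ))) ∈ O := hq hne
      simpa only [Prod.smul_mk, Prod.mk_add_mk, smul_zero, add_zero] using h4
    have hUv : ∀ᶠ r in 𝓝 (0 : ℝ), x + r • v ∈ U :=
      (tendsto_add_smul x v).eventually (hUo.mem_nhds hx)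
    filter_upwards [self_mem_nhdsWithin, hP.filter_mono nhdsWithin_le_nhds,
      hUv.filter_mono nhdsWithin_le_nhds] with r hr h1 h2 t ht
    have := h1 t ht hr
    rw [← hΓ _ h2, ← hΓ _ hx] at this
    exact this

end CurveFamily

/-! ### Local primitives for regular Lie groups -/

section Rays

variable {X V : Type*} [AddCommGroup X] [Module ℝ X] [TopologicalSpace X]
  [IsTopologicalAddGroup X] [ContinuousSMul ℝ X] [LocallyConvexSpace ℝ X]
  [AddCommGroup V] [Module ℝ V] [TopologicalSpace V]
  [IsTopologicalAddGroup V] [ContinuousSMul ℝ V] [LocallyConvexSpace ℝ V] [T2Space V]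

/-- Iterated derivatives of `a` along the flow `(p, v) ↦ (p + t v, v)`. -/
def flowDerivs (a : X × X → V) : ℕ → X × X → V
  | 0 => a
  | k + 1 => fun p => dirDeriv (flowDerivs a k) p (p.2, 0)

theorem smoothOn_flowDerivs {a : X × X → V} {B : Set X} (hB : IsOpen B)
    (ha : SmoothOn a (B ×ˢ univ)) (k : ℕ) : SmoothOn (flowDerivs a k) (B ×ˢ univ) := by
  induction k with
  | zero => exact ha
  | succ k ih =>
    let ℓ : X × X →L[ℝ] (X × X) × (X × X) := (ContinuousLinearMap.id ℝ (X × X)).prod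
      ((ContinuousLinearMap.snd ℝ X X).prod 0)
    exact ((ih.tderiv (hB.prod isOpen_univ)).comp_clm ℓ).mono fun q hq => ⟨hq, trivial⟩

theorem smoothOn_ray (x₀ : X) (U : Set (X × ℝ)) :
    SmoothOn (fun p : X × ℝ => (x₀ + p.2 • (p.1 - x₀), p.1 - x₀)) U := by
  have h1 : SmoothOn (fun p : X × ℝ => p.1 - x₀) U :=
    (smoothOn_clm (ContinuousLinearMap.fst ℝ X ℝ) U).sub (smoothOn_const x₀ U)
  exact ((smoothOn_const x₀ U).add
    ((smoothOn_clm (ContinuousLinearMap.snd ℝ X ℝ) U).smul h1)).prodMk h1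

theorem hasDirDeriv_ray (x₀ x : X) (t : ℝ) :
    HasDirDeriv (fun p : X × ℝ => (x₀ + p.2 • (p.1 - x₀), p.1 - x₀)) (x - x₀, 0) (x, t) (0, 1) := by
  refine HasDirDeriv.prodMk (tendsto_const_nhds.congr' ?_) (tendsto_const_nhds.congr fun r => ?_)
  · filter_upwards [self_mem_nhdsWithin] with r hr
    have hr : r ≠ 0 := hr
    simp [add_smul, smul_smul, hr]
  · simp

/-- Along a ray the pair (point, direction) moves with velocity `(x - x₀, 0)`, which is the vector
field differentiated in `flowDerivs`. -/
theorem timeDerivs_ray {a : X × X → V} {B : Set X} (hB : IsOpen B)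
    (ha : SmoothOn a (B ×ˢ univ)) (x₀ : X) :
    TimeDerivs (fun k (p : X × ℝ) => flowDerivs a k (x₀ + p.2 • (p.1 - x₀), p.1 - x₀))
      {p | x₀ + p.2 • (p.1 - x₀) ∈ B} := by
  have hop : IsOpen {p : X × ℝ | x₀ + p.2 • (p.1 - x₀) ∈ B} := hB.preimage (by fun_prop)
  refine ⟨hop, fun k => ?_, fun k p hp => ?_⟩
  · exact (smoothOn_flowDerivs hB ha k).comp (hB.prod isOpen_univ) (smoothOn_ray x₀ _)
      fun p hp => ⟨hp, trivial⟩
  · exact (smoothOn_flowDerivs hB ha k).dirDeriv_comp (hB.prod isOpen_univ)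
      (f := fun p : X × ℝ => (x₀ + p.2 • (p.1 - x₀), p.1 - x₀)) (x := p) ⟨hp, trivial⟩
      (hasDirDeriv_ray x₀ p.1 p.2)

theorem ray_mem {B : Set X} (hconv : Convex ℝ B) {x₀ x : X} (h₀ : x₀ ∈ B) (hx : x ∈ B) {t : ℝ}
    (ht : t ∈ Icc (0 : ℝ) 1) : x₀ + t • (x - x₀) ∈ B :=
  hconv.add_smul_sub_mem h₀ hx ht

theorem LinSnd.dirDeriv_smul {Φ : X × X → V} {U : Set X} (hU : IsOpen U)
    (hΦ : SmoothOn Φ (U ×ˢ univ)) (h : LinSnd Φ U) {u : X} (hu : u ∈ U) (t : ℝ) (v w : X) :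
    dirDeriv (fun z => Φ (z, t • w)) u v = t • dirDeriv (fun z => Φ (z, w)) u v := by
  refine HasDirDeriv.dirDeriv_eq ?_
  have h1 : HasDirDeriv (fun z => Φ (z, w)) (dirDeriv (fun z => Φ (z, w)) u v) u v := by
    rw [hasDirDeriv_fst_iff, dirDeriv_fst]
    exact hΦ.hasDirDeriv (hU.prod isOpen_univ) ⟨hu, trivial⟩ _
  have h2 : HasDirDeriv (fun z => t • Φ (z, w)) (t • dirDeriv (fun z => Φ (z, w)) u v) u v :=
    (Tendsto.const_smul h1 t).congr fun r => by module
  refine h2.congr ?_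
  filter_upwards [hU.mem_nhds hu] with z hz
  exact (h.map_smul hz t w).symm

theorem LinSnd.sub {Φ Ψ : X × X → V} {U : Set X} (h : LinSnd Φ U) (h' : LinSnd Ψ U) :
    LinSnd (fun p => Φ p - Ψ p) U := fun u hu w z t => by
  simp only [h u hu, h' u hu]
  module

theorem SmoothOn.hasDirDeriv_fst {Φ : X × X → V} {U : Set X} (hU : IsOpen U)
    (hΦ : SmoothOn Φ (U ×ˢ univ)) {u : X} (hu : u ∈ U) (v w : X) :
    HasDirDeriv (fun z => Φ (z, w)) (dirDeriv (fun z => Φ (z, w)) u v) u v := by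
  rw [hasDirDeriv_fst_iff, dirDeriv_fst]
  exact hΦ.hasDirDeriv (hU.prod isOpen_univ) ⟨hu, trivial⟩ _

end Rays

/-! ### Primitives by integration along rays. -/

section Regular

variable {𝔥 H : Type*} [AddCommGroup 𝔥] [Module ℝ 𝔥] [TopologicalSpace 𝔥]
  [IsTopologicalAddGroup 𝔥] [ContinuousSMul ℝ 𝔥] [LocallyConvexSpace ℝ 𝔥] [T2Space 𝔥]
  [TopologicalSpace H] [ChartedSpace 𝔥 H] [Group H] [LCLieGroup 𝔥 H]
  {X : Type*} [AddCommGroup X] [Module ℝ X] [TopologicalSpace X]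
  [IsTopologicalAddGroup X] [ContinuousSMul ℝ X] [LocallyConvexSpace ℝ X]

/-- A logarithmic derivative that satisfies the Maurer–Cartan equation is determined by its
values in the radial direction. -/
theorem SmoothInto.logD_eq_of_radial {a : X × X → 𝔥} {B : Set X} (hB : IsOpen B)
    (hconv : Convex ℝ B) {x₀ : X} (h₀ : x₀ ∈ B) (ha : SmoothOn a (B ×ˢ univ)) (hlin : LinSnd a B)
    (hMC : ∀ x ∈ B, ∀ v w, dirDeriv (fun z => a (z, w)) x v - dirDeriv (fun z => a (z, v)) x w
      + lieBracket H (a (x, v)) (a (x, w)) = 0)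
    {F : X → H} (hF : SmoothInto 𝔥 F B)
    (hrad : ∀ x ∈ B, ∀ t ∈ Icc (0 : ℝ) 1,
      logD 𝔥 F (x₀ + t • (x - x₀)) (x - x₀) = a (x₀ + t • (x - x₀), x - x₀))
    {x : X} (hx : x ∈ B) (v : X) : logD 𝔥 F x v = a (x, v) := by
  set b : X × X → 𝔥 := fun p => logD 𝔥 F p.1 p.2 with hb
  have hbs : SmoothOn b (B ×ˢ univ) := hF.smoothOn_logD hB
  have hblin : LinSnd b B := hF.linSnd_logD hB
  set β : X × X → 𝔥 := fun p => b p - a p with hβ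
  have hβs : SmoothOn β (B ×ˢ univ) := hbs.sub ha
  have hβlin : LinSnd β B := hblin.sub hlin
  have hrad0 : ∀ z ∈ B, β (z, z - x₀) = 0 := by
    intro z hz
    have := hrad z hz 1 (right_mem_Icc.2 zero_le_one)
    rw [one_smul, add_sub_cancel] at this
    exact sub_eq_zero.2 this
  -- Differentiate the identity `β (z, z - x₀) = 0` in direction `v`; the second argument
  -- contributes `β (z, v)`.
  have hrad1 : ∀ z ∈ B, ∀ v, dirDeriv (fun u => β (u, z - x₀)) z v = -β (z, v) := by
    intro z hz v
    have h2 : HasDirDeriv (fun z => z - x₀) v z v :=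
      (hasDirDeriv_id z v).congr' (Eventually.of_forall fun t => by simp)
    have h1 := hβs.hasDirDeriv_linSnd hB hβlin (f := fun z => z) (g := fun z => z - x₀) hz
      (hasDirDeriv_id z v) h2
    have h3 : HasDirDeriv (fun z => β (z, z - x₀)) 0 z v :=
      (hasDirDeriv_const (0 : 𝔥) z v).congr (by
        filter_upwards [hB.mem_nhds hz] with u hu using (hrad0 u hu).symm)
    exact eq_neg_of_add_eq_zero_left (tendsto_nhds_unique h1 h3)
  have hβsub : ∀ z ∈ B, ∀ v w, dirDeriv (fun u => β (u, w)) z v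
      = dirDeriv (fun u => b (u, w)) z v - dirDeriv (fun u => a (u, w)) z v := by
    intro z hz v w
    refine HasDirDeriv.dirDeriv_eq ?_
    refine ((hbs.hasDirDeriv_fst hB hz v w).sub (ha.hasDirDeriv_fst hB hz v w)).congr fun t => ?_
    simp only [hβ]
    module
  have hmem : ∀ t ∈ Icc (0 : ℝ) 1, x₀ + t • (x - x₀) ∈ B := fun t ht => ray_mem hconv h₀ hx ht
  have hcont : ContinuousOn (fun t : ℝ => x₀ + t • (x - x₀)) (Icc 0 1) := by fun_prop
  -- The defect `β` of the candidate is multiplied by `t` so that the initial value is `0` without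
  -- knowing `β (x₀, v)`. Subtracting the Maurer–Cartan equations of `b` and `a`, which agree
  -- radially, yields `d' = -[a, d]`.
  have key := eq_zero_of_bracket_equation (η := fun t => F (x₀ + t • (x - x₀)))
    (a := fun t => a (x₀ + t • (x - x₀), x - x₀)) (d := fun t => t • β (x₀ + t • (x - x₀), v))
    zero_le_one (hF.1.comp hcont hmem) (fun t ht => by
      rw [← hrad x hx t ht]
      exact hF.hasCurveLog_segment hB (hmem t ht)) (fun t ht => ?_) (zero_smul _ _)
  · rw [one_smul, one_smul, add_sub_cancel] at key
    exact sub_eq_zero.1 key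
  · have hz := hmem t ht
    set z := x₀ + t • (x - x₀) with hzdef
    have h1 := hβs.hasCurveDeriv_linSnd hB hβlin (f := fun t : ℝ => x₀ + t • (x - x₀))
      (g := fun _ => v) (s := Icc 0 1) hz (hasCurveDeriv_segment x₀ (x - x₀) (Icc 0 1) t)
      (hasCurveDeriv_const v _ _)
    have h2 := (hasCurveDeriv_id (Icc 0 1) t).smul h1
    rw [hβlin.map_zero hz, add_zero, one_smul] at h2
    have hMCa := hMC z hz (x - x₀) v
    have hMCb : dirDeriv (fun z => b (z, v)) z (x - x₀) - dirDeriv (fun z => b (z, x - x₀)) z v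
        + lieBracket H (b (z, x - x₀)) (b (z, v)) = 0 := hF.maurerCartan hB hz (x - x₀) v
    have hA : b (z, x - x₀) = a (z, x - x₀) := hrad x hx t ht
    -- Here `t (x - x₀) = z - x₀`, so the factor `t` turns the direction into the radial one at `z`.
    have h3 : t • dirDeriv (fun u => β (u, x - x₀)) z v = -β (z, v) := by
      rw [← hβlin.dirDeriv_smul hB hβs hz, ← hrad1 z hz]
      congr 1
      ext u
      rw [hzdef, add_sub_cancel_left]
    have h4 : dirDeriv (fun u => β (u, v)) z (x - x₀) = dirDeriv (fun u => β (u, x - x₀)) z v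
        - lieBracket H (a (z, x - x₀)) (β (z, v)) := by
      rw [hβsub z hz, hβsub z hz, hβ, lieBracket_sub_right]
      rw [hA] at hMCb
      rw [← sub_eq_zero, ← sub_zero (0 : 𝔥)]
      nth_rewrite 1 [← hMCb]
      rw [← hMCa]
      abel
    have h5 : t • dirDeriv (fun u => β (u, v)) z (x - x₀) + β (z, v)
        = -lieBracket H (a (z, x - x₀)) (t • β (z, v)) := by
      rw [h4, smul_sub, h3, lieBracket_smul_right]
      abel
    rw [← h5]
    exact h2

/-- The primitive is the time-one solution along the ray from `x₀`: smooth as the composition of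
`evol` with a smooth map into the space of curves, and correct in radial directions because the
solution along a shorter ray is a reparametrization of the longer one. -/
theorem IsRegular.exists_primitive (hreg : IsRegular 𝔥 H) {a : X × X → 𝔥} {B : Set X}
    (hB : IsOpen B) (hconv : Convex ℝ B) {x₀ : X} (h₀ : x₀ ∈ B) (ha : SmoothOn a (B ×ˢ univ))
    (hlin : LinSnd a B)
    (hMC : ∀ x ∈ B, ∀ v w, dirDeriv (fun z => a (z, w)) x v - dirDeriv (fun z => a (z, v)) x w
      + lieBracket H (a (x, v)) (a (x, w)) = 0) :
    ∃ F : X → H, SmoothInto 𝔥 F B ∧ ∀ x ∈ B, ∀ v, logD 𝔥 F x v = a (x, v) := by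
  obtain ⟨evol, hevol, hsol⟩ := hreg
  have htd := timeDerivs_ray hB ha x₀
  have hΩ : ∀ x ∈ B, ∀ t ∈ Icc (0 : ℝ) 1, (x, t) ∈ {p : X × ℝ | x₀ + p.2 • (p.1 - x₀) ∈ B} :=
    fun x hx t ht => ray_mem hconv h₀ hx ht
  obtain ⟨Γ, hΓ⟩ := htd.exists_curves hΩ
  have hΓs : SmoothOn Γ B := fun k => TimeDerivs.ckOn k htd hB hΩ hΓ
  have hev : SmoothInto 𝔥 evol univ := by
    refine ⟨hevol.1.continuousOn, fun e he => ?_⟩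
    simpa [Function.comp_def] using hevol.2 (OpenPartialHomeomorph.refl _) (by simp) e he
  have hF : SmoothInto 𝔥 (fun x => evol (Γ x)) B := hev.comp isOpen_univ hΓs (mapsTo_univ _ _)
  -- the solutions along rays
  have hη : ∀ x ∈ B, ∃ η : ℝ → H, ContinuousOn η (Icc 0 1) ∧ η 0 = 1 ∧ η 1 = evol (Γ x) ∧
      ∀ t ∈ Icc (0 : ℝ) 1, HasCurveLog η (a (x₀ + t • (x - x₀), x - x₀)) (Icc 0 1) t := by
    intro x hx
    obtain ⟨η, h1, h2, h3, h4⟩ := hsol (Γ x)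
    refine ⟨η, h1.1, h2, h4, fun t ht => ?_⟩
    have := neBot_Icc_diff zero_lt_one ht
    have h5 := h1.hasCurveLog ht
    rw [h3 ⟨t, ht⟩, hΓ x hx 0 ⟨t, ht⟩] at h5
    exact h5
  choose! η hηc hη0 hη1 hηlog using hη
  -- Both `η y` and `r ↦ η x (τ r)` solve the equation along the ray to `y` with value `1` at `0`,
  -- so uniqueness identifies their endpoints.
  have hray : ∀ x ∈ B, ∀ τ ∈ Icc (0 : ℝ) 1, evol (Γ (x₀ + τ • (x - x₀))) = η x τ := by
    intro x hx τ hτ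
    have hy := ray_mem hconv h₀ hx hτ
    set y := x₀ + τ • (x - x₀) with hydef
    have hτmem : ∀ r ∈ Icc (0 : ℝ) 1, τ * r + 0 ∈ Icc (0 : ℝ) 1 := fun r hr => by
      rw [add_zero]; exact ⟨mul_nonneg hτ.1 hr.1, mul_le_one₀ hτ.2 hr.1 hr.2⟩
    have hcont : ContinuousOn (fun r => η x (τ * r + 0)) (Icc 0 1) :=
      (hηc x hx).comp (by fun_prop) hτmem
    have hval : ∀ r ∈ Icc (0 : ℝ) 1, a (x₀ + r • (y - x₀), y - x₀)
        = τ • a (x₀ + (τ * r + 0) • (x - x₀), x - x₀) := by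
      intro r hr
      rw [hydef, add_sub_cancel_left, smul_smul, add_zero, mul_comm r, hlin.map_smul]
      have := ray_mem hconv h₀ hx (hτmem r hr)
      rwa [add_zero] at this
    have hlog : ∀ r ∈ Icc (0 : ℝ) 1, HasCurveLog (fun r => η x (τ * r + 0))
        (a (x₀ + r • (y - x₀), y - x₀)) (Icc 0 1) r := by
      intro r hr
      rw [hval r hr]
      -- For `τ = 0` the affine substitution degenerates and both sides are constant curves.
      rcases eq_or_ne τ 0 with h0 | h0
      · simp only [h0, zero_mul, zero_smul, HasCurveLog]
        exact hasCurveDeriv_const _ _ _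
      · exact (hηlog x hx _ (hτmem r hr)).comp_affine
          (c := fun r' => chartAt 𝔥 (1 : H) ((η x (τ * r + 0))⁻¹ * η x r')) hτmem h0
    have := div_eq_of_hasCurveLog (𝔥 := 𝔥) (hηc y hy) hcont (hηlog y hy) hlog
      (left_mem_Icc.2 zero_le_one) (right_mem_Icc.2 zero_le_one)
    simp only [mul_zero, add_zero, mul_one, hη0 x hx, hη0 y hy, inv_one] at this
    rw [← hη1 y hy]
    exact (mul_inv_eq_one.1 this.symm)
  refine ⟨_, hF, fun x hx v => hF.logD_eq_of_radial hB hconv h₀ ha hlin hMC ?_ hx v⟩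
  intro x hx t ht
  have h1 := hF.hasCurveLog_segment hB (v := x - x₀) (s := Icc 0 1) (ray_mem hconv h₀ hx ht)
  have h2 := hηlog x hx t ht
  have := neBot_Icc_diff zero_lt_one ht
  refine HasCurveDeriv.unique h1 (HasCurveDeriv.congr h2 ?_ ?_)
  · filter_upwards [self_mem_nhdsWithin] with r hr
    rw [hray x hx t ht, hray x hx r hr]
  · simp

end Regular

/-! ### Ordinary differential equations in normed spaces. -/

section Ode

variable {V : Type*} [NormedAddCommGroup V] [NormedSpace ℝ V]

theorem hasCurveDeriv_iff_hasDerivWithinAt {c : ℝ → V} {y : V} {s : Set ℝ} {t : ℝ} :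
    HasCurveDeriv c y s t ↔ HasDerivWithinAt c y s t := by
  rw [hasDerivWithinAt_iff_tendsto_slope]
  rfl

open Metric in
/-- The Picard–Lindelöf theorem on `[0, 1]`, with the information that the solution stays in the
ball. -/
theorem exists_solution_mem_closedBall [CompleteSpace V] {g : ℝ → V → V} {y₀ : V} {r : ℝ}
    {K : NNReal} (hr : 0 ≤ r) (hK : ∀ t ∈ Icc (0 : ℝ) 1, LipschitzOnWith K (g t) (closedBall y₀ r))
    (hc : ∀ y ∈ closedBall y₀ r, ContinuousOn (fun t => g t y) (Icc 0 1))
    (hb : ∀ t ∈ Icc (0 : ℝ) 1, ∀ y ∈ closedBall y₀ r, ‖g t y‖ ≤ r) :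
    ∃ η : ℝ → V, Continuous η ∧ η 0 = y₀ ∧ (∀ t ∈ Icc (0 : ℝ) 1, η t ∈ closedBall y₀ r) ∧
      ∀ t ∈ Icc (0 : ℝ) 1, HasDerivWithinAt η (g t (η t)) (Icc 0 1) t := by
  lift r to NNReal using hr
  -- Initial radius `0`, speed bound `r` and time length `1` exactly fit the ball of radius `r`.
  have hf : IsPicardLindelof g (⟨0, left_mem_Icc.2 zero_le_one⟩ : Icc (0 : ℝ) 1) y₀ r 0 r K :=
    ⟨hK, hc, hb, by simp⟩
  -- The fixed point of the Picard operator is used directly because its function space records that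
  -- the solution stays in the ball.
  obtain ⟨β, hβ⟩ := ODE.FunSpace.exists_isFixedPt_next hf (mem_closedBall_self le_rfl)
  refine ⟨β.compProj, β.continuous_compProj, ?_, fun t _ => β.compProj_mem_closedBall hf.mul_max_le, fun t ht => ?_⟩
  · have h := ODE.FunSpace.compProj_val (α := β) (t := ⟨0, left_mem_Icc.2 zero_le_one⟩)
    rw [← hβ, ODE.FunSpace.next_apply₀] at h
    rw [← hβ]; exact h
  · apply ODE.hasDerivWithinAt_picard_Icc (left_mem_Icc.2 zero_le_one) hf.continuousOn_uncurry
      β.continuous_compProj.continuousOn (fun _ _ => β.compProj_mem_closedBall hf.mul_max_le)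
      y₀ ht |>.congr_of_mem _ ht
    intro t' ht'
    nth_rw 1 [← hβ]
    rw [ODE.FunSpace.compProj_of_mem ht', ODE.FunSpace.next_apply]

/-- Comparison of a solution and an approximate solution, by Gronwall's inequality. -/
theorem dist_le_of_approx_solution {g : ℝ → V → V} {s : Set V} {K : NNReal} (hK0 : K ≠ 0)
    (hK : ∀ t ∈ Icc (0 : ℝ) 1, LipschitzOnWith K (g t) s) {η ζ ζ' : ℝ → V} {ε : ℝ}
    (hη : ∀ t ∈ Icc (0 : ℝ) 1, HasDerivWithinAt η (g t (η t)) (Icc 0 1) t)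
    (hηs : ∀ t ∈ Icc (0 : ℝ) 1, η t ∈ s)
    (hζ : ∀ t ∈ Icc (0 : ℝ) 1, HasDerivWithinAt ζ (ζ' t) (Icc 0 1) t)
    (hζs : ∀ t ∈ Icc (0 : ℝ) 1, ζ t ∈ s) (hε : ∀ t ∈ Icc (0 : ℝ) 1, ‖ζ' t - g t (ζ t)‖ ≤ ε)
    (h0 : η 0 = ζ 0) : ‖η 1 - ζ 1‖ ≤ ε * ((Real.exp K - 1) / K) := by
  have hd : ∀ {c : ℝ → V} {y : V} {t : ℝ}, t ∈ Ico (0 : ℝ) 1 → HasDerivWithinAt c y (Icc 0 1) t →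
      HasDerivWithinAt c y (Ici t) t := fun ht h =>
    h.mono_of_mem_nhdsWithin (mem_of_superset (Icc_mem_nhdsGE ht.2) (Icc_subset_Icc_left ht.1))
  have := dist_le_of_approx_trajectories_ODE_of_mem (v := g) (s := fun _ => s) (K := K)
    (f := η) (g := ζ) (a := 0) (b := 1) (f' := fun t => g t (η t)) (g' := ζ') (εf := 0) (εg := ε)
    (δ := 0) (fun t ht => hK t (Ico_subset_Icc_self ht))
    (fun t ht => (hη t ht).continuousWithinAt) (fun t ht => hd ht (hη t (Ico_subset_Icc_self ht)))
    (fun t ht => by simp) (fun t ht => hηs t (Ico_subset_Icc_self ht))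
    (fun t ht => (hζ t ht).continuousWithinAt) (fun t ht => hd ht (hζ t (Ico_subset_Icc_self ht)))
    (fun t ht => by rw [dist_eq_norm]; exact hε t (Ico_subset_Icc_self ht))
    (fun t ht => hζs t (Ico_subset_Icc_self ht)) (by simp [h0]) 1 (right_mem_Icc.2 zero_le_one)
  rw [dist_eq_norm, gronwallBound_of_K_ne_0 (by exact_mod_cast hK0)] at this
  refine this.trans (le_of_eq ?_)
  simp
  ring

end Ode

/-! ### Frobenius' theorem with locally convex parameters and Banach values. -/

section Frobenius

variable {V : Type*} [NormedAddCommGroup V] [NormedSpace ℝ V] [CompleteSpace V]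
  {X : Type*} [AddCommGroup X] [Module ℝ X] [TopologicalSpace X]
  [IsTopologicalAddGroup X] [ContinuousSMul ℝ X] [LocallyConvexSpace ℝ X]

/-- By homogeneity, a bound by `1` on directions of norm at most `δ` is an operator bound `δ⁻¹`. The
hypothesis has the form that continuity of the total derivative at direction `0` provides. -/
theorem SmoothOn.lipschitzOnWith_of_dirDeriv_le {Φ : V → V} {N S : Set V} (hN : IsOpen N)
    (hΦ : SmoothOn Φ N) (hS : S ⊆ N) (hconv : Convex ℝ S) {δ : NNReal} (hδ : 0 < δ)
    (hb : ∀ y ∈ S, ∀ z, ‖z‖ ≤ δ → ‖dirDeriv Φ y z‖ ≤ 1) : LipschitzOnWith δ⁻¹ Φ S := by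
  have hder : ∀ y ∈ S, ∀ z, ‖dirDeriv Φ y z‖ ≤ (δ : ℝ)⁻¹ * ‖z‖ := by
    intro y hy z
    rcases eq_or_ne z 0 with rfl | hz
    · rw [hΦ.dirDeriv_zero hN (hS hy)]; simp
    · have hz' : 0 < ‖z‖ := norm_pos_iff.2 hz
      have hδ' : (0 : ℝ) < δ := hδ
      have h3 := hb y hy ((δ / ‖z‖) • z) (by rw [norm_smul, norm_div, norm_norm,
        Real.norm_of_nonneg hδ'.le, div_mul_cancel₀ _ hz'.ne'])
      rw [hΦ.dirDeriv_smul hN (hS hy), norm_smul, Real.norm_of_nonneg (by positivity),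
        div_mul_eq_mul_div, div_le_one hz'] at h3
      rw [← div_eq_inv_mul, le_div_iff₀ hδ']
      linarith
  refine LipschitzOnWith.of_dist_le_mul fun y₁ h₁ y₂ h₂ => ?_
  rw [dist_comm, dist_comm y₁, dist_eq_norm, dist_eq_norm]
  have hseg : ∀ t ∈ Icc (0 : ℝ) 1, y₁ + t • (y₂ - y₁) ∈ S :=
    fun t ht => hconv.add_smul_sub_mem h₁ h₂ ht
  have hc : ∀ t ∈ Icc (0 : ℝ) 1, HasDerivWithinAt (fun t => Φ (y₁ + t • (y₂ - y₁)))
      (dirDeriv Φ (y₁ + t • (y₂ - y₁)) (y₂ - y₁)) (Icc 0 1) t := by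
    intro t ht
    rw [← hasCurveDeriv_iff_hasDerivWithinAt]
    exact hΦ.hasCurveDeriv_comp hN (c := fun t : ℝ => y₁ + t • (y₂ - y₁)) (hS (hseg t ht))
      (hasCurveDeriv_segment y₁ (y₂ - y₁) _ t)
  have := norm_image_sub_le_of_norm_deriv_le_segment_01' hc
    (fun t ht => hder _ (hseg t (Ico_subset_Icc_self ht)) _)
  simpa using this

open Metric in
/-- Uniform bounds near `(y₀, x₀, 0)` for the right hand side of a total differential equation. -/
theorem exists_lipschitz_nhds {Ψ : (V × X) × X → V} {N : Set V} {B : Set X} (hN : IsOpen N)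
    (hB : IsOpen B) (hΨ : SmoothOn Ψ ((N ×ˢ B) ×ˢ univ)) (hlin : LinSnd Ψ (N ×ˢ B)) {y₀ : V}
    {x₀ : X} (hy : y₀ ∈ N) (hx : x₀ ∈ B) :
    ∃ r > 0, ∃ K : NNReal, K ≠ 0 ∧ ∃ W : Set X, IsOpen W ∧ Convex ℝ W ∧ (0 : X) ∈ W ∧
      closedBall y₀ (2 * r) ⊆ N ∧ (∀ w ∈ W, x₀ + w ∈ B) ∧
      (∀ w ∈ W, ∀ w' ∈ W, LipschitzOnWith K (fun y => Ψ ((y, x₀ + w), w')) (closedBall y₀ (2 * r)))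
      ∧ ∀ w ∈ W, ∀ w' ∈ W, ∀ y ∈ closedBall y₀ (2 * r), ‖Ψ ((y, x₀ + w), w')‖ ≤ r := by
  have hO : IsOpen ((N ×ˢ B) ×ˢ (univ : Set X)) := (hN.prod hB).prod isOpen_univ
  have hp : ((y₀, x₀), (0 : X)) ∈ (N ×ˢ B) ×ˢ (univ : Set X) := ⟨⟨hy, hx⟩, trivial⟩
  have h1 := hΨ.continuousAt hO hp
  have h2 := (hΨ.tderiv hO).continuousAt (hO.prod isOpen_univ)
    (show (((y₀, x₀), (0 : X)), ((0 : V), (0 : X)), (0 : X)) ∈ _ from ⟨hp, trivial⟩)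
  -- `Ψ` and its derivative vanish at direction `0`, so by continuity both have norm less than `1`
  -- nearby; the second bound gives the Lipschitz constant.
  have hT0 : LCGeometry.tderiv Ψ (((y₀, x₀), (0 : X)), ((0 : V), (0 : X)), (0 : X)) = 0 :=
    hΨ.dirDeriv_zero hO hp
  have hΨ0 : Ψ ((y₀, x₀), (0 : X)) = 0 := hlin.map_zero ⟨hy, hx⟩
  rw [ContinuousAt, hΨ0] at h1
  rw [ContinuousAt, hT0] at h2
  have c1 : Tendsto (fun q : V × X × X => ((q.1, x₀ + q.2.1), q.2.2)) (𝓝 (y₀, 0, 0))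
      (𝓝 ((y₀, x₀), (0 : X))) := by
    refine Continuous.tendsto' (by fun_prop) _ _ (by simp)
  have c2 : Tendsto (fun q : V × X × X × V =>
      (((q.1, x₀ + q.2.1), q.2.2.1), ((q.2.2.2, (0 : X)), (0 : X)))) (𝓝 (y₀, 0, 0, 0))
      (𝓝 (((y₀, x₀), (0 : X)), ((0 : V), (0 : X)), (0 : X))) :=
    Continuous.tendsto' (by fun_prop) _ _ (by simp)
  have e1 : ∀ᶠ q in 𝓝 ((y₀, 0, 0) : V × X × X), (q.1 ∈ N ∧ x₀ + q.2.1 ∈ B) ∧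
      ‖Ψ ((q.1, x₀ + q.2.1), q.2.2)‖ < 1 := by
    refine Eventually.and ?_ ?_
    · filter_upwards [c1.eventually (hO.mem_nhds hp)] with q hq using ⟨hq.1.1, hq.1.2⟩
    · have := (h1.comp c1).eventually (ball_mem_nhds (0 : V) one_pos)
      simpa using this
  have e2 : ∀ᶠ q in 𝓝 ((y₀, 0, 0, 0) : V × X × X × V),
      ‖LCGeometry.tderiv Ψ (((q.1, x₀ + q.2.1), q.2.2.1), ((q.2.2.2, (0 : X)), (0 : X)))‖ < 1 := by
    have := (h2.comp c2).eventually (ball_mem_nhds (0 : V) one_pos)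
    simpa using this
  rw [nhds_prod_eq, nhds_prod_eq] at e1
  rw [nhds_prod_eq, nhds_prod_eq, nhds_prod_eq] at e2
  obtain ⟨A1, hA1, T1, hT1, H1⟩ := mem_prod_iff.1 e1
  obtain ⟨S1, hS1, S1', hS1', H1'⟩ := mem_prod_iff.1 hT1
  obtain ⟨A2, hA2, T2, hT2, H2⟩ := mem_prod_iff.1 e2
  obtain ⟨S2, hS2, T2', hT2', H2'⟩ := mem_prod_iff.1 hT2
  obtain ⟨S2', hS2', D, hD, H2''⟩ := mem_prod_iff.1 hT2'
  obtain ⟨R, hR, hRA⟩ := Metric.nhds_basis_closedBall.mem_iff.1 (inter_mem hA1 hA2)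
  obtain ⟨δ, hδ, hδD⟩ := Metric.nhds_basis_closedBall.mem_iff.1 hD
  have hr : 0 < R / 2 := by positivity
  have hscale : Tendsto (fun w : X => (R / 2)⁻¹ • w) (𝓝 0) (𝓝 0) :=
    Continuous.tendsto' (by fun_prop) _ _ (smul_zero _)
  -- The radius is fixed before `W`. Asking also that `(R / 2)⁻¹ w'` be small improves the bound `1`
  -- to `R / 2` by linearity, as the Picard–Lindelöf ball demands.
  obtain ⟨W, ⟨hW0, hWo, hWc⟩, hWS⟩ := (LocallyConvexSpace.convex_open_basis_zero ℝ X).mem_iff.1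
    (inter_mem (inter_mem hS1 hS1') (inter_mem (inter_mem hS2 hS2') (hscale hS1')))
  have hball : closedBall y₀ (2 * (R / 2)) ⊆ A1 ∩ A2 := by
    rwa [mul_div_cancel₀ _ (two_ne_zero' ℝ)]
  have G1 : ∀ y ∈ A1, ∀ w ∈ S1, ∀ w' ∈ S1', (y ∈ N ∧ x₀ + w ∈ B) ∧
      ‖Ψ ((y, x₀ + w), w')‖ < 1 := fun y hy w hw w' hw' =>
    H1 (show (y, w, w') ∈ A1 ×ˢ T1 from ⟨hy, H1' ⟨hw, hw'⟩⟩)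
  have G2 : ∀ y ∈ A2, ∀ w ∈ S2, ∀ w' ∈ S2', ∀ z ∈ D,
      ‖LCGeometry.tderiv Ψ (((y, x₀ + w), w'), ((z, (0 : X)), (0 : X)))‖ < 1 := by
    intro y hy w hw w' hw' z hz
    have hq : (y, w, w', z) ∈ A2 ×ˢ T2 := ⟨hy, H2' ⟨hw, H2'' ⟨hw', hz⟩⟩⟩
    have := H2 hq
    rwa [mem_ofPred_eq] at this
  have hNB : ∀ y ∈ closedBall y₀ (2 * (R / 2)), ∀ w ∈ W, y ∈ N ∧ x₀ + w ∈ B := fun y hy w hw =>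
    (G1 y (hball hy).1 w (hWS hw).1.1 0 (mem_of_mem_nhds hS1')).1
  refine ⟨R / 2, hr, ⟨δ, hδ.le⟩⁻¹, ?_, W, hWo, hWc, hW0, ?_, ?_, ?_, ?_⟩
  · exact inv_ne_zero fun h => hδ.ne' (congrArg NNReal.toReal h)
  · exact fun y hy => (hNB y hy 0 hW0).1
  · exact fun w hw => (hNB y₀ (mem_closedBall_self (by positivity)) w hw).2
  · intro w hw w' hw'
    have hinc : ∀ y z : V, HasDirDeriv (fun y => ((y, x₀ + w), w')) ((z, (0 : X)), (0 : X)) y z :=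
      fun y z => ((hasDirDeriv_id y z).prodMk (hasDirDeriv_const _ _ _)).prodMk
        (hasDirDeriv_const _ _ _)
    refine SmoothOn.lipschitzOnWith_of_dirDeriv_le (N := N) hN ?_ (fun y hy => (hNB y hy 0 hW0).1)
      (convex_closedBall _ _) (δ := ⟨δ, hδ.le⟩) hδ fun y hy z hz => ?_
    · exact hΨ.comp hO (f := fun y => ((y, x₀ + w), w')) (((smoothOn_id _).prodMk
        (smoothOn_const _ _)).prodMk (smoothOn_const _ _)) fun y hy =>
        ⟨⟨hy, (hNB y₀ (mem_closedBall_self (by positivity)) w hw).2⟩, trivial⟩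
    · rw [hΨ.dirDeriv_comp hO (f := fun y => ((y, x₀ + w), w')) ⟨hNB y hy w hw, trivial⟩
        (hinc y z)]
      exact (G2 y (hball hy).2 w (hWS hw).2.1.1 w' (hWS hw').2.1.2 z
        (hδD (by rwa [mem_closedBall_zero_iff]))).le
  · intro w hw w' hw' y hy
    have h3 := (G1 y (hball hy).1 w (hWS hw).1.1 _ (hWS hw').2.2).2
    rw [hlin.map_smul (hNB y hy w hw), norm_smul, norm_inv, Real.norm_of_nonneg hr.le,
      inv_mul_lt_iff₀ hr, mul_one] at h3
    exact h3.le

open Metric in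
/-- Frobenius' theorem: the total differential equation `df(x)(v) = Ψ((f x, x), v)` has local
solutions if it satisfies the integrability condition. -/
theorem exists_total_solution {Ψ : (V × X) × X → V} {N : Set V} {B : Set X} (hN : IsOpen N)
    (hB : IsOpen B) (hΨ : SmoothOn Ψ ((N ×ˢ B) ×ˢ univ)) (hlin : LinSnd Ψ (N ×ˢ B))
    (hint : ∀ p ∈ N ×ˢ B, ∀ v w, dirDeriv (fun q => Ψ (q, v)) p (Ψ (p, w), w)
      = dirDeriv (fun q => Ψ (q, w)) p (Ψ (p, v), v)) {y₀ : V} {x₀ : X} (hy : y₀ ∈ N)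
    (hx : x₀ ∈ B) :
    ∃ U : Set X, IsOpen U ∧ x₀ ∈ U ∧ U ⊆ B ∧ ∃ f : X → V, ContinuousOn f U ∧ MapsTo f U N ∧
      ∀ x ∈ U, ∀ v, HasDirDeriv f (Ψ ((f x, x), v)) x v := by
  obtain ⟨r, hr, K, hK0, W, hWo, hWc, hW0, hrN, hWB, hLip, hbd⟩ :=
    exists_lipschitz_nhds hN hB hΨ hlin hy hx
  have hNB := hN.prod hB
  have hO : IsOpen ((N ×ˢ B) ×ˢ (univ : Set X)) := hNB.prod isOpen_univ
  have hrr : closedBall y₀ r ⊆ closedBall y₀ (2 * r) := closedBall_subset_closedBall (by linarith)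
  have htW : ∀ w ∈ W, ∀ t ∈ Icc (0 : ℝ) 1, t • w ∈ W := fun w hw t ht =>
    hWc.smul_mem_of_zero_mem hW0 hw ht
  -- The solution at `x₀ + w` will be the time-one value of the ordinary equation along the ray; `W`
  -- is convex and contains `0`, so rays stay inside.
  have hsol : ∀ w ∈ W, ∃ η : ℝ → V, Continuous η ∧ η 0 = y₀ ∧
      (∀ t ∈ Icc (0 : ℝ) 1, η t ∈ closedBall y₀ r) ∧
      ∀ t ∈ Icc (0 : ℝ) 1, HasDerivWithinAt η (Ψ ((η t, x₀ + t • w), w)) (Icc 0 1) t := by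
    intro w hw
    refine exists_solution_mem_closedBall (g := fun t y => Ψ ((y, x₀ + t • w), w)) (K := K) hr.le
      (fun t ht => (hLip _ (htW w hw t ht) w hw).mono hrr) (fun y hy => ?_)
      (fun t ht y hy => hbd _ (htW w hw t ht) w hw y (hrr hy))
    refine hΨ.continuousOn.comp (f := fun t : ℝ => ((y, x₀ + t • w), w)) (by fun_prop) ?_
    exact fun t ht => ⟨⟨hrN (hrr hy), hWB _ (htW w hw t ht)⟩, trivial⟩
  choose! η hηc hη0 hηr hηd using hsol
  have hmem : ∀ w ∈ W, ∀ t ∈ Icc (0 : ℝ) 1, (η w t, x₀ + t • w) ∈ N ×ˢ B := fun w hw t ht =>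
    ⟨hrN (hrr (hηr w hw t ht)), hWB _ (htW w hw t ht)⟩
  set C := (Real.exp K - 1) / K with hC
  -- Gronwall's estimate on the ball of radius `2 r`. Exact solutions stay in radius `r`, which
  -- leaves room for perturbed curves.
  have hcomp : ∀ w ∈ W, ∀ (ζ ζ' : ℝ → V) (ε : ℝ),
      (∀ t ∈ Icc (0 : ℝ) 1, HasDerivWithinAt ζ (ζ' t) (Icc 0 1) t) →
      (∀ t ∈ Icc (0 : ℝ) 1, ζ t ∈ closedBall y₀ (2 * r)) →
      (∀ t ∈ Icc (0 : ℝ) 1, ‖ζ' t - Ψ ((ζ t, x₀ + t • w), w)‖ ≤ ε) → ζ 0 = y₀ →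
      ‖η w 1 - ζ 1‖ ≤ ε * C := fun w hw ζ ζ' ε h1 h2 h3 h4 =>
    dist_le_of_approx_solution (g := fun t y => Ψ ((y, x₀ + t • w), w)) hK0
      (fun t ht => hLip _ (htW w hw t ht) w hw) (hηd w hw) (fun t ht => hrr (hηr w hw t ht))
      h1 h2 h3 (by rw [hη0 w hw, h4])
  -- The solution for `w` is an approximate solution for nearby `w'`, uniformly in time.
  have hcont : ∀ w ∈ W, ContinuousAt (fun w => η w 1) w := by
    intro w hw
    rw [Metric.continuousAt_iff']
    intro ε hε
    set ε' := ε / (|C| + 1) with hε'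
    have hε'0 : 0 < ε' := by positivity
    have huni : ∀ᶠ w' in 𝓝 w, ∀ t ∈ Icc (0 : ℝ) 1,
        ‖Ψ ((η w t, x₀ + t • w), w) - Ψ ((η w t, x₀ + t • w'), w')‖ < ε' := by
      refine isCompact_Icc.eventually_forall_of_forall_eventually fun t ht => ?_
      have hc1 : ContinuousAt (fun z : X × ℝ => ((η w z.2, x₀ + z.2 • w), w)) (w, t) := by
        have := hηc w hw
        fun_prop
      have hc2 : ContinuousAt (fun z : X × ℝ => ((η w z.2, x₀ + z.2 • z.1), z.1)) (w, t) := by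
        have := hηc w hw
        fun_prop
      have h0 := hΨ.continuousAt hO
        (show ((η w t, x₀ + t • w), w) ∈ (N ×ˢ B) ×ˢ (univ : Set X) from ⟨hmem w hw t ht, trivial⟩)
      have h1 : ContinuousAt (fun z : X × ℝ => Ψ ((η w z.2, x₀ + z.2 • w), w)
          - Ψ ((η w z.2, x₀ + z.2 • z.1), z.1)) (w, t) :=
        (ContinuousAt.comp (f := fun z : X × ℝ => ((η w z.2, x₀ + z.2 • w), w)) h0 hc1).sub
          (ContinuousAt.comp (f := fun z : X × ℝ => ((η w z.2, x₀ + z.2 • z.1), z.1)) h0 hc2)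
      have h2 := h1.norm.eventually_lt_const (u := ε') (by simpa using hε'0)
      exact h2
    filter_upwards [huni, hWo.mem_nhds hw] with w' h1 h2
    rw [dist_eq_norm]
    have h3 := hcomp w' h2 (η w) _ ε' (hηd w hw) (fun t ht => hrr (hηr w hw t ht))
      (fun t ht => (h1 t ht).le) (hη0 w hw)
    calc ‖η w' 1 - η w 1‖ ≤ ε' * C := h3
      _ ≤ ε' * |C| := by gcongr; exact le_abs_self C
      _ < ε' * (|C| + 1) := by gcongr; linarith
      _ = ε := by rw [hε']; field_simp
  refine ⟨(fun x => x - x₀) ⁻¹' W, hWo.preimage (by fun_prop), by simpa using hW0, fun x hx => ?_,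
    fun x => η (x - x₀) 1, fun x hx => ?_, fun x hx => ?_, fun x hx v => ?_⟩
  · simpa using hWB _ hx
  · exact (ContinuousAt.comp (f := fun x => x - x₀) (hcont _ hx) (by fun_prop)).continuousWithinAt
  · exact (hmem _ hx 1 (right_mem_Icc.2 zero_le_one)).1
  · set w := x - x₀ with hw
    replace hx : w ∈ W := hx
    have hu0 := hmem w hx
    set p : ℝ → V × X := fun t => (η w t, x₀ + t • w) with hp
    -- `u t` is the derivative that the desired function should have at `x₀ + t w` in direction `t
    -- v`, hence the expected variation of `η w t` as `w` moves along `v`.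
    set u : ℝ → V := fun t => Ψ (p t, t • v) with hu
    set D : ℝ → V := fun t => LCGeometry.tderiv Ψ ((p t, w), ((u t, t • v), v)) with hD
    have hpc : Continuous p := (hηc w hx).prodMk (by fun_prop)
    have hpd : ∀ t ∈ Icc (0 : ℝ) 1, HasCurveDeriv p (Ψ (p t, w), w) (Icc 0 1) t := fun t ht =>
      (hasCurveDeriv_iff_hasDerivWithinAt.2 (hηd w hx t ht)).prodMk
        (hasCurveDeriv_segment x₀ w _ t)
    have hud : ∀ t ∈ Icc (0 : ℝ) 1, HasDerivWithinAt u (D t) (Icc 0 1) t := by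
      intro t ht
      rw [← hasCurveDeriv_iff_hasDerivWithinAt]
      have h1 := hΨ.hasCurveDeriv_linSnd hNB hlin (f := p) (g := fun t => t • v) (hu0 t ht)
        (hpd t ht) ((hasCurveDeriv_id _ _).smul (hasCurveDeriv_const v _ _))
      have h2 : D t = dirDeriv (fun q => Ψ (q, w)) (p t) (u t, t • v) + Ψ (p t, v) :=
        hΨ.dirDeriv_linSnd hNB hlin (hu0 t ht) _ _ _
      -- The integrability condition exchanges the directions `w` and `v`; after that, `u` solves
      -- the linearized equation.
      rw [h2, hu, ← hint _ (hu0 t ht)]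
      simpa using h1
    have huc : ContinuousOn u (Icc 0 1) := fun t ht => (hud t ht).continuousWithinAt
    obtain ⟨b, hb⟩ := isCompact_Icc.exists_bound_of_continuousOn huc
    -- `η w + s u` solves the equation for `w + s v` with error at most `ε |s|`, because `u` solves
    -- the linearization. Gronwall then gives the first-order expansion of the time-one value.
    have key : ∀ ε > 0, ∀ᶠ s in 𝓝 (0 : ℝ), ‖η (w + s • v) 1 - (η w 1 + s • u 1)‖ ≤ ε * |s| * C := by
      intro ε hε
      have huni : ∀ᶠ s in 𝓝 (0 : ℝ), ∀ t ∈ Icc (0 : ℝ) 1, s ≠ 0 →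
          ‖s⁻¹ • (Ψ ((p t, w) + s • ((u t, t • v), v)) - Ψ (p t, w)) - D t‖ < ε := by
        refine isCompact_Icc.eventually_forall_of_forall_eventually fun t ht => ?_
        have hbase : ((p t, w) : (V × X) × X) ∈ (N ×ˢ B) ×ˢ (univ : Set X) := ⟨hu0 t ht, trivial⟩
        have hpw : ContinuousAt (fun t : ℝ => (p t, w)) t := by fun_prop
        have huc' : ContinuousAt u t := by
          have h0 := hΨ.continuousAt hO
            (show (p t, t • v) ∈ (N ×ˢ B) ×ˢ (univ : Set X) from ⟨hu0 t ht, trivial⟩)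
          exact ContinuousAt.comp (f := fun t : ℝ => (p t, t • v)) h0 (by fun_prop)
        have hdir : ContinuousAt (fun t : ℝ => ((u t, t • v), v)) t := by fun_prop
        have hDc : ContinuousAt D t := by
          have h0 := (hΨ.tderiv hO).continuousAt (hO.prod isOpen_univ)
            (show ((p t, w), ((u t, t • v), v)) ∈ _ from ⟨hbase, trivial⟩)
          exact ContinuousAt.comp (f := fun t : ℝ => ((p t, w), ((u t, t • v), v))) h0
            (hpw.prodMk hdir)
        have hsnd : Tendsto (fun z : ℝ × ℝ => z.2) (𝓝[{z | z.1 ≠ 0}] (0, t)) (𝓝 t) :=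
          (continuous_snd.tendsto' ((0 : ℝ), t) t rfl).mono_left nhdsWithin_le_nhds
        have hfst : Tendsto (fun z : ℝ × ℝ => z.1) (𝓝[{z | z.1 ≠ 0}] (0, t)) (𝓝[≠] 0) :=
          tendsto_nhdsWithin_of_tendsto_nhds_of_eventually_within _
            ((continuous_fst.tendsto' ((0 : ℝ), t) 0 rfl).mono_left nhdsWithin_le_nhds)
            self_mem_nhdsWithin
        have h1 := hΨ.tendsto_slope hO hbase (hpw.tendsto.comp hsnd) (hdir.tendsto.comp hsnd) hfst
        have h2 := (h1.sub (hDc.tendsto.comp hsnd)).norm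
        have h3 : ‖dirDeriv Ψ (p t, w) ((u t, t • v), v) - D t‖ < ε := by
          simpa [hD, LCGeometry.tderiv] using hε
        have h4 := h2.eventually_lt_const h3
        rw [eventually_nhdsWithin_iff] at h4
        exact h4
      have hW : ∀ᶠ s in 𝓝 (0 : ℝ), w + s • v ∈ W :=
        (Continuous.tendsto' (by fun_prop) (0 : ℝ) w (by simp)).eventually (hWo.mem_nhds hx)
      have hs : ∀ᶠ s in 𝓝 (0 : ℝ), |s| * b < r :=
        (Continuous.tendsto' (by fun_prop) (0 : ℝ) 0 (by simp)).eventually (gt_mem_nhds hr)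
      filter_upwards [huni, hW, hs] with s h1 h2 h3
      rcases eq_or_ne s 0 with rfl | hs0
      · simp
      refine hcomp _ h2 (fun t => η w t + s • u t) (fun t => Ψ (p t, w) + s • D t) _
        (fun t ht => (hηd w hx t ht).add ((hud t ht).const_smul s)) (fun t ht => ?_)
        (fun t ht => ?_) ?_
      · have h4 := hηr w hx t ht
        rw [mem_closedBall, dist_eq_norm] at h4 ⊢
        calc ‖η w t + s • u t - y₀‖ = ‖(η w t - y₀) + s • u t‖ := by congr 1; abel
          _ ≤ ‖η w t - y₀‖ + |s| * ‖u t‖ := by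
            rw [← Real.norm_eq_abs, ← norm_smul]; exact norm_add_le _ _
          _ ≤ r + |s| * b := by gcongr; exact hb t ht
          _ ≤ 2 * r := by linarith
      · have h4 := (h1 t ht hs0).le
        have h5 : ((η w t + s • u t, x₀ + t • (w + s • v)), w + s • v)
            = ((p t, w) + s • ((u t, t • v), v) : (V × X) × X) := by
          simp only [hp, Prod.smul_mk, Prod.mk_add_mk, smul_add, Prod.mk.injEq, true_and, and_true]
          rw [smul_comm t s, add_assoc]
        rw [h5]
        calc _ = ‖s • (s⁻¹ • (Ψ ((p t, w) + s • ((u t, t • v), v)) - Ψ (p t, w)) - D t)‖ := by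
              rw [smul_sub, smul_inv_smul₀ hs0, ← norm_neg]; congr 1; abel
          _ ≤ ε * |s| := by
              rw [norm_smul, Real.norm_eq_abs, mul_comm]; gcongr
      · have h6 : u 0 = 0 := by
          simp only [hu, zero_smul]; exact hlin.map_zero (hu0 0 (left_mem_Icc.2 zero_le_one))
        simp [h6, hη0 w hx]
    have hfin : Ψ ((η w 1, x), v) = u 1 := by simp [hu, hp, hw]
    change Tendsto _ _ _
    rw [hfin, Metric.tendsto_nhdsWithin_nhds]
    intro ε hε
    set ε' := ε / (|C| + 1) with hε'
    have hε'0 : 0 < ε' := by positivity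
    obtain ⟨d, hd, hk⟩ := Metric.eventually_nhds_iff.1 (key ε' hε'0)
    refine ⟨d, hd, fun {s} hs0 hs => ?_⟩
    have hs0' : s ≠ 0 := hs0
    have h1 := hk hs
    have h2 : x + s • v - x₀ = w + s • v := by rw [hw]; abel
    beta_reduce
    rw [h2, dist_eq_norm]
    have h3 : s⁻¹ • (η (w + s • v) 1 - η w 1) - u 1
        = s⁻¹ • (η (w + s • v) 1 - (η w 1 + s • u 1)) := by
      rw [← sub_sub, smul_sub s⁻¹ _ (s • u 1), inv_smul_smul₀ hs0']
    have hs1 : 0 < |s| := abs_pos.2 hs0'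
    rw [h3, norm_smul, norm_inv, Real.norm_eq_abs, inv_mul_lt_iff₀ hs1]
    calc _ ≤ ε' * |s| * C := h1
      _ ≤ ε' * |s| * |C| := by gcongr; exact le_abs_self C
      _ < ε' * |s| * (|C| + 1) := by gcongr; linarith
      _ = |s| * ε := by rw [hε']; field_simp

/-- Bootstrapping: `df = Ψ ∘ (f, id)` is as regular as `f`, so `f` gains one degree at each step. -/
theorem smoothOn_of_total_solution {V : Type*} [AddCommGroup V] [Module ℝ V] [TopologicalSpace V]
    [IsTopologicalAddGroup V] [ContinuousSMul ℝ V] [LocallyConvexSpace ℝ V]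
    {Ψ : (V × X) × X → V} {Q : Set (V × X)} {U : Set X} (hQ : IsOpen Q)
    (hΨ : SmoothOn Ψ (Q ×ˢ univ)) {f : X → V} (hf : ContinuousOn f U)
    (hm : ∀ x ∈ U, (f x, x) ∈ Q) (hd : ∀ x ∈ U, ∀ v, HasDirDeriv f (Ψ ((f x, x), v)) x v) :
    SmoothOn f U := by
  intro k
  induction k with
  | zero => exact hf
  | succ k ih =>
    refine ⟨hf, fun p => Ψ ((f p.1, p.1), p.2), hd, ?_⟩
    have h1 : CkOn k (fun p : X × X => f p.1) (U ×ˢ univ) :=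
      (ih.comp_clm (ContinuousLinearMap.fst ℝ X X)).mono fun p hp => hp.1
    have h2 : CkOn k (fun p : X × X => p.1) (U ×ˢ univ) :=
      ckOn_clm k (ContinuousLinearMap.fst ℝ X X) _
    have h3 : CkOn k (fun p : X × X => p.2) (U ×ˢ univ) :=
      ckOn_clm k (ContinuousLinearMap.snd ℝ X X) _
    exact CkOn.comp (hQ.prod isOpen_univ) (hΨ k) ((h1.prodMk h2).prodMk h3)
      fun p hp => ⟨hm _ hp.1, trivial⟩

end Frobenius

/-! ### Local primitives in finite dimensions, and both cases combined. -/

section LocalPrimitive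

variable {𝔥 H : Type*} [AddCommGroup 𝔥] [Module ℝ 𝔥] [TopologicalSpace 𝔥]
  [IsTopologicalAddGroup 𝔥] [ContinuousSMul ℝ 𝔥] [LocallyConvexSpace ℝ 𝔥] [T2Space 𝔥]
  [TopologicalSpace H] [T2Space H] [ChartedSpace 𝔥 H] [Group H] [LCLieGroup 𝔥 H]
  {X : Type*} [AddCommGroup X] [Module ℝ X] [TopologicalSpace X]
  [IsTopologicalAddGroup X] [ContinuousSMul ℝ X] [LocallyConvexSpace ℝ X]

/-- In the chart at `1`, `δF = a` reads `df(v) = leftRep (f, a (x, v))`. Its integrability condition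
is the Maurer–Cartan equation, since left invariant fields bracket to left invariant fields at every
point of the chart. -/
theorem exists_primitive_of_finiteDimensional [FiniteDimensional ℝ 𝔥] {a : X × X → 𝔥} {B : Set X}
    (hB : IsOpen B) {x₀ : X} (h₀ : x₀ ∈ B) (ha : SmoothOn a (B ×ˢ univ)) (hlin : LinSnd a B)
    (hMC : ∀ x ∈ B, ∀ v w, dirDeriv (fun z => a (z, w)) x v - dirDeriv (fun z => a (z, v)) x w
      + lieBracket H (a (x, v)) (a (x, w)) = 0) :
    ∃ U : Set X, IsOpen U ∧ x₀ ∈ U ∧ U ⊆ B ∧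
      ∃ F : X → H, SmoothInto 𝔥 F U ∧ ∀ x ∈ U, ∀ v, logD 𝔥 F x v = a (x, v) := by
  -- `𝔥` carries a topology but no norm; the identification with a Euclidean space supplies a
  -- complete norm.
  set ψ := toEuclidean (E := 𝔥) with hψ
  set V := EuclideanSpace ℝ (Fin (Module.finrank ℝ 𝔥))
  set e := chartAt 𝔥 (1 : H) with he
  set N : Set V := ψ.symm ⁻¹' e.target with hN
  have hNo : IsOpen N := e.open_target.preimage ψ.symm.continuous
  set Ψ : (V × X) × X → V := fun p => ψ (leftRep 𝔥 H (ψ.symm p.1.1, a (p.1.2, p.2))) with hΨdef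
  have hlo := (e.open_target).prod (isOpen_univ (X := 𝔥))
  have hQ := hNo.prod hB
  have hΨ : SmoothOn Ψ ((N ×ˢ B) ×ˢ univ) := by
    have h1 : SmoothOn (fun p : (V × X) × X => ψ.symm p.1.1) ((N ×ˢ B) ×ˢ univ) :=
      smoothOn_clm ((ψ.symm : V →L[ℝ] 𝔥).comp ((ContinuousLinearMap.fst ℝ V X).comp
        (ContinuousLinearMap.fst ℝ (V × X) X))) _
    have h2 : SmoothOn (fun p : (V × X) × X => (p.1.2, p.2)) ((N ×ˢ B) ×ˢ univ) :=
      (smoothOn_clm ((ContinuousLinearMap.snd ℝ V X).comp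
        (ContinuousLinearMap.fst ℝ (V × X) X)) _).prodMk
        (smoothOn_clm (ContinuousLinearMap.snd ℝ (V × X) X) _)
    have h3 := ha.comp (hB.prod isOpen_univ) h2 fun p hp => ⟨hp.1.2, trivial⟩
    have h4 := (smoothOn_leftRep (𝔥 := 𝔥) (H := H)).comp hlo (h1.prodMk h3)
      fun p hp => ⟨hp.1.1, trivial⟩
    exact (smoothOn_clm (ψ : 𝔥 →L[ℝ] V) univ).comp isOpen_univ h4 (mapsTo_univ _ _)
  have hΨlin : LinSnd Ψ (N ×ˢ B) := by
    intro p hp w z t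
    simp only [hΨdef]
    rw [hlin _ hp.2, linSnd_leftRep _ hp.1, map_add, map_smul]
  have hψd : ∀ {Y : Type _} [AddCommGroup Y] [Module ℝ Y] {f : Y → 𝔥} {y : 𝔥} {x v : Y},
      HasDirDeriv f y x v → HasDirDeriv (fun z => ψ (f z)) (ψ y) x v := by
    intro Y _ _ f y x v h
    refine ((ψ.continuous.tendsto y).comp h).congr fun t => ?_
    simp
  have hder : ∀ p ∈ N ×ˢ B, ∀ v w, dirDeriv (fun q => Ψ (q, v)) p (Ψ (p, w), w)
      = ψ (dirDeriv (fun u => leftRep 𝔥 H (u, a (p.2, v))) (ψ.symm p.1)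
          (leftRep 𝔥 H (ψ.symm p.1, a (p.2, w)))
        + leftRep 𝔥 H (ψ.symm p.1, dirDeriv (fun z => a (z, v)) p.2 w)) := by
    intro p hp v w
    refine HasDirDeriv.dirDeriv_eq (hψd ?_)
    refine (smoothOn_leftRep (𝔥 := 𝔥) (H := H)).hasDirDeriv_linSnd e.open_target linSnd_leftRep
      (f := fun q : V × X => ψ.symm q.1) (g := fun q => a (q.2, v)) hp.1 ?_ ?_
    · have : HasDirDeriv (fun q : V × X => ψ.symm q.1) (ψ.symm (Ψ (p, w))) p (Ψ (p, w), w) :=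
        hasDirDeriv_clm ((ψ.symm : V →L[ℝ] 𝔥).comp (ContinuousLinearMap.fst ℝ V X)) _ _
      simpa [hΨdef] using this
    · refine (ha.hasDirDeriv_fst hB hp.2 w v).congr' (Eventually.of_forall fun t => ?_)
      simp
  have hint : ∀ p ∈ N ×ˢ B, ∀ v w, dirDeriv (fun q => Ψ (q, v)) p (Ψ (p, w), w)
      = dirDeriv (fun q => Ψ (q, w)) p (Ψ (p, v), v) := by
    intro p hp v w
    rw [hder p hp, hder p hp]
    congr 1
    -- The second derivatives differ by a left invariant field evaluated at `da(w, v) + [a w, a v]`,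
    -- which vanishes.
    have h1 := dirDeriv_leftRep_sub (H := H) hp.1 (a (p.2, w)) (a (p.2, v))
    have h2 := hMC p.2 hp.2 w v
    have h3 := linSnd_leftRep (𝔥 := 𝔥) (H := H)
    have h4 : leftRep 𝔥 H (ψ.symm p.1, (dirDeriv (fun z => a (z, v)) p.2 w
        - dirDeriv (fun z => a (z, w)) p.2 v) + lieBracket H (a (p.2, w)) (a (p.2, v))) = 0 := by
      rw [h2, h3.map_zero hp.1]
    rw [h3.map_add hp.1, h3.map_sub hp.1, ← h1] at h4
    rw [← sub_eq_zero, ← h4]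
    abel
  obtain ⟨U, hU, hxU, hUB, f, hfc, hfN, hfd⟩ := exists_total_solution hNo hB hΨ hΨlin hint
    (y₀ := ψ (e 1)) (x₀ := x₀) (by
      rw [hN, mem_preimage, ψ.symm_apply_apply]; exact one_mem_target) h₀
  have hfs : SmoothOn f U :=
    smoothOn_of_total_solution hQ hΨ hfc (fun x hx => ⟨hfN hx, hUB hx⟩) hfd
  have hfs' : SmoothOn (fun x => ψ.symm (f x)) U :=
    (smoothOn_clm (ψ.symm : V →L[ℝ] 𝔥) univ).comp isOpen_univ hfs (mapsTo_univ _ _)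
  have hF : SmoothInto 𝔥 (fun x => e.symm (ψ.symm (f x))) U :=
    smoothInto_chartSymm.comp e.open_target hfs' hfN
  refine ⟨U, hU, hxU, hUB, _, hF, fun x hx v => ?_⟩
  have h1 := hF.dirDeriv_chart hU hx (e.map_target (hfN hx)) v
  have h2 : HasDirDeriv (fun z => ψ.symm (f z)) (leftRep 𝔥 H (ψ.symm (f x), a (x, v))) x v := by
    have := (smoothOn_clm (ψ.symm : V →L[ℝ] 𝔥) univ).hasDirDeriv_comp isOpen_univ (f := f)
      (mem_univ _) (hfd x hx v)
    rw [(hasDirDeriv_clm _ _ _).dirDeriv_eq] at this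
    simpa [hΨdef] using this
  have h3 : e (e.symm (ψ.symm (f x))) = ψ.symm (f x) := e.right_inv (hfN hx)
  rw [h3] at h1
  have h4 : HasDirDeriv (fun z => e (e.symm (ψ.symm (f z))))
      (leftRep 𝔥 H (ψ.symm (f x), a (x, v))) x v := h2.congr (by
    filter_upwards [hU.mem_nhds hx] with z hz using (e.right_inv (hfN hz)).symm)
  exact leftRep_injective (H := H) (hfN hx) (tendsto_nhds_unique h1 h4)

/-- Local primitives of solutions of the Maurer–Cartan equation. -/
theorem exists_local_primitive (hreg : ¬ FiniteDimensional ℝ 𝔥 → IsRegular 𝔥 H) {a : X × X → 𝔥}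
    {B : Set X} (hB : IsOpen B) {x₀ : X} (h₀ : x₀ ∈ B) (ha : SmoothOn a (B ×ˢ univ))
    (hlin : LinSnd a B)
    (hMC : ∀ x ∈ B, ∀ v w, dirDeriv (fun z => a (z, w)) x v - dirDeriv (fun z => a (z, v)) x w
      + lieBracket H (a (x, v)) (a (x, w)) = 0) :
    ∃ U : Set X, IsOpen U ∧ x₀ ∈ U ∧ U ⊆ B ∧
      ∃ F : X → H, SmoothInto 𝔥 F U ∧ ∀ x ∈ U, ∀ v, logD 𝔥 F x v = a (x, v) := by
  by_cases hfin : FiniteDimensional ℝ 𝔥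
  · exact exists_primitive_of_finiteDimensional hB h₀ ha hlin hMC
  · obtain ⟨C, hC, hconv, -, hCB⟩ := exists_closed_convex_nhds (hB.mem_nhds h₀)
    have hsub : interior C ⊆ B := interior_subset.trans hCB
    obtain ⟨F, hF, hlog⟩ := (hreg hfin).exists_primitive isOpen_interior hconv.interior
      (mem_interior_iff_mem_nhds.2 hC) (ha.mono (prod_mono_left hsub))
      (fun x hx => hlin x (hsub hx)) (fun x hx => hMC x (hsub hx))
    exact ⟨interior C, isOpen_interior, mem_interior_iff_mem_nhds.2 hC, hsub, F, hF, hlog⟩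

end LocalPrimitive

/-! ### Differential forms in charts -/

section FormsInCharts

variable {E M : Type*} [AddCommGroup E] [Module ℝ E] [TopologicalSpace E]
  [IsTopologicalAddGroup E] [ContinuousSMul ℝ E] [LocallyConvexSpace ℝ E] [T2Space E]
  [TopologicalSpace M] [ChartedSpace E M] [LCManifold E M]
  {e e' : OpenPartialHomeomorph M E}

theorem isOpen_transition (e e' : OpenPartialHomeomorph M E) :
    IsOpen (e.target ∩ e.symm ⁻¹' e'.source) := e.isOpen_inter_preimage_symm e'.open_source

theorem smoothOn_transition (he : e ∈ atlas E M) (he' : e' ∈ atlas E M) :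
    SmoothOn (fun x => e' (e.symm x)) (e.target ∩ e.symm ⁻¹' e'.source) :=
  LCManifold.compat e he e' he'

theorem tangentOfChart_add_smul (he : e ∈ atlas E M) {x : E} (hx : x ∈ e.target) (v w : E) (t : ℝ) :
    tangentOfChart e x (v + t • w) = tangentOfChart e x v + t • tangentOfChart e x w :=
  (smoothOn_transition he (chart_mem_atlas E _)).linSnd_tderiv (isOpen_transition _ _) x
    ⟨hx, mem_chart_source E _⟩ v w t

theorem tangentOfChart_chartAt (m : M) (v : E) :
    tangentOfChart (chartAt E m) (chartAt E m m) v = v := by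
  have h : (chartAt E m).symm (chartAt E m m) = m := (chartAt E m).left_inv (mem_chart_source E m)
  rw [tangentOfChart, h]
  refine ((hasDirDeriv_id _ v).congr ?_).dirDeriv_eq
  filter_upwards [(chartAt E m).open_target.mem_nhds (mem_chart_target E m)] with z hz
  exact ((chartAt E m).right_inv hz).symm

/-- The change of the representative of a tangent vector under a change of charts. -/
theorem tangentOfChart_change (he : e ∈ atlas E M) (he' : e' ∈ atlas E M) {x : E}
    (hx : x ∈ e.target ∩ e.symm ⁻¹' e'.source) (v : E) :
    tangentOfChart e x v
      = tangentOfChart e' (e' (e.symm x)) (dirDeriv (fun z => e' (e.symm z)) x v) := by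
  have h1 := (smoothOn_transition he he').hasDirDeriv (isOpen_transition _ _) hx v
  have hm : e'.symm (e' (e.symm x)) = e.symm x := e'.left_inv hx.2
  rw [tangentOfChart, tangentOfChart, hm]
  have h2 := (smoothOn_transition he' (chart_mem_atlas E (e.symm x))).hasDirDeriv_comp
    (isOpen_transition _ _) (f := fun z => e' (e.symm z)) (x := x)
    ⟨e'.map_source hx.2, by rw [mem_preimage, hm]; exact mem_chart_source E _⟩ h1
  refine HasDirDeriv.dirDeriv_eq (h2.congr ?_)
  filter_upwards [(isOpen_transition e e').mem_nhds hx] with z hz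
  simp only [Function.comp]
  rw [e'.left_inv hz.2]

variable {V : Type*} [AddCommGroup V] [Module ℝ V] [TopologicalSpace V]

theorem OneForm.linSnd_rep (α : OneForm E M V) (he : e ∈ atlas E M) :
    LinSnd (fun p : E × E => α.rep e p.1 p.2) e.target := fun x hx v w t => by
  simp only [OneForm.rep]
  rw [tangentOfChart_add_smul he hx, map_add, map_smul]

theorem OneForm.rep_chartAt (α : OneForm E M V) (m : M) (v : E) :
    α.rep (chartAt E m) (chartAt E m m) v = α.toFun m v := by
  rw [OneForm.rep, tangentOfChart_chartAt, (chartAt E m).left_inv (mem_chart_source E m)]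

theorem OneForm.rep_change (α : OneForm E M V) (he : e ∈ atlas E M) (he' : e' ∈ atlas E M) {x : E}
    (hx : x ∈ e.target ∩ e.symm ⁻¹' e'.source) (v : E) :
    α.rep e x v = α.rep e' (e' (e.symm x)) (dirDeriv (fun z => e' (e.symm z)) x v) := by
  rw [OneForm.rep, OneForm.rep, tangentOfChart_change he he' hx, e'.left_inv hx.2]

variable {𝔥 H : Type*} [AddCommGroup 𝔥] [Module ℝ 𝔥] [TopologicalSpace 𝔥]
  [IsTopologicalAddGroup 𝔥] [ContinuousSMul ℝ 𝔥] [LocallyConvexSpace ℝ 𝔥] [T2Space 𝔥]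
  [TopologicalSpace H] [T2Space H] [ChartedSpace 𝔥 H] [Group H] [LCLieGroup 𝔥 H]

/-- The Maurer–Cartan equation in an arbitrary chart. -/
theorem MaurerCartan.rep {α : OneForm E M 𝔥} (hα : MaurerCartan H α) (he : e ∈ atlas E M) {x : E}
    (hx : x ∈ e.target) (v w : E) :
    dirDeriv (fun z => α.rep e z w) x v - dirDeriv (fun z => α.rep e z v) x w
      + lieBracket H (α.rep e x v) (α.rep e x w) = 0 := by
  set m := e.symm x with hm
  set e' := chartAt E m with he'
  have hea : e' ∈ atlas E M := chart_mem_atlas E m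
  have hxd : x ∈ e.target ∩ e.symm ⁻¹' e'.source := ⟨hx, mem_chart_source E m⟩
  have hop := isOpen_transition e e'
  have hτ := smoothOn_transition he hea
  set τ : E → E := fun z => e' (e.symm z) with hτd
  have hτt : τ x ∈ e'.target := mem_chart_target E m
  -- The change of chart adds the second derivative of `τ`, which is symmetric and cancels in the
  -- exterior derivative.
  have key : ∀ v w, dirDeriv (fun z => α.rep e z w) x v
      = dirDeriv (fun z => α.rep e' z (dirDeriv τ x w)) (τ x) (dirDeriv τ x v)
        + α.rep e' (τ x) (dirDeriv (fun z => dirDeriv τ z w) x v) := by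
    intro v w
    have h1 := hτ.hasDirDeriv hop hxd v
    have h2 : HasDirDeriv (fun z => dirDeriv τ z w) (dirDeriv (fun z => dirDeriv τ z w) x v) x v :=
      SmoothOn.hasDirDeriv_fst (Φ := LCGeometry.tderiv τ) hop (hτ.tderiv hop) hxd v w
    have h3 := (α.smooth e' hea).hasDirDeriv_linSnd e'.open_target (α.linSnd_rep hea) (f := τ)
      (g := fun z => dirDeriv τ z w) hτt h1 h2
    refine HasDirDeriv.dirDeriv_eq (h3.congr ?_)
    filter_upwards [hop.mem_nhds hxd] with z hz using (α.rep_change he hea hz w).symm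
  have hval : ∀ v, α.rep e x v = α.toFun m (dirDeriv τ x v) := fun v => by
    rw [α.rep_change he hea hxd, ← α.rep_chartAt]
  have hMC := hα m (dirDeriv τ x v) (dirDeriv τ x w)
  -- By skew symmetry `[α ∧ α](v, w) = 2 [α v, α w]`, which absorbs the factor `1/2`.
  have hw : (1 / 2 : ℝ) • wedgeBracket H α α m (dirDeriv τ x v) (dirDeriv τ x w)
      = lieBracket H (α.rep e x v) (α.rep e x w) := by
    rw [hval, hval, wedgeBracket, lieBracket_skew (α.toFun m (dirDeriv τ x v)), sub_neg_eq_add,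
      ← two_smul ℝ, smul_smul]
    norm_num
  rw [hw, OneForm.extDeriv] at hMC
  rw [key v w, key w v, hτ.dirDeriv_symm hop hxd v w, ← hMC]
  abel

/-- `f` is a primitive on `U` of the Lie algebra valued form `α`: `δf = α`. -/
def IsPrimitiveOn (α : OneForm E M 𝔥) (f : M → H) (U : Set M) : Prop :=
  ∀ e ∈ atlas E M, SmoothInto 𝔥 (fun x => f (e.symm x)) (e.target ∩ e.symm ⁻¹' U) ∧
    ∀ x ∈ e.target ∩ e.symm ⁻¹' U, ∀ v, logD 𝔥 (fun x => f (e.symm x)) x v = α.rep e x v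

theorem SmoothInto.change_chart {f : M → H} {O : Set E} (he : e ∈ atlas E M) (he' : e' ∈ atlas E M)
    (hf : SmoothInto 𝔥 (fun x => f (e'.symm x)) O) (hO : IsOpen O) :
    SmoothInto 𝔥 (fun x => f (e.symm x))
      ((e.target ∩ e.symm ⁻¹' e'.source) ∩ (fun z => e' (e.symm z)) ⁻¹' O) ∧
    ∀ x ∈ e.target ∩ e.symm ⁻¹' e'.source, e' (e.symm x) ∈ O → ∀ v,
      logD 𝔥 (fun x => f (e.symm x)) x v = logD 𝔥 (fun x => f (e'.symm x)) (e' (e.symm x))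
        (dirDeriv (fun z => e' (e.symm z)) x v) := by
  have hop := isOpen_transition e e'
  have hτ := smoothOn_transition he he'
  constructor
  · refine (hf.comp hO (f := fun z => e' (e.symm z)) (hτ.mono inter_subset_left)
      fun z hz => hz.2).congr (hτ.continuousOn.isOpen_inter_preimage hop hO) fun z hz => ?_
    simp only
    rw [e'.left_inv hz.1.2]
  · intro x hx hxO v
    rw [← hf.logD_comp hO (f := fun z => e' (e.symm z)) hxO (hτ.hasDirDeriv hop hx v)]
    refine logD_congr (F' := fun z => f (e'.symm (e' (e.symm z)))) ?_ v
    filter_upwards [hop.mem_nhds hx] with z hz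
    rw [e'.left_inv hz.2]

/-- One chart per point suffices, and the logarithmic equation need only be checked at that point:
forms and logarithmic derivatives transform alike under changes of charts. -/
theorem isPrimitiveOn_of_local {α : OneForm E M 𝔥} {f : M → H} {U : Set M} (hU : IsOpen U)
    (h : ∀ m ∈ U, ∃ e ∈ atlas E M, m ∈ e.source ∧ ∃ O, IsOpen O ∧ e m ∈ O ∧
      SmoothInto 𝔥 (fun x => f (e.symm x)) O ∧
      ∀ v, logD 𝔥 (fun x => f (e.symm x)) (e m) v = α.rep e (e m) v) : IsPrimitiveOn α f U := by
  intro e he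
  refine ⟨SmoothInto.congr_of_locally (e.isOpen_inter_preimage_symm hU) fun x hx => ?_,
    fun x hx v => ?_⟩
  · obtain ⟨e', he', hm, O, hO, hmO, hs, -⟩ := h _ hx.2
    have h1 := hs.change_chart he he' hO
    exact ⟨_, (smoothOn_transition he he').continuousOn.isOpen_inter_preimage
      (isOpen_transition e e') hO, ⟨⟨hx.1, hm⟩, hmO⟩, _, fun _ _ => rfl, h1.1.mono inter_subset_right⟩
  · obtain ⟨e', he', hm, O, hO, hmO, hs, hlog⟩ := h _ hx.2
    rw [(hs.change_chart he he' hO).2 x ⟨hx.1, hm⟩ hmO, hlog, α.rep_change he he' ⟨hx.1, hm⟩]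

theorem IsPrimitiveOn.mono {α : OneForm E M 𝔥} {f : M → H} {U U' : Set M} (h : IsPrimitiveOn α f U)
    (hU : U' ⊆ U) : IsPrimitiveOn α f U' := fun e he =>
  ⟨(h e he).1.mono (inter_subset_inter_right _ (preimage_mono hU)),
    fun x hx v => (h e he).2 x ⟨hx.1, hU hx.2⟩ v⟩

theorem IsPrimitiveOn.mul_left {α : OneForm E M 𝔥} {f : M → H} {U : Set M} (hU : IsOpen U)
    (h : IsPrimitiveOn α f U) (g : H) : IsPrimitiveOn α (fun m => g * f m) U := fun e he => by
  have hop := e.isOpen_inter_preimage_symm hU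
  refine ⟨(smoothInto_const g _ hop).mul (h e he).1 hop, fun x hx v => ?_⟩
  rw [logD_mul_left, (h e he).2 x hx]

theorem IsPrimitiveOn.congr {α : OneForm E M 𝔥} {f f' : M → H} {U : Set M} (hU : IsOpen U)
    (h : IsPrimitiveOn α f U) (hf : EqOn f f' U) : IsPrimitiveOn α f' U := fun e he => by
  have hop := e.isOpen_inter_preimage_symm hU
  refine ⟨(h e he).1.congr hop fun x hx => hf hx.2, fun x hx v => ?_⟩
  rw [← (h e he).2 x hx]
  refine logD_congr ?_ v
  filter_upwards [hop.mem_nhds hx] with z hz using (hf hz.2).symm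

theorem IsPrimitiveOn.of_local {α : OneForm E M 𝔥} {f : M → H} {U : Set M} (hU : IsOpen U)
    (h : ∀ m ∈ U, ∃ O, IsOpen O ∧ m ∈ O ∧ IsPrimitiveOn α f O) : IsPrimitiveOn α f U := by
  refine isPrimitiveOn_of_local hU fun m hm => ?_
  obtain ⟨O, hO, hmO, hf⟩ := h m hm
  have h1 := hf _ (chart_mem_atlas E m)
  have h2 : (chartAt E m).symm (chartAt E m m) = m := (chartAt E m).left_inv (mem_chart_source E m)
  have h3 : chartAt E m m ∈ (chartAt E m).target ∩ (chartAt E m).symm ⁻¹' O :=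
    ⟨mem_chart_target E m, by rwa [mem_preimage, h2]⟩
  exact ⟨_, chart_mem_atlas E m, mem_chart_source E m, _,
    (chartAt E m).isOpen_inter_preimage_symm hO, h3, h1.1, h1.2 _ h3⟩

theorem IsPrimitiveOn.continuousOn {α : OneForm E M 𝔥} {f : M → H} {U : Set M} (hU : IsOpen U)
    (h : IsPrimitiveOn α f U) : ContinuousOn f U := fun m hm => by
  have h1 := h _ (chart_mem_atlas E m)
  have hs := mem_chart_source E m
  have h2 : (chartAt E m).symm (chartAt E m m) = m := (chartAt E m).left_inv hs
  have h3 : chartAt E m m ∈ (chartAt E m).target ∩ (chartAt E m).symm ⁻¹' U :=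
    ⟨mem_chart_target E m, by rwa [mem_preimage, h2]⟩
  have h4 := h1.1.1.continuousAt (((chartAt E m).isOpen_inter_preimage_symm hU).mem_nhds h3)
  have h5 := ContinuousAt.comp (f := chartAt E m) h4 ((chartAt E m).continuousAt hs)
  refine (h5.congr ?_).continuousWithinAt
  filter_upwards [(chartAt E m).open_source.mem_nhds hs] with z hz
  simp only [Function.comp]
  rw [(chartAt E m).left_inv hz]

/-- Solutions of the Maurer–Cartan equation have local primitives. -/
theorem MaurerCartan.exists_isPrimitiveOn (hreg : ¬ FiniteDimensional ℝ 𝔥 → IsRegular 𝔥 H)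
    {α : OneForm E M 𝔥} (hα : MaurerCartan H α) (m : M) :
    ∃ U, IsOpen U ∧ m ∈ U ∧ ∃ f : M → H, IsPrimitiveOn α f U := by
  set e := chartAt E m with he
  have hea : e ∈ atlas E M := chart_mem_atlas E m
  obtain ⟨O, hO, hmO, hOe, F, hF, hlog⟩ := exists_local_primitive hreg e.open_target
    (mem_chart_target E m) (α.smooth e hea) (α.linSnd_rep hea) fun x hx v w => hα.rep hea hx v w
  have hFe : EqOn F (fun x => F (e (e.symm x))) O := fun x hx => by
    simp only; rw [e.right_inv (hOe hx)]
  refine ⟨e.source ∩ e ⁻¹' O, e.isOpen_inter_preimage hO, ⟨mem_chart_source E m, hmO⟩,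
    fun z => F (e z), isPrimitiveOn_of_local (e.isOpen_inter_preimage hO) fun z hz =>
      ⟨e, hea, hz.1, O, hO, hz.2, hF.congr hO hFe, fun v => ?_⟩⟩
  rw [← logD_congr (Filter.eventuallyEq_of_mem (hO.mem_nhds hz.2) hFe)]
  exact hlog _ hz.2 v

/-- Primitives are locally unique up to left translations. -/
theorem IsPrimitiveOn.div_eventuallyEq {α : OneForm E M 𝔥} {f f' : M → H} {U : Set M}
    (hU : IsOpen U) (h : IsPrimitiveOn α f U) (h' : IsPrimitiveOn α f' U) {m : M} (hm : m ∈ U) :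
    ∀ᶠ z in 𝓝 m, f z * (f' z)⁻¹ = f m * (f' m)⁻¹ := by
  set e := chartAt E m with he
  have hs : m ∈ e.source := mem_chart_source E m
  have hop := e.isOpen_inter_preimage_symm hU
  have hmt : e m ∈ e.target ∩ e.symm ⁻¹' U :=
    ⟨mem_chart_target E m, by rw [mem_preimage, e.left_inv hs]; exact hm⟩
  obtain ⟨C, hC, hconv, -, hCU⟩ := exists_closed_convex_nhds (hop.mem_nhds hmt)
  have h1 := h e (chart_mem_atlas E m)
  have h2 := h' e (chart_mem_atlas E m)
  filter_upwards [(e.continuousAt hs).preimage_mem_nhds hC, e.open_source.mem_nhds hs] with z hz hzs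
  have := h1.1.div_eq_of_logD_eq h2.1 hop (fun x hx v => by rw [h1.2 x hx, h2.2 x hx])
    (x := e z) (y := e m) ((hconv.segment_subset hz (mem_of_mem_nhds hC)).trans hCU)
  rwa [e.left_inv hzs, e.left_inv hs] at this

end FormsInCharts

section Primitives

variable {E M : Type*} [AddCommGroup E] [Module ℝ E] [TopologicalSpace E]
  [IsTopologicalAddGroup E] [ContinuousSMul ℝ E] [LocallyConvexSpace ℝ E] [T2Space E]
  [TopologicalSpace M] [ChartedSpace E M] [LCManifold E M]
  {𝔥 H : Type*} [AddCommGroup 𝔥] [Module ℝ 𝔥] [TopologicalSpace 𝔥]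
  [IsTopologicalAddGroup 𝔥] [ContinuousSMul ℝ 𝔥] [LocallyConvexSpace ℝ 𝔥] [T2Space 𝔥]
  [TopologicalSpace H] [T2Space H] [ChartedSpace 𝔥 H] [Group H] [LCLieGroup 𝔥 H]

/-! ### Momentum maps as primitives -/

/-- Reconciles the logarithmic derivative defined by tangent maps, in the charts at `m` and `J m`,
with the one computed in the chart at `1`. -/
theorem logDeriv_eq_logD {J : M → H} {m : M} {O : Set E} (hO : IsOpen O)
    (hm : chartAt E m m ∈ O) (hJ : SmoothInto 𝔥 (fun x => J ((chartAt E m).symm x)) O) (v : E) :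
    logDeriv E 𝔥 J m v = logD 𝔥 (fun x => J ((chartAt E m).symm x)) (chartAt E m m) v := by
  have hmm : (chartAt E m).symm (chartAt E m m) = m := (chartAt E m).left_inv (mem_chart_source E m)
  have hop := hJ.isOpen_inter hO (chartAt 𝔥 (J m)).open_source
  have hmO : chartAt E m m ∈ O ∩ (fun x => J ((chartAt E m).symm x)) ⁻¹'
      (chartAt 𝔥 (J m)).source := by
    refine ⟨hm, ?_⟩
    rw [mem_preimage, hmm]
    exact mem_chart_source 𝔥 _
  have h1 := (hJ.2 _ (chart_mem_atlas 𝔥 (J m))).hasDirDeriv hop hmO v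
  have h2 := (smoothInto_symm (chart_mem_atlas 𝔥 (J m))).logD_comp (chartAt 𝔥 (J m)).open_target
    (f := fun x => chartAt 𝔥 (J m) (J ((chartAt E m).symm x))) (y := chartAt E m m)
    ((chartAt 𝔥 (J m)).map_source hmO.2) h1
  have h3 : logDeriv E 𝔥 J m v = logD 𝔥 (chartAt 𝔥 (J m)).symm (chartAt 𝔥 (J m) (J m))
      (dirDeriv (fun x => chartAt 𝔥 (J m) (J ((chartAt E m).symm x))) (chartAt E m m) v) :=
    leftTranslateToOne_eq _ _
  simp only [hmm] at h2
  rw [h3, ← h2, logD]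
  refine dirDeriv_congr ?_ v
  filter_upwards [hop.mem_nhds hmO] with z hz
  rw [(chartAt 𝔥 (J m)).left_inv hz.2, (chartAt 𝔥 (J m)).left_inv (mem_chart_source 𝔥 _), hmm]

theorem isPrimitiveOn_univ_iff {α : OneForm E M 𝔥} {J : M → H} :
    IsPrimitiveOn α J univ ↔ SmoothBetween (atlas E M) (atlas 𝔥 H) J ∧
      ∀ m v, logDeriv E 𝔥 J m v = α.toFun m v := by
  constructor
  · intro h
    refine ⟨⟨continuousOn_univ.1 (h.continuousOn isOpen_univ), fun e he e' he' => ?_⟩,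
      fun m v => ?_⟩
    · refine ((h e he).1.2 e' he').mono fun x hx => ⟨⟨hx.1, trivial⟩, hx.2⟩
    · have h1 := h _ (chart_mem_atlas E m)
      have hm : chartAt E m m ∈ (chartAt E m).target ∩ (chartAt E m).symm ⁻¹' univ :=
        ⟨mem_chart_target E m, trivial⟩
      rw [logDeriv_eq_logD ((chartAt E m).isOpen_inter_preimage_symm isOpen_univ) hm h1.1,
        h1.2 _ hm, α.rep_chartAt]
  · rintro ⟨hJ, hlog⟩
    refine isPrimitiveOn_of_local isOpen_univ fun m _ => ?_
    have h1 : SmoothInto 𝔥 (fun x => J ((chartAt E m).symm x)) (chartAt E m).target :=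
      (smoothInto_symm (chart_mem_atlas E m)).smoothBetween hJ (chartAt E m).open_target
    refine ⟨_, chart_mem_atlas E m, mem_chart_source E m, _, (chartAt E m).open_target,
      mem_chart_target E m, h1, fun v => ?_⟩
    rw [← logDeriv_eq_logD (chartAt E m).open_target (mem_chart_target E m) h1, hlog,
      α.rep_chartAt]

/-- Skew symmetry of `ω` makes the momentum equation `κ (A, δJ - α) = 0` for all `A`; non-degeneracy
in the second argument gives `δJ = α`. -/
theorem IsDualSymplectic.isMomentumMap_iff {𝔤 G : Type*} [AddCommGroup 𝔤] [Module ℝ 𝔤]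
    [TopologicalSpace 𝔤] [TopologicalSpace G] [ChartedSpace 𝔤 G] [Group G] [MulAction G M]
    {ω : TwoForm E M} {κ : 𝔤 →ₗ[ℝ] 𝔥 →ₗ[ℝ] ℝ} (hκ : κ.Nondegenerate) {α : OneForm E M 𝔥}
    (hα : IsDualSymplectic G H ω κ α) {J : M → H} :
    IsMomentumMap G ω κ J ↔ IsPrimitiveOn α J univ := by
  rw [isPrimitiveOn_univ_iff]
  refine and_congr_right fun _ => ?_
  have hskew : ∀ m v w, ω.toFun m v w = -ω.toFun m w v := by
    intro m v w
    have h := ω.alternating m (v + w)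
    simp only [map_add, LinearMap.add_apply, ω.alternating, zero_add, add_zero] at h
    linarith
  constructor
  · intro h m v
    refine sub_eq_zero.1 (hκ.2 _ fun A => ?_)
    have h1 := h A m v
    have h2 := hα.1 A m v
    rw [hskew] at h1
    rw [map_sub]
    linarith
  · intro h A m v
    rw [h, hα.1, hskew]
    ring

/-! ### Primitives along curves -/

/-- `η` is locally the composition of `γ` with primitives of `α`. -/
def IsPrimitiveAlong {T : Type*} [TopologicalSpace T] (α : OneForm E M 𝔥) (γ : T → M) (η : T → H)
    (s : Set T) : Prop :=
  ∀ t ∈ s, ∃ U, IsOpen U ∧ γ t ∈ U ∧ ∃ f : M → H, IsPrimitiveOn α f U ∧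
    ∀ᶠ r in 𝓝[s] t, η r = f (γ r)

section Along

variable {T : Type*} [TopologicalSpace T] {α : OneForm E M 𝔥} {γ : T → M} {η η' : T → H} {s : Set T}

theorem IsPrimitiveAlong.comp {T' : Type*} [TopologicalSpace T'] {g : T' → T} {s' : Set T'}
    (h : IsPrimitiveAlong α γ η s) (hg : ContinuousOn g s') (hm : MapsTo g s' s) :
    IsPrimitiveAlong α (γ ∘ g) (η ∘ g) s' := by
  intro t ht
  obtain ⟨U, hU, hγ, f, hf, he⟩ := h (g t) (hm ht)
  exact ⟨U, hU, hγ, f, hf, ((hg t ht).tendsto_nhdsWithin hm).eventually he⟩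

theorem IsPrimitiveAlong.continuousOn (h : IsPrimitiveAlong α γ η s) (hγ : ContinuousOn γ s) :
    ContinuousOn η s := by
  intro t ht
  obtain ⟨U, hU, hγU, f, hf, he⟩ := h t ht
  have h1 := ((hf.continuousOn hU).continuousAt (hU.mem_nhds hγU)).comp_continuousWithinAt
    (f := γ) (hγ t ht)
  exact h1.congr_of_eventuallyEq he (he.self_of_nhdsWithin ht)

theorem IsPrimitiveAlong.div_eventuallyEq (h : IsPrimitiveAlong α γ η s)
    (h' : IsPrimitiveAlong α γ η' s) (hγ : ContinuousOn γ s) {t : T} (ht : t ∈ s) :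
    ∀ᶠ r in 𝓝[s] t, η r * (η' r)⁻¹ = η t * (η' t)⁻¹ := by
  obtain ⟨U, hU, hγU, f, hf, he⟩ := h t ht
  obtain ⟨U', hU', hγU', f', hf', he'⟩ := h' t ht
  have h1 := (hf.mono (inter_subset_left (t := U'))).div_eventuallyEq (hU.inter hU')
    (hf'.mono inter_subset_right) ⟨hγU, hγU'⟩
  filter_upwards [(hγ t ht).eventually h1, he, he'] with r h1 h2 h3
  rw [h2, h3, h1, he.self_of_nhdsWithin ht, he'.self_of_nhdsWithin ht]

/-- Primitives along a path are unique up to left translations. -/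
theorem IsPrimitiveAlong.div_eq (h : IsPrimitiveAlong α γ η s)
    (h' : IsPrimitiveAlong α γ η' s) (hγ : ContinuousOn γ s) (hs : IsPreconnected s) {t t' : T}
    (ht : t ∈ s) (ht' : t' ∈ s) : η t * (η' t)⁻¹ = η t' * (η' t')⁻¹ :=
  hs.induction₂ (fun x y => η x * (η' x)⁻¹ = η y * (η' y)⁻¹)
    (fun _ hx => (h.div_eventuallyEq h' hγ hx).mono fun _ hr => hr.symm)
    (fun _ _ _ _ _ _ h1 h2 => h1.trans h2) (fun _ _ _ _ h => h.symm) ht ht'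

end Along

/-- Near each parameter `η` is a smooth function of the coordinates of `γ`, so both claims follow
from the chain rule, endpoints included. -/
theorem IsPrimitiveAlong.smoothCurve {α : OneForm E M 𝔥} {γ : ℝ → M} {η : ℝ → H} {a b : ℝ}
    (hab : a < b) (hγ : SmoothCurve E γ (Icc a b)) (h : IsPrimitiveAlong α γ η (Icc a b)) :
    SmoothCurve 𝔥 η (Icc a b) ∧ ∀ t ∈ Icc a b,
      curveLogDeriv 𝔥 η (Icc a b) t = α.toFun (γ t) (velocity E γ (Icc a b) t) := by
  have hηc := h.continuousOn hγ.1
  have hchart : ∀ t ∈ Icc a b, ∃ U, IsOpen U ∧ ∃ f : M → H, IsPrimitiveOn α f U ∧ γ t ∈ U ∧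
      ∀ᶠ r in 𝓝[Icc a b] t, r ∈ Icc a b ∧ γ r ∈ (chartAt E (γ t)).source ∧ γ r ∈ U ∧
        η r = f ((chartAt E (γ t)).symm (chartAt E (γ t) (γ r))) := by
    intro t ht
    obtain ⟨U, hU, hγU, f, hf, he⟩ := h t ht
    refine ⟨U, hU, f, hf, hγU, ?_⟩
    filter_upwards [self_mem_nhdsWithin, (hγ.1 t ht).eventually
      ((chartAt E (γ t)).open_source.mem_nhds (mem_chart_source E _)),
      (hγ.1 t ht).eventually (hU.mem_nhds hγU), he] with r h0 h1 h2 h3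
    exact ⟨h0, h1, h2, by rw [(chartAt E (γ t)).left_inv h1, h3]⟩
  have hsm : SmoothCurve 𝔥 η (Icc a b) := by
    refine ⟨hηc, fun e' he' => SmoothCurveIn.of_local (fun t ht => ?_) fun t ht => ?_⟩
    · rw [nhdsWithin_inter_diff ((hηc t ht.1) (e'.open_source.mem_nhds ht.2))]
      exact neBot_Icc_diff hab ht.1
    · obtain ⟨U, hU, f, hf, hγU, he⟩ := hchart t ht.1
      obtain ⟨O, hO, htO, hsub⟩ := mem_nhdsWithin.1 he
      have hfe := (hf _ (chart_mem_atlas E (γ t))).1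
      have hop := hfe.isOpen_inter ((chartAt E (γ t)).isOpen_inter_preimage_symm hU) e'.open_source
      refine ⟨O, hO, htO, fun r => e' (f ((chartAt E (γ t)).symm (chartAt E (γ t) (γ r)))),
        fun r hr => ?_, ?_⟩
      · simp only [Function.comp]
        rw [(hsub ⟨hr.2, hr.1.1⟩).2.2.2]
      · refine (hfe.2 e' he').smoothCurveIn_comp hop (c := fun r => chartAt E (γ t) (γ r))
          ((hγ.2 _ (chart_mem_atlas E (γ t))).mono fun r hr =>
            ⟨hr.1.1, (hsub ⟨hr.2, hr.1.1⟩).2.1⟩) fun r hr => ?_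
        obtain ⟨-, h1, h2, h3⟩ := hsub ⟨hr.2, hr.1.1⟩
        refine ⟨⟨(chartAt E (γ t)).map_source h1, ?_⟩, ?_⟩
        · rw [mem_preimage, (chartAt E (γ t)).left_inv h1]; exact h2
        · rw [mem_preimage, ← h3]; exact hr.1.2
  refine ⟨hsm, fun t ht => ?_⟩
  have := neBot_Icc_diff hab ht
  obtain ⟨U, hU, f, hf, hγU, he⟩ := hchart t ht
  have hfe := hf _ (chart_mem_atlas E (γ t))
  have hmm : (chartAt E (γ t)).symm (chartAt E (γ t) (γ t)) = γ t :=
    (chartAt E (γ t)).left_inv (mem_chart_source E _)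
  have hmem : chartAt E (γ t) (γ t) ∈ (chartAt E (γ t)).target ∩ (chartAt E (γ t)).symm ⁻¹' U :=
    ⟨mem_chart_target E _, by rwa [mem_preimage, hmm]⟩
  have h1 := hfe.1.hasCurveLog_comp ((chartAt E (γ t)).isOpen_inter_preimage_symm hU)
    (c := fun r => chartAt E (γ t) (γ r)) hmem (hγ.hasCurveDeriv_velocity ht)
  rw [hfe.2 _ hmem, α.rep_chartAt] at h1
  refine HasCurveDeriv.unique (hsm.hasCurveLog ht) (HasCurveDeriv.congr h1 ?_ ?_)
  · filter_upwards [he] with r hr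
    rw [hr.2.2.2, (he.self_of_nhdsWithin ht).2.2.2]
  · simp

/-! ### The initial value problem along piecewise smooth paths -/

/-- Functions that are constant between finitely many break points are constant. -/
theorem eq_of_eq_between_breaks {Y : Type*} {g : ℝ → Y} {S : Finset ℝ}
    (h : ∀ a b : ℝ, 0 ≤ a → a < b → b ≤ 1 → Disjoint (Ioo a b) (S : Set ℝ) → g a = g b) :
    g 0 = g 1 := by
  have hloc : ∀ t : ℝ, ∃ δ > 0, Disjoint (Ioo (t - δ) t) (S : Set ℝ) ∧
      Disjoint (Ioo t (t + δ)) (S : Set ℝ) := by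
    intro t
    have h1 : ((S : Set ℝ) \ {t})ᶜ ∈ 𝓝 t :=
      (S.finite_toSet.subset sdiff_subset).isClosed.isOpen_compl.mem_nhds (by simp)
    obtain ⟨δ, hδ, hb⟩ := Metric.mem_nhds_iff.1 h1
    rw [Real.ball_eq_Ioo] at hb
    refine ⟨δ, hδ, ?_, ?_⟩ <;> rw [Set.disjoint_left] <;> intro r hr hrS
    · exact hb ⟨hr.1, by linarith [hr.2]⟩ ⟨hrS, hr.2.ne⟩
    · exact hb ⟨by linarith [hr.1], hr.2⟩ ⟨hrS, hr.1.ne'⟩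
  refine (isPreconnected_Icc (a := (0 : ℝ)) (b := 1)).induction₂ (fun x y => g x = g y)
    (fun t ht => ?_) (fun _ _ _ _ _ _ h1 h2 => h1.trans h2) (fun _ _ _ _ h => h.symm)
    (left_mem_Icc.2 zero_le_one) (right_mem_Icc.2 zero_le_one)
  obtain ⟨δ, hδ, h1, h2⟩ := hloc t
  rw [eventually_nhdsWithin_iff]
  filter_upwards [Metric.ball_mem_nhds t hδ] with r hr hrI
  rw [Real.ball_eq_Ioo] at hr
  rcases lt_trichotomy r t with hrt | rfl | hrt
  · exact (h r t hrI.1 hrt ht.2 (h1.mono_left (Ioo_subset_Ioo_left hr.1.le))).symm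
  · rfl
  · exact h t r ht.1 hrt hrI.2 (h2.mono_left (Ioo_subset_Ioo_right hr.2.le))

/-- On every interval free of the break points of both solutions, `η (η')⁻¹` is constant. -/
theorem SolvesLogIVP.apply_one_eq {α : OneForm E M 𝔥} {γ : ℝ → M} {η η' : ℝ → H}
    (h : SolvesLogIVP α γ η) (h' : SolvesLogIVP α γ η') : η 1 = η' 1 := by
  classical
  obtain ⟨hc, h0, S, hS⟩ := h
  obtain ⟨hc', h0', S', hS'⟩ := h'
  have := eq_of_eq_between_breaks (g := fun t => η t * (η' t)⁻¹) (S := S ∪ S') fun a b ha hab hb hd => by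
    rw [Finset.coe_union, disjoint_union_right] at hd
    obtain ⟨-, h1, h2⟩ := hS a b ha hab hb hd.1
    obtain ⟨-, h1', h2'⟩ := hS' a b ha hab hb hd.2
    have hne := fun t (ht : t ∈ Icc a b) => neBot_Icc_diff hab ht
    refine div_eq_of_hasCurveLog (𝔥 := 𝔥)
      (y := fun t => α.toFun (γ t) (velocity E γ (Icc a b) t)) h1.1 h1'.1 (fun t ht => ?_)
      (fun t ht => ?_) (left_mem_Icc.2 hab.le) (right_mem_Icc.2 hab.le)
    · have := hne t ht
      rw [← h2 t ht]; exact h1.hasCurveLog ht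
    · have := hne t ht
      rw [← h2' t ht]; exact h1'.hasCurveLog ht
  simp only [h0, h0', inv_one, mul_one] at this
  exact (mul_inv_eq_one.1 this.symm)

theorem IsPrimitiveAlong.solvesLogIVP {α : OneForm E M 𝔥} {γ : ℝ → M} {η : ℝ → H}
    (h : IsPrimitiveAlong α γ η (Icc 0 1)) (h0 : η 0 = 1) (hγ : PiecewiseSmooth E γ) :
    SolvesLogIVP α γ η := by
  obtain ⟨hc, S, hS⟩ := hγ
  refine ⟨h.continuousOn hc, h0, S, fun a b ha hab hb hd => ?_⟩
  have hsub : Icc a b ⊆ Icc 0 1 := Icc_subset_Icc ha hb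
  have h1 := hS a b ha hab hb hd
  exact ⟨h1, IsPrimitiveAlong.smoothCurve hab h1
    (h.comp (g := id) continuousOn_id hsub)⟩

end Primitives

/-! ### The covering of `M` by germs of primitives -/

/-- A type with the discrete topology. -/
@[ext] structure DiscreteCopy (Y : Type*) where
  /-- The underlying element. -/
  val : Y

instance (Y : Type*) : TopologicalSpace (DiscreteCopy Y) := ⊥

instance (Y : Type*) : DiscreteTopology (DiscreteCopy Y) := ⟨rfl⟩

section Covering

variable {E M : Type*} [AddCommGroup E] [Module ℝ E] [TopologicalSpace E]
  [IsTopologicalAddGroup E] [ContinuousSMul ℝ E] [LocallyConvexSpace ℝ E] [T2Space E]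
  [TopologicalSpace M] [ChartedSpace E M] [LCManifold E M]
  {𝔥 H : Type*} [AddCommGroup 𝔥] [Module ℝ 𝔥] [TopologicalSpace 𝔥]
  [IsTopologicalAddGroup 𝔥] [ContinuousSMul ℝ 𝔥] [LocallyConvexSpace ℝ 𝔥] [T2Space 𝔥]
  [TopologicalSpace H] [T2Space H] [ChartedSpace 𝔥 H] [Group H] [LCLieGroup 𝔥 H]

/-- The bundle of germs of primitives of `α`, with discrete fibre. The germ `h f` of a left
translate of the local primitive `f i` has the coordinate `h` in the `i`-th trivialization. -/
def primitiveBundle {α : OneForm E M 𝔥} {U : M → Set M} (hU : ∀ m, IsOpen (U m))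
    (hm : ∀ m, m ∈ U m) {f : M → M → H} (hf : ∀ m, IsPrimitiveOn α (f m) (U m)) :
    FiberBundleCore M M (DiscreteCopy H) where
  baseSet := U
  isOpen_baseSet := hU
  indexAt := id
  mem_baseSet_at := hm
  coordChange i j x h := ⟨h.val * f i x * (f j x)⁻¹⟩
  coordChange_self i x _ h := DiscreteCopy.ext (mul_inv_cancel_right h.val (f i x))
  -- With discrete fibre, continuity of the transition means that `f i (f j)⁻¹` is locally constant,
  -- which is local uniqueness of primitives.
  continuousOn_coordChange i j := by
    rintro ⟨x, h⟩ ⟨hx, -⟩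
    have h1 := ((hf i).mono inter_subset_left).div_eventuallyEq ((hU i).inter (hU j))
      ((hf j).mono inter_subset_right) hx
    have hc : ContinuousAt (fun _ : M × DiscreteCopy H =>
        (⟨h.val * f i x * (f j x)⁻¹⟩ : DiscreteCopy H)) (x, h) := continuousAt_const
    refine (hc.congr ?_).continuousWithinAt
    rw [nhds_prod_eq, nhds_discrete (DiscreteCopy H), prod_pure, EventuallyEq, eventually_map]
    filter_upwards [h1] with z hz
    simp only [mul_assoc, hz]
  coordChange_comp i j k x _ h := by
    simp only [inv_mul_cancel_right]

/-- `Θ γ` is the primitive of `α` along `γ` that starts at `1`; its endpoint depends only on the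
homotopy class of `γ`. -/
structure IsTransport (α : OneForm E M 𝔥) (Θ : C(I, M) → I → H) : Prop where
  along : ∀ γ : C(I, M), IsPrimitiveAlong α γ (Θ γ) univ
  zero : ∀ γ, Θ γ 0 = 1
  homotopic : ∀ γ₀ γ₁ : C(I, M), γ₀.HomotopicRel γ₁ {0, 1} → Θ γ₀ 1 = Θ γ₁ 1

/-- A bundle with discrete fibre is a covering, so every path lifts to a path of germs, and
evaluating these germs along the path gives the primitive. Homotopy lifting gives invariance of the
endpoint. -/
theorem exists_isTransport {α : OneForm E M 𝔥}
    (hloc : ∀ m, ∃ U, IsOpen U ∧ m ∈ U ∧ ∃ f : M → H, IsPrimitiveOn α f U) :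
    ∃ Θ : C(I, M) → I → H, IsTransport α Θ := by
  choose U hU hm f hf using hloc
  set Z := primitiveBundle hU hm hf with hZ
  have cov : IsCoveringMap (Bundle.TotalSpace.proj : Z.TotalSpace → M) :=
    FiberBundle.isCoveringMap (F := DiscreteCopy H) (E := Z.Fiber)
  -- `val` evaluates a germ at its base point, and `e m` is the germ at `m` with value `1`.
  let val : Z.TotalSpace → H := fun p => (p.2 : DiscreteCopy H).val * f p.1 p.1
  let e : M → Z.TotalSpace := fun m => ⟨m, (⟨(f m m)⁻¹⟩ : DiscreteCopy H)⟩
  have hval : ∀ m, val (e m) = 1 := fun m => inv_mul_cancel (f m m)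
  have he : ∀ m, m = (e m).proj := fun m => rfl
  refine ⟨fun (γ : C(I, M)) t => val (cov.liftPath γ (e (γ 0)) (he _) t),
    fun γ t _ => ?_, fun γ => ?_, fun γ₀ γ₁ h => ?_⟩
  · set Γ := cov.liftPath γ (e (γ 0)) (he _) with hΓ
    have hproj : ∀ r, (Γ r).proj = γ r := fun r => congrFun (cov.liftPath_lifts γ _ (he _)) r
    set i := γ t with hi
    have hcont : ContinuousAt (fun r => (Z.localTriv i (Γ r)).2) t := by
      have h1 : ContinuousAt (Z.localTriv i) (Γ t) := by
        refine (Z.localTriv i).continuousAt ?_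
        rw [(Z.localTriv i).mem_source]
        change (Γ t).proj ∈ U i
        rw [hproj]
        exact hm i
      exact (ContinuousAt.comp (f := Γ) h1 Γ.continuous.continuousAt).snd
    -- The fibre coordinate of the lift is locally constant, so nearby the lift stays on one left
    -- translate of `f i`.
    have hev : ∀ᶠ r in 𝓝 t, (Z.localTriv i (Γ r)).2 = (Z.localTriv i (Γ t)).2 := by
      have := hcont.tendsto
      rw [nhds_discrete (DiscreteCopy H), tendsto_pure] at this
      exact this
    refine ⟨U i, hU i, hm i, _, (hf i).mul_left (hU i) (Z.localTriv i (Γ t)).2.val, ?_⟩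
    rw [nhdsWithin_univ]
    filter_upwards [hev] with r hr
    rw [← hr, ← hproj r]
    change _ = (val (Γ r) * (f i (Γ r).proj)⁻¹) * f i (Γ r).proj
    rw [inv_mul_cancel_right]
  · rw [cov.liftPath_zero, hval]
  · have h0 : γ₀ 0 = γ₁ 0 := h.some.fst_eq_snd (by simp)
    have := cov.liftPath_apply_one_eq_of_homotopicRel h (e (γ₀ 0)) (he _) (h0.symm.trans (he _))
    rw [this]
    congr 3
    rw [h0]

end Covering

/-! ### Piecewise smooth representatives of homotopy classes -/

section PiecewiseSmooth

variable {E M : Type*} [AddCommGroup E] [Module ℝ E] [TopologicalSpace E]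
  [IsTopologicalAddGroup E] [ContinuousSMul ℝ E] [LocallyConvexSpace ℝ E] [T2Space E]
  [TopologicalSpace M] [ChartedSpace E M]

theorem SmoothCurve.congr {γ γ' : ℝ → M} {s : Set ℝ} (h : SmoothCurve E γ s) (heq : EqOn γ γ' s) :
    SmoothCurve E γ' s := by
  refine ⟨h.1.congr heq.symm, fun e he => ?_⟩
  obtain ⟨d, h0, hd⟩ := h.2 e he
  have hs : s ∩ γ' ⁻¹' e.source = s ∩ γ ⁻¹' e.source := by
    ext r
    refine and_congr_right fun hr => ?_
    rw [mem_preimage, mem_preimage, heq hr]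
  rw [hs]
  -- Only the zeroth term is replaced: it must equal the curve as a function on all of `ℝ`, while
  -- the curves agree only on `s`.
  refine ⟨fun k => if k = 0 then e ∘ γ' else d k, by simp, fun k t ht => ?_⟩
  rcases k with _ | k
  · have h1 := hd 0 t ht
    rw [h0] at h1
    refine h1.congr ?_ ?_
    · filter_upwards [self_mem_nhdsWithin] with r hr
      simp [heq hr.1]
    · simp [heq ht.1]
  · simpa using hd (k + 1) t ht

theorem SmoothCurve.comp_affine {γ : ℝ → M} {s s' : Set ℝ} {k m : ℝ} (h : SmoothCurve E γ s)
    (hs : ∀ r ∈ s', k * r + m ∈ s) (hk : k ≠ 0) : SmoothCurve E (fun r => γ (k * r + m)) s' :=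
  ⟨h.1.comp (by fun_prop) hs, fun e he =>
    (h.2 e he).comp_affine (s' := s' ∩ (fun r => γ (k * r + m)) ⁻¹' e.source)
      (fun r hr => ⟨hs r hr.1, hr.2⟩) hk⟩

theorem PiecewiseSmooth.trans {x y z : M} {γ : Path x y} {γ' : Path y z}
    (h : PiecewiseSmooth E γ.extend) (h' : PiecewiseSmooth E γ'.extend) :
    PiecewiseSmooth E (γ.trans γ').extend := by
  classical
  obtain ⟨-, S, hS⟩ := h
  obtain ⟨-, S', hS'⟩ := h'
  refine ⟨(γ.trans γ').continuous_extend.continuousOn,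
    insert (1 / 2) (S.image (fun r => r / 2) ∪ S'.image fun r => (r + 1) / 2),
    fun a b ha hab hb hd => ?_⟩
  rw [Set.disjoint_left] at hd
  -- The midpoint is a break point, so an admissible interval lies in one half.
  have hhalf : b ≤ 1 / 2 ∨ 1 / 2 ≤ a := by
    by_contra! hcon
    exact hd ⟨hcon.2, hcon.1⟩ (by simp)
  rcases hhalf with hb' | ha'
  · have h1 := hS (2 * a) (2 * b) (by linarith) (by linarith) (by linarith) (by
      rw [Set.disjoint_left]
      intro r hr hrS
      refine hd (a := r / 2) ⟨by linarith [hr.1], by linarith [hr.2]⟩ ?_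
      simp only [Finset.coe_insert, Finset.coe_union, Finset.coe_image]
      exact Or.inr (Or.inl ⟨r, hrS, rfl⟩))
    refine (h1.comp_affine (s' := Icc a b) (k := 2) (m := 0) (fun r hr =>
      ⟨by linarith [hr.1], by linarith [hr.2]⟩) two_ne_zero).congr fun r hr => ?_
    have hr0 : r ∈ I := ⟨by linarith [hr.1], by linarith [hr.2]⟩
    have hr1 : 2 * r + 0 ∈ I := ⟨by linarith [hr.1], by linarith [hr.2]⟩
    simp only
    rw [Path.extend_apply _ hr0, Path.extend_apply _ hr1, Path.trans_apply,
      dif_pos (by simpa using hr.2.trans hb')]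
    congr 2
    simp
  · have h1 := hS' (2 * a - 1) (2 * b - 1) (by linarith) (by linarith) (by linarith) (by
      rw [Set.disjoint_left]
      intro r hr hrS
      refine hd (a := (r + 1) / 2) ⟨by linarith [hr.1], by linarith [hr.2]⟩ ?_
      simp only [Finset.coe_insert, Finset.coe_union, Finset.coe_image]
      exact Or.inr (Or.inr ⟨r, hrS, rfl⟩))
    refine (h1.comp_affine (s' := Icc a b) (k := 2) (m := -1) (fun r hr =>
      ⟨by linarith [hr.1], by linarith [hr.2]⟩) two_ne_zero).congr fun r hr => ?_
    have hr0 : r ∈ I := ⟨by linarith [hr.1], by linarith [hr.2]⟩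
    have hr1 : 2 * r + -1 ∈ I := ⟨by linarith [hr.1], by linarith [hr.2]⟩
    simp only
    rw [Path.extend_apply _ hr0, Path.extend_apply _ hr1, Path.trans_apply]
    split_ifs with hle
    -- At the midpoint the concatenation is evaluated on the first path; its endpoint is the start
    -- of the second.
    · have hr2 : r = 1 / 2 := le_antisymm hle (ha'.trans hr.1)
      subst hr2
      have e1 : (⟨2 * (1 / 2) + -1, hr1⟩ : I) = 0 := by ext; norm_num
      have e2 : ∀ h, (⟨2 * (1 / 2), h⟩ : I) = 1 := fun h => by ext; norm_num
      rw [e1, γ'.source]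
      simp only [e2, γ.target]
    · congr 2

variable [LCManifold E M]

/-- A set that is convex in a chart. -/
def IsChartConvex (E : Type*) {M : Type*} [AddCommGroup E] [Module ℝ E] [TopologicalSpace E]
    [TopologicalSpace M] [ChartedSpace E M] (U : Set M) : Prop :=
  ∃ e ∈ atlas E M, ∃ C : Set E, Convex ℝ C ∧ C ⊆ e.target ∧ U = e.source ∩ e ⁻¹' C

theorem exists_isChartConvex {m : M} {O : Set M} (hO : O ∈ 𝓝 m) :
    ∃ U, IsOpen U ∧ m ∈ U ∧ U ⊆ O ∧ IsChartConvex E U := by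
  set e := chartAt E m
  have hs : m ∈ e.source := mem_chart_source E m
  have h1 : e.target ∩ e.symm ⁻¹' O ∈ 𝓝 (e m) := by
    refine inter_mem (e.open_target.mem_nhds (e.map_source hs)) ?_
    refine (e.continuousAt_symm (e.map_source hs)).preimage_mem_nhds ?_
    rwa [e.left_inv hs]
  obtain ⟨C, hC, hconv, -, hCO⟩ := exists_closed_convex_nhds h1
  refine ⟨e.source ∩ e ⁻¹' interior C, e.isOpen_inter_preimage isOpen_interior,
    ⟨hs, mem_interior_iff_mem_nhds.2 hC⟩, fun z hz => ?_, e, chart_mem_atlas E m, _,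
    hconv.interior, fun x hx => (hCO (interior_subset hx)).1, rfl⟩
  have := (hCO (interior_subset hz.2)).2
  rwa [mem_preimage, e.left_inv hz.1] at this

theorem smoothCurve_chart_segment {e : OpenPartialHomeomorph M E} (he : e ∈ atlas E M) {p v : E}
    {s : Set ℝ} (hs : ∀ t ∈ s, p + t • v ∈ e.target) :
    SmoothCurve E (fun t => e.symm (p + t • v)) s := by
  have hF := smoothInto_symm he
  refine ⟨hF.1.comp (by fun_prop) hs, fun e' he' => ?_⟩
  have hc : SmoothCurveIn (fun t : ℝ => p + t • v) (s ∩ (fun t => e.symm (p + t • v)) ⁻¹' e'.source) := by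
    refine ⟨fun k => match k with
      | 0 => fun t => p + t • v
      | 1 => fun _ => v
      | _ + 2 => fun _ => 0, rfl, fun k t _ => ?_⟩
    rcases k with _ | _ | k
    · exact hasCurveDeriv_segment p v _ t
    · exact hasCurveDeriv_const v _ t
    · exact hasCurveDeriv_const 0 _ t
  exact (hF.2 e' he').smoothCurveIn_comp (hF.isOpen_inter e.open_target e'.open_source) hc
    fun t ht => ⟨hs t ht.1, ht.2⟩

/-- A path in a set that is convex in a chart is homotopic to a piecewise smooth path. -/
theorem IsChartConvex.exists_homotopic {U : Set M} (hU : IsChartConvex E U) {x y : M}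
    (γ : Path x y) (hγ : ∀ t, γ t ∈ U) :
    ∃ γ' : Path x y, γ.Homotopic γ' ∧ PiecewiseSmooth E γ'.extend ∧ ∀ t, γ' t ∈ U := by
  obtain ⟨e, he, C, hconv, hC, rfl⟩ := hU
  have hx := hγ 0
  have hy := hγ 1
  rw [γ.source] at hx
  rw [γ.target] at hy
  have hseg : ∀ t ∈ I, e x + t • (e y - e x) ∈ C := fun t ht => hconv.add_smul_sub_mem hx.2 hy.2 ht
  have hcont : Continuous fun t : I => e.symm (e x + (t : ℝ) • (e y - e x)) :=
    e.continuousOn_symm.comp_continuous (by fun_prop) fun t => hC (hseg t t.2)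
  let γ' : Path x y :=
    { toFun := fun t => e.symm (e x + (t : ℝ) • (e y - e x))
      continuous_toFun := hcont
      source' := by simp [e.left_inv hx.1]
      target' := by simp [e.left_inv hy.1] }
  -- Straight-line homotopy in the chart from `γ` to the segment between its endpoints.
  refine ⟨γ', ⟨⟨⟨⟨fun q => e.symm (e (γ q.2) + (q.1 : ℝ) •
    ((e x + (q.2 : ℝ) • (e y - e x)) - e (γ q.2))), ?_⟩, fun t => ?_, fun t => ?_⟩, ?_⟩⟩, ?_, ?_⟩
  · have h1 : Continuous fun t => e (γ t) :=
      e.continuousOn.comp_continuous γ.continuous fun t => (hγ t).1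
    have h2 : Continuous fun q : I × I => e (γ q.2) := h1.comp continuous_snd
    have h3 : Continuous fun q : I × I => e x + (q.2 : ℝ) • (e y - e x) := by fun_prop
    refine e.continuousOn_symm.comp_continuous (h2.add
      ((continuous_subtype_val.comp continuous_fst).smul (h3.sub h2))) fun q => hC ?_
    exact hconv.add_smul_sub_mem (hγ q.2).2 (hseg _ q.2.2) q.1.2
  · simp [e.left_inv (hγ t).1]
  · simp [γ']
  · rintro t r (rfl | rfl)
    · simp [e.left_inv hx.1]
    · simp [e.left_inv hy.1]
  · refine ⟨γ'.continuous_extend.continuousOn, ∅, fun a b ha hab hb _ => ?_⟩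
    have hsub : Icc a b ⊆ I := Icc_subset_Icc ha hb
    refine (smoothCurve_chart_segment he (p := e x) (v := e y - e x)
      fun t ht => hC (hseg t (hsub ht))).congr fun t ht => ?_
    rw [Path.extend_apply _ (hsub ht)]
    rfl
  · intro t
    refine ⟨e.map_target (hC (hseg t t.2)), ?_⟩
    change e (e.symm _) ∈ C
    rw [e.right_inv (hC (hseg t t.2))]
    exact hseg t t.2

/-- Every path is homotopic to a piecewise smooth path. -/
theorem exists_piecewiseSmooth_homotopic {x y : M} (γ : Path x y) :
    ∃ γ' : Path x y, γ.Homotopic γ' ∧ PiecewiseSmooth E γ'.extend := by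
  have hU : ∀ m : M, ∃ U, IsOpen U ∧ m ∈ U ∧ IsChartConvex E U := fun m =>
    let ⟨U, h1, h2, _, h3⟩ := exists_isChartConvex (E := E) (univ_mem (f := 𝓝 m))
    ⟨U, h1, h2, h3⟩
  choose U hUo hmU hUc using hU
  obtain ⟨t, ht0, htm, ⟨n, hn⟩, hsub⟩ := exists_monotone_Icc_subset_open_cover_unitInterval
    (c := fun r : I => γ ⁻¹' U (γ r)) (fun r => (hUo _).preimage γ.continuous)
    fun r _ => mem_iUnion.2 ⟨r, hmU _⟩
  -- Induction over the partition points: each subpath lies in one chart-convex set and is replaced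
  -- by a segment.
  have key : ∀ k, ∃ γ' : Path (γ 0) (γ (t k)), (γ.subpath 0 (t k)).Homotopic γ' ∧
      PiecewiseSmooth E γ'.extend := by
    intro k
    induction k with
    | zero =>
      rw [ht0]
      obtain ⟨γ', h1, h2, -⟩ := (hUc (γ 0)).exists_homotopic (γ.subpath 0 0) (by simp [hmU])
      exact ⟨γ', h1, h2⟩
    | succ k ih =>
      obtain ⟨γ₁, h1, h2⟩ := ih
      obtain ⟨r, hr⟩ := hsub k
      obtain ⟨γ₂, h3, h4, -⟩ := (hUc (γ r)).exists_homotopic (γ.subpath (t k) (t (k + 1)))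
        (fun s => by
          have h5 := mem_range_self (f := γ.subpath (t k) (t (k + 1))) s
          rw [Path.range_subpath_of_le _ _ _ (htm k.le_succ)] at h5
          obtain ⟨s', hs', heq⟩ := h5
          rw [← heq]
          exact hr hs')
      exact ⟨γ₁.trans γ₂, Path.Homotopic.trans
        ⟨(Path.Homotopy.subpathTransSubpath γ 0 (t k) (t (k + 1))).symm⟩ (h1.hcomp h3), h2.trans h4⟩
  have h1 := key n
  rw [hn n le_rfl] at h1
  obtain ⟨γ', h2, h3⟩ := h1
  rw [Path.subpath_zero_one] at h2
  obtain ⟨F⟩ := h2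
  exact ⟨γ'.cast γ.source.symm γ.target.symm, ⟨F⟩, h3⟩

end PiecewiseSmooth

/-! ### The period homomorphism -/

section Period

variable {E M : Type*} [AddCommGroup E] [Module ℝ E] [TopologicalSpace E]
  [IsTopologicalAddGroup E] [ContinuousSMul ℝ E] [LocallyConvexSpace ℝ E] [T2Space E]
  [TopologicalSpace M] [ChartedSpace E M] [LCManifold E M]
  {𝔥 H : Type*} [AddCommGroup 𝔥] [Module ℝ 𝔥] [TopologicalSpace 𝔥]
  [IsTopologicalAddGroup 𝔥] [ContinuousSMul ℝ 𝔥] [LocallyConvexSpace ℝ 𝔥] [T2Space 𝔥]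
  [TopologicalSpace H] [T2Space H] [ChartedSpace 𝔥 H] [Group H] [LCLieGroup 𝔥 H]
  {α : OneForm E M 𝔥} {Θ : C(I, M) → I → H}

theorem IsTransport.apply_one_eq (hΘ : IsTransport α Θ) {x y : M} (γ : Path x y) {η : I → H}
    (h : IsPrimitiveAlong α γ η univ) : η 1 = η 0 * Θ γ 1 := by
  have := h.div_eq (hΘ.along γ) γ.continuous.continuousOn isPreconnected_univ (mem_univ 1)
    (mem_univ 0)
  rw [hΘ.zero, inv_one, mul_one] at this
  rw [← this, inv_mul_cancel_right]

/-- Restricted to the two halves, the transport of the concatenation is a primitive along each path.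
The second one starts at `Θ γ 1` and is therefore the left translate of `Θ γ'` by it. -/
theorem IsTransport.trans (hΘ : IsTransport α Θ) {x y z : M} (γ : Path x y) (γ' : Path y z) :
    Θ (γ.trans γ') 1 = Θ γ 1 * Θ γ' 1 := by
  have h := hΘ.along (γ.trans γ')
  let g : I → I := fun t => ⟨t / 2, by linarith [t.2.1], by linarith [t.2.2]⟩
  let g' : I → I := fun t => ⟨(1 + t) / 2, by linarith [t.2.1], by linarith [t.2.2]⟩
  have hg : Continuous g := by fun_prop
  have hg' : Continuous g' := by fun_prop
  have e1 : (γ.trans γ') ∘ g = γ := by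
    ext t
    simp only [Function.comp, g]
    rw [Path.trans_apply, dif_pos (by simp only; linarith [t.2.2])]
    congr 1
    ext
    simp only
    ring
  have e2 : (γ.trans γ') ∘ g' = γ' := by
    ext t
    simp only [Function.comp, g']
    rw [Path.trans_apply]
    split_ifs with hle
    · have ht : t = 0 := by
        ext
        simp only at hle
        have : (t : ℝ) ≤ 0 := by linarith
        exact le_antisymm this t.2.1
      subst ht
      rw [γ'.source]
      convert γ.target using 2
      ext
      simp
    · congr 1
      ext
      simp only
      ring
  have h1 := h.comp hg.continuousOn (mapsTo_univ _ univ)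
  have h2 := h.comp hg'.continuousOn (mapsTo_univ _ univ)
  have c : ⇑((γ.trans γ' : Path x z) : C(I, M)) = γ.trans γ' := rfl
  rw [c, e1] at h1
  rw [c, e2] at h2
  have k1 := hΘ.apply_one_eq γ h1
  have k2 := hΘ.apply_one_eq γ' h2
  have g0 : g 0 = 0 := by ext; simp [g]
  have g1 : g 1 = g' 0 := by ext; simp [g, g']
  have g2 : g' 1 = 1 := by ext; norm_num [g']
  simp only [Function.comp, g0, g1, g2, hΘ.zero, one_mul] at k1 k2
  rw [k2, k1]

theorem IsTransport.eq_mul (hΘ : IsTransport α Θ) {U : Set M} (hU : IsOpen U) {f : M → H}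
    (hf : IsPrimitiveOn α f U) {x y : M} (γ : Path x y) (hγ : ∀ t, γ t ∈ U) :
    f y = f x * Θ γ 1 := by
  have := hΘ.apply_one_eq γ (η := f ∘ γ) fun t _ => ⟨U, hU, hγ t, f, hf, Eventually.of_forall
    fun _ => rfl⟩
  simpa using this

theorem IsTransport.homotopic_path (hΘ : IsTransport α Θ) {x y : M} {γ γ' : Path x y}
    (h : γ.Homotopic γ') : Θ γ 1 = Θ γ' 1 := hΘ.homotopic _ _ h

theorem IsTransport.refl (hΘ : IsTransport α Θ) (x : M) : Θ (Path.refl x) 1 = 1 := by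
  have h := hΘ.trans (Path.refl x) (Path.refl x)
  rw [hΘ.homotopic_path ⟨Path.Homotopy.transRefl (Path.refl x)⟩] at h
  -- The transport of the constant path is idempotent, hence `1`.
  exact left_eq_mul.1 h

/-- The period homomorphism. -/
def IsTransport.periodHom (hΘ : IsTransport α Θ) (m₀ : M) : (FundamentalGroup M m₀)ᵐᵒᵖ →* H where
  toFun p := (FundamentalGroup.toPath p.unop).lift (fun γ : Path m₀ m₀ => Θ γ 1)
    fun _ _ h => hΘ.homotopic_path h
  map_one' := hΘ.refl m₀
  map_mul' := by
    rintro ⟨p⟩ ⟨q⟩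
    induction p using Quotient.inductionOn with | _ γ => ?_
    induction q using Quotient.inductionOn with | _ γ' => ?_
    exact hΘ.trans γ γ'

theorem IsTransport.periodHom_apply (hΘ : IsTransport α Θ) {m₀ : M} (γ : Path m₀ m₀) :
    hΘ.periodHom m₀ (MulOpposite.op (FundamentalGroup.fromPath (Path.Homotopic.Quotient.mk γ)))
      = Θ γ 1 := rfl

theorem IsTransport.solvesLogIVP (hΘ : IsTransport α Θ) {x y : M} (γ : Path x y)
    (hγ : PiecewiseSmooth E γ.extend) :
    SolvesLogIVP α γ.extend (IccExtend zero_le_one (Θ γ)) := by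
  refine IsPrimitiveAlong.solvesLogIVP ?_ ?_ hγ
  · exact (hΘ.along γ).comp continuous_projIcc.continuousOn (mapsTo_univ _ _)
  · rw [IccExtend_left]
    exact hΘ.zero _

theorem IsTransport.isPeriodHom (hΘ : IsTransport α Θ) (m₀ : M) :
    IsPeriodHom α m₀ (hΘ.periodHom m₀) := fun γ hγ => by
  have h := hΘ.solvesLogIVP γ hγ
  refine ⟨⟨_, h⟩, fun η hη => ?_⟩
  rw [hη.apply_one_eq h, IccExtend_right, hΘ.periodHom_apply]
  rfl

/-- The defining property only constrains piecewise smooth loops, but every class contains one. -/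
theorem IsPeriodHom.unique {m₀ : M} {per per' : (FundamentalGroup M m₀)ᵐᵒᵖ →* H}
    (h : IsPeriodHom α m₀ per) (h' : IsPeriodHom α m₀ per') : per = per' := by
  ext p
  obtain ⟨p, rfl⟩ := MulOpposite.op_surjective p
  induction p using Quotient.inductionOn with | _ γ => ?_
  obtain ⟨γ', hγ', hps⟩ := exists_piecewiseSmooth_homotopic (E := E) γ
  obtain ⟨⟨η, hη⟩, h1⟩ := h γ' hps
  have h2 := (h' γ' hps).2 η hη
  have h3 : Path.Homotopic.Quotient.mk γ = Path.Homotopic.Quotient.mk γ' :=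
    Path.Homotopic.Quotient.eq.2 hγ'
  have h4 := (h1 η hη).trans h2.symm
  rw [← h3] at h4
  exact h4

/-- A form with trivial periods has a primitive. -/
theorem IsTransport.exists_primitive [ConnectedSpace M]
    (hloc : ∀ m, ∃ U, IsOpen U ∧ m ∈ U ∧ ∃ f : M → H, IsPrimitiveOn α f U)
    (hΘ : IsTransport α Θ) {m₀ : M} (h : hΘ.periodHom m₀ = 1) :
    ∃ J : M → H, IsPrimitiveOn α J univ := by
  -- Local path connectedness passes from the model space to `M`, so `M`, being connected, is path
  -- connected.
  have hlp : LocallyPathConnectedSpace E := inferInstance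
  have : LocallyPathConnectedSpace M := ChartedSpace.locallyPathConnectedSpace E M
  have : PathConnectedSpace M := pathConnectedSpace_iff_connectedSpace.2 inferInstance
  have hend : ∀ {x : M} (γ γ' : Path m₀ x), Θ γ 1 = Θ γ' 1 := by
    intro x γ γ'
    have h1 : Θ (γ.trans γ'.symm) 1 = 1 := by
      rw [← hΘ.periodHom_apply, h]; rfl
    have h2 : Θ (γ'.symm.trans γ') 1 = 1 := by
      rw [← hΘ.refl x]
      exact hΘ.homotopic_path ⟨(Path.Homotopy.reflSymmTrans γ').symm⟩
    rw [hΘ.trans] at h1 h2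
    rw [eq_inv_of_mul_eq_one_left h1, ← eq_inv_of_mul_eq_one_right h2]
  -- The chosen paths need not depend continuously on `m`; by `hend` only the endpoint matters.
  let δ : ∀ m, Path m₀ m := fun m => PathConnectedSpace.somePath m₀ m
  refine ⟨fun m => Θ (δ m) 1, IsPrimitiveOn.of_local isOpen_univ fun m _ => ?_⟩
  obtain ⟨O, hO, hmO, f, hf⟩ := hloc m
  -- Points `z` of this component are joined to `m` inside `O`, where transport is read off from
  -- `f`; so `J` is there a left translate of `f`.
  have hW : IsOpen (pathComponentIn O m) := hO.pathComponentIn m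
  refine ⟨pathComponentIn O m, hW, mem_pathComponentIn_self hmO,
    ((hf.mono pathComponentIn_subset).mul_left hW (Θ (δ m) 1 * (f m)⁻¹)).congr hW fun z hz => ?_⟩
  obtain ⟨γ, hγ⟩ := hz
  rw [hend (δ z) ((δ m).trans γ), hΘ.trans, hΘ.eq_mul hO hf γ hγ, mul_assoc, inv_mul_cancel_left]

/-- Transport along a loop satisfies `J m₀ = J m₀ * Θ γ 1`. -/
theorem IsPrimitiveOn.periodHom_eq_one {J : M → H} (hJ : IsPrimitiveOn α J univ)
    (hΘ : IsTransport α Θ) (m₀ : M) : hΘ.periodHom m₀ = 1 := by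
  ext p
  obtain ⟨p, rfl⟩ := MulOpposite.op_surjective p
  induction p using Quotient.inductionOn with | _ γ => ?_
  exact left_eq_mul.1 (hΘ.eq_mul isOpen_univ hJ γ fun _ => trivial)

theorem IsPrimitiveOn.exists_eq_mul [ConnectedSpace M] {J J' : M → H}
    (hJ : IsPrimitiveOn α J univ) (hJ' : IsPrimitiveOn α J' univ) : ∃ h : H, ∀ m, J' m = h * J m := by
  have hc : IsLocallyConstant fun m => J' m * (J m)⁻¹ :=
    (IsLocallyConstant.iff_eventually_eq _).2 fun m =>
      hJ'.div_eventuallyEq isOpen_univ hJ (mem_univ m)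
  obtain ⟨m₀⟩ := (inferInstance : Nonempty M)
  exact ⟨J' m₀ * (J m₀)⁻¹, fun m => by
    rw [hc.apply_eq_of_preconnectedSpace m₀ m, inv_mul_cancel_right]⟩

end Period

end LCGeometry

end

theorem mainTheorem5
    {E M 𝔤 G 𝔥 H : Type*}
    [AddCommGroup E] [Module ℝ E] [TopologicalSpace E] [IsTopologicalAddGroup E]
    [ContinuousSMul ℝ E] [LocallyConvexSpace ℝ E] [T2Space E]
    [TopologicalSpace M] [T2Space M] [ConnectedSpace M] [ChartedSpace E M]
    [LCGeometry.LCManifold E M]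
    [AddCommGroup 𝔤] [Module ℝ 𝔤] [TopologicalSpace 𝔤] [IsTopologicalAddGroup 𝔤]
    [ContinuousSMul ℝ 𝔤] [LocallyConvexSpace ℝ 𝔤] [T2Space 𝔤]
    [TopologicalSpace G] [T2Space G] [ChartedSpace 𝔤 G] [Group G] [LCGeometry.LCLieGroup 𝔤 G]
    [AddCommGroup 𝔥] [Module ℝ 𝔥] [TopologicalSpace 𝔥] [IsTopologicalAddGroup 𝔥]
    [ContinuousSMul ℝ 𝔥] [LocallyConvexSpace ℝ 𝔥] [T2Space 𝔥]
    [TopologicalSpace H] [T2Space H] [ChartedSpace 𝔥 H] [Group H] [LCGeometry.LCLieGroup 𝔥 H]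
    [MulAction G M]
    (hact : LCGeometry.SmoothBetween (LCGeometry.prodAtlas 𝔤 G E M) (atlas E M)
      (fun p : G × M => p.1 • p.2))
    (ω : LCGeometry.TwoForm E M) (hω : ω.IsSymplectic)
    (κ : 𝔤 →ₗ[ℝ] 𝔥 →ₗ[ℝ] ℝ) (hκ : κ.Nondegenerate)
    (hreg : ¬ FiniteDimensional ℝ 𝔥 → LCGeometry.IsRegular 𝔥 H)
    (α : LCGeometry.OneForm E M 𝔥) (hα : LCGeometry.IsDualSymplectic G H ω κ α)
    (m₀ : M) :
    (∃! per : (FundamentalGroup M m₀)ᵐᵒᵖ →* H, LCGeometry.IsPeriodHom α m₀ per) ∧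
    (∀ per : (FundamentalGroup M m₀)ᵐᵒᵖ →* H, LCGeometry.IsPeriodHom α m₀ per →
      ((∃ J : M → H, LCGeometry.IsMomentumMap G ω κ J) ↔ per = 1)) ∧
    (∀ J : M → H, LCGeometry.IsMomentumMap G ω κ J →
      ∀ J' : M → H, LCGeometry.IsMomentumMap G ω κ J' ↔ ∃ h : H, ∀ m : M, J' m = h * J m) := by

  obtain ⟨Θ, hΘ⟩ := LCGeometry.exists_isTransport fun m => hα.2.exists_isPrimitiveOn hreg m
  refine ⟨⟨hΘ.periodHom m₀, hΘ.isPeriodHom m₀, fun per h => h.unique (hΘ.isPeriodHom m₀)⟩,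
    fun per h => ?_, fun J hJ J' => ?_⟩
  · rw [h.unique (hΘ.isPeriodHom m₀)]
    simp only [LCGeometry.IsDualSymplectic.isMomentumMap_iff hκ hα]
    exact ⟨fun ⟨J, hJ⟩ => hJ.periodHom_eq_one hΘ m₀, fun h1 =>
      hΘ.exists_primitive (fun m => hα.2.exists_isPrimitiveOn hreg m) h1⟩
  · rw [LCGeometry.IsDualSymplectic.isMomentumMap_iff hκ hα] at hJ ⊢
    refine ⟨fun hJ' => hJ.exists_eq_mul hJ', fun ⟨h, hh⟩ => ?_⟩
    rw [show J' = fun m => h * J m from funext hh]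
    exact hJ.mul_left isOpen_univ h
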